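/- Let $A$ be a smooth proper differential graded (dg) $\mathbb C$-algebra: the total cohomology of $A$ is finite-dimensional, and the diagonal bimodule $A$ lies in the thick subcategory of the derived category of dg $A$-bimodules generated by $A\otimes_{\mathbb C}A$. Let $\mathcal T$ be a $\mathbb C$-linear triangulated category equivalent to the perfect derived category $\mathrm{perf}(A)$, i.e. the thick subcategory generated by $A$ in the derived category of right dg $A$-modules, and let $\mathcal S$ be the Serre functor of $\mathcal T$: an exact autoequivalence with isomorphisms $\mathrm{Hom}(X,Y)\cong\mathrm{Hom}(Y,\mathcal SX)^*$ natural in $X$ and $Y$. For objects $G,E$ of $\mathcal T$ and $t\in\mathbb R$ let $\delta_t(G,E)$ be the infimum of $\sum_{i=1}^p e^{n_it}$ over all sequences $0=E_0\to E_1\to\dots\to E_p\cong E\oplus M$, with $M\in\mathcal T$ arbitrary, that fit into exact triangles $E_{i-1}\to E_i\to G[n_i]\to E_{i-1}[1]$. For a split-generator $G$ (one such that $\mathcal T$ is the smallest triangulated subcategory containing $G$ and closed under direct summands) let $$h_t(\mathcal S)=\lim_{n\to+\infty}\frac1n\log\delta_t(G,\mathcal S^nG),\qquad \overline{\mathrm{Sdim}}\,\mathcal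 T=\lim_{t\to+\infty}\frac{h_t(\mathcal S)}{t}.$$ Split-generators exist, these limits exist in $[-\infty,+\infty]$, and they do not depend on $G$. Let $\Lambda$ be a finitely generated free abelian group, $v:K(\mathcal T)\to\Lambda$ a surjective homomorphism from the Grothendieck group of $\mathcal T$, and $\|\cdot\|$ a norm on $\Lambda\otimes_{\mathbb Z}\mathbb R$. A stability condition $\sigma=(Z,\mathcal P)$ with respect to these data consists of a homomorphism $Z:\Lambda\to\mathbb C$ and full additive subcategories $\mathcal P(\phi)\subset\mathcal T$, closed under isomorphism, for $\phi\in\mathbb R$, such that: (i) $Z(v(E))\in\mathbb R_{>0}\,e^{i\pi\phi}$ for $0\ne E\in\mathcal P(\phi)$; (ii) $\mathcal P(\phi+1)=\mathcal P(\phi)[1]$; (iii) $\mathrm{Hom}(E_1,E_2)=0$ if $E_i\in\mathcal P(\phi_i)$ and $\phi_1>\phi_2$; (iv) every $E\neq0$ has a Harder–Narasimhan filtration, i.e. a sequence $0=E_0\to\dots\to E_p=E$ with exact triangles $E_{i-1}\to E_i\to A_i\to E_{i-1}[1]$ where $A_i\in\mathcal P(\phi_i)$ and $\phi_1>\dots>\phi_p$;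 (v) there is $C>0$ with $\|v(E)\|<C\,|Z(v(E))|$ for all $\phi$ and all $0\neq E\in\mathcal P(\phi)$. Its global dimension is $$\mathrm{gldim}\,\sigma=\sup\{\phi_2-\phi_1\mid \mathrm{Hom}(E_1,E_2)\neq0\text{ for some }E_i\in\mathcal P(\phi_i)\}.$$ Then $\overline{\mathrm{Sdim}}\,\mathcal T\le\mathrm{gldim}\,\sigma$ for every stability condition $\sigma$ on $\mathcal T$ with respect to $(\Lambda,v)$. Hence $$\overline{\mathrm{Sdim}}\,\mathcal T\le\inf_{\sigma}\,\mathrm{gldim}\,\sigma .$$ -/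

import Mathlib

open CategoryTheory Category Limits Pretriangulated Filter Topology
open scoped TensorProduct ENNReal

universe w u v

noncomputable section

/-! ## Dg algebras, dg modules and dg bimodules over `ℂ`

Gradings are cohomological and internal: a graded vector space is a vector space together with
an internal direct sum decomposition indexed by `ℤ`; differentials have degree `+1`. -/

/-- A differential graded `ℂ`-algebra (associative, unital). -/
structure DGAlgebra where
  carrier : Type w
  [ring : Ring carrier]
  [algebra : Algebra ℂ carrier]
  gr : ℤ → Submodule ℂ carrier
  isInternal : DirectSum.IsInternal gr
  one_mem : (1 : carrier) ∈ gr 0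
  mul_mem : ∀ {i j : ℤ} {a b : carrier}, a ∈ gr i → b ∈ gr j → a * b ∈ gr (i + j)
  d : carrier →ₗ[ℂ] carrier
  d_mem : ∀ {i : ℤ} {a : carrier}, a ∈ gr i → d a ∈ gr (i + 1)
  d_d : ∀ a : carrier, d (d a) = 0
  leibniz : ∀ {i : ℤ} {a : carrier}, a ∈ gr i → ∀ b : carrier,
    d (a * b) = d a * b + i.negOnePow • (a * d b)

attribute [instance] DGAlgebra.ring DGAlgebra.algebra

/-- `φ : (M, dM) → (N, dN)` induces an isomorphism on (total) cohomology. For maps of complexes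
that preserve the gradings this is the same as an isomorphism in each degree. -/
def InducesCohomologyIso {M N : Type*} [AddCommGroup M] [Module ℂ M] [AddCommGroup N]
    [Module ℂ N] (dM : M →ₗ[ℂ] M) (dN : N →ₗ[ℂ] N) (φ : M →ₗ[ℂ] N) : Prop :=
  (∀ x, dM x = 0 → (∃ y, φ x = dN y) → ∃ x', x = dM x') ∧
  (∀ y, dN y = 0 → ∃ x y', dM x = 0 ∧ y = φ x + dN y')

/-- A right dg module over `A`; `act m a` is the product `m · a`. -/
structure DGModule (A : DGAlgebra.{w}) where
  carrier : Type w
  [addCommGroup : AddCommGroup carrier]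
  [module : Module ℂ carrier]
  act : carrier →ₗ[ℂ] A.carrier →ₗ[ℂ] carrier
  act_one : ∀ m : carrier, act m 1 = m
  act_mul : ∀ (m : carrier) (a b : A.carrier), act m (a * b) = act (act m a) b
  gr : ℤ → Submodule ℂ carrier
  isInternal : DirectSum.IsInternal gr
  act_mem : ∀ {i j : ℤ} {m : carrier} {a : A.carrier}, m ∈ gr i → a ∈ A.gr j →
    act m a ∈ gr (i + j)
  d : carrier →ₗ[ℂ] carrier
  d_mem : ∀ {i : ℤ} {m : carrier}, m ∈ gr i → d m ∈ gr (i + 1)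
  d_d : ∀ m : carrier, d (d m) = 0
  leibniz : ∀ {i : ℤ} {m : carrier}, m ∈ gr i → ∀ a : A.carrier,
    d (act m a) = act (d m) a + i.negOnePow • act m (A.d a)

attribute [instance] DGModule.addCommGroup DGModule.module

namespace DGModule

variable {A : DGAlgebra.{w}}

/-- Morphisms of dg modules: `A`-linear maps of degree `0` commuting with the differentials. -/
@[ext]
structure Hom (M N : DGModule A) where
  toFun : M.carrier →ₗ[ℂ] N.carrier
  map_act : ∀ (m : M.carrier) (a : A.carrier), toFun (M.act m a) = N.act (toFun m) a
  map_mem : ∀ {i : ℤ} {m : M.carrier}, m ∈ M.gr i → toFun m ∈ N.gr i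
  map_d : ∀ m : M.carrier, toFun (M.d m) = N.d (toFun m)

instance : Category (DGModule A) where
  Hom := Hom
  id M := ⟨LinearMap.id, fun _ _ => rfl, fun h => h, fun _ => rfl⟩
  comp f g := ⟨g.toFun ∘ₗ f.toFun, fun m a => by simp [f.map_act, g.map_act],
    fun h => g.map_mem (f.map_mem h), fun m => by simp [f.map_d, g.map_d]⟩

@[ext]
lemma hom_ext {M N : DGModule A} {f g : M ⟶ N} (h : ∀ m, f.toFun m = g.toFun m) : f = g :=
  Hom.ext (LinearMap.ext h)

@[simp] lemma id_toFun (M : DGModule A) : Hom.toFun (𝟙 M) = LinearMap.id := rfl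

@[simp] lemma comp_toFun {M N P : DGModule A} (f : M ⟶ N) (g : N ⟶ P) :
    (f ≫ g).toFun = g.toFun ∘ₗ f.toFun := rfl

/-- Multiplication by a scalar, as an endomorphism of a dg module. -/
def scalar (z : ℂ) (M : DGModule A) : M ⟶ M where
  toFun := z • LinearMap.id
  map_act m a := by simp
  map_mem h := Submodule.smul_mem _ _ h
  map_d m := by simp

variable (A) in
/-- `A` as a right dg module over itself. -/
def free : DGModule A where
  carrier := A.carrier
  act := LinearMap.mul ℂ A.carrier
  act_one m := by simp
  act_mul m a b := by simp [mul_assoc]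
  gr := A.gr
  isInternal := A.isInternal
  act_mem hm ha := A.mul_mem hm ha
  d := A.d
  d_mem := A.d_mem
  d_d := A.d_d
  leibniz hm a := A.leibniz hm a

lemma isInternal_shift {V : Type*} [AddCommGroup V] [Module ℂ V] {g : ℤ → Submodule ℂ V}
    (h : DirectSum.IsInternal g) (n : ℤ) : DirectSum.IsInternal (fun i => g (i + n)) := by
  rw [DirectSum.isInternal_submodule_iff_iSupIndep_and_iSup_eq_top] at h ⊢
  exact ⟨h.1.comp (add_left_injective n), by rw [← h.2]; exact (Equiv.addRight n).iSup_comp⟩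

lemma isInternal_prod {V W : Type*} [AddCommGroup V] [Module ℂ V] [AddCommGroup W] [Module ℂ W]
    {g : ℤ → Submodule ℂ V} {h : ℤ → Submodule ℂ W}
    (hg : DirectSum.IsInternal g) (hh : DirectSum.IsInternal h) :
    DirectSum.IsInternal (fun i => (g i).prod (h i)) := by
  rw [DirectSum.isInternal_submodule_iff_iSupIndep_and_iSup_eq_top] at hg hh ⊢
  refine ⟨fun i => ?_, ?_⟩
  · rw [Submodule.disjoint_def]
    intro x hx hx'
    have hle : (⨆ (j) (_ : j ≠ i), (g j).prod (h j)) ≤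
        (⨆ (j) (_ : j ≠ i), g j).prod (⨆ (j) (_ : j ≠ i), h j) :=
      iSup₂_le fun j hj => Submodule.prod_mono
        (le_iSup₂_of_le j hj le_rfl) (le_iSup₂_of_le j hj le_rfl)
    have hx'' := hle hx'
    exact Prod.ext (Submodule.disjoint_def.1 (hg.1 i) _ hx.1 hx''.1)
      (Submodule.disjoint_def.1 (hh.1 i) _ hx.2 hx''.2)
  · rw [eq_top_iff]
    rintro ⟨a, b⟩ -
    have ha : ((a, 0) : V × W) ∈ ⨆ i, (g i).prod (h i) := by
      have h1 : (⨆ i, (g i).map (LinearMap.inl ℂ V W)) ≤ ⨆ i, (g i).prod (h i) :=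
        iSup_mono fun i => by
          rintro _ ⟨y, hy, rfl⟩
          exact ⟨hy, Submodule.zero_mem _⟩
      rw [← Submodule.map_iSup, hg.2] at h1
      exact h1 ⟨a, trivial, rfl⟩
    have hb : ((0, b) : V × W) ∈ ⨆ i, (g i).prod (h i) := by
      have h1 : (⨆ i, (h i).map (LinearMap.inr ℂ V W)) ≤ ⨆ i, (g i).prod (h i) :=
        iSup_mono fun i => by
          rintro _ ⟨y, hy, rfl⟩
          exact ⟨Submodule.zero_mem _, hy⟩
      rw [← Submodule.map_iSup, hh.2] at h1
      exact h1 ⟨b, trivial, rfl⟩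
    simpa using Submodule.add_mem _ ha hb

/-- The shift `M[n]`: `M[n]^i = M^{i+n}`, with differential `(-1)^n d` and the same right action. -/
def shiftObj (n : ℤ) (M : DGModule A) : DGModule A where
  carrier := M.carrier
  act := M.act
  act_one := M.act_one
  act_mul := M.act_mul
  gr i := M.gr (i + n)
  isInternal := isInternal_shift M.isInternal n
  act_mem {i j m a} hm ha := by
    have := M.act_mem hm ha
    rwa [show i + n + j = i + j + n by ring] at this
  d := n.negOnePow • M.d
  d_mem {i m} hm := by
    have := M.d_mem hm
    rw [show i + n + 1 = i + 1 + n by ring] at this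
    rcases Int.even_or_odd n with h | h
    · simpa [Int.negOnePow_even n h] using this
    · simpa [Int.negOnePow_odd n h] using this
  d_d m := by
    rcases Int.even_or_odd n with h | h
    · simp [Int.negOnePow_even n h, M.d_d]
    · simp [Int.negOnePow_odd n h, M.d_d]
  leibniz {i m} hm a := by
    have := M.leibniz hm a
    simp only [LinearMap.smul_apply, this, Int.negOnePow_add, smul_add, smul_smul,
      Units.smul_def, map_zsmul, Units.val_mul]
    congr 2
    have h1 : ((n.negOnePow : ℤˣ) : ℤ) * (n.negOnePow : ℤˣ) = 1 := by
      rw [← Units.val_mul, Int.units_mul_self, Units.val_one]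
    rw [mul_comm, mul_assoc, h1, mul_one]

/-- The shift functor `[n]` on dg modules. -/
def shiftF (n : ℤ) : DGModule A ⥤ DGModule A where
  obj M := shiftObj n M
  map {M N} f :=
    { toFun := f.toFun
      map_act := f.map_act
      map_mem := fun h => f.map_mem h
      map_d := fun (m : M.carrier) =>
        (map_zsmul f.toFun ((n.negOnePow : ℤˣ) : ℤ) (M.d m)).trans
          (congrArg (fun y : N.carrier => n.negOnePow • y) (f.map_d m)) }

lemma eqToHom_shiftObj_toFun (M : DGModule A) {n m : ℤ} (h : n = m)
    (h' : shiftObj n M = shiftObj m M) :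
    Hom.toFun (eqToHom h') = (LinearMap.id : M.carrier →ₗ[ℂ] M.carrier) := by
  subst h
  rfl

/-- The identification `M[0] = M`. -/
def shiftZeroIso : shiftF (A := A) 0 ≅ 𝟭 (DGModule A) :=
  NatIso.ofComponents (fun M =>
    { hom :=
        { toFun := (LinearMap.id : M.carrier →ₗ[ℂ] M.carrier)
          map_act := fun _ _ => rfl
          map_mem := fun {i m} (h : m ∈ M.gr (i + 0)) => by
            rw [add_zero] at h
            exact h
          map_d := fun m => by
            change (0 : ℤ).negOnePow • M.d m = M.d m
            simp }
      inv :=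
        { toFun := (LinearMap.id : M.carrier →ₗ[ℂ] M.carrier)
          map_act := fun _ _ => rfl
          map_mem := fun {i m} (h : m ∈ M.gr i) => by
            change m ∈ M.gr (i + 0)
            rwa [add_zero]
          map_d := fun m => by
            change M.d m = (0 : ℤ).negOnePow • M.d m
            simp }
      hom_inv_id := rfl
      inv_hom_id := rfl }) (fun _ => rfl)

/-- The identification `M[n + m] = M[n][m]`. -/
def shiftAddIso (n m : ℤ) : shiftF (A := A) (n + m) ≅ shiftF n ⋙ shiftF m :=
  NatIso.ofComponents (fun M =>
    { hom :=
        { toFun := (LinearMap.id : M.carrier →ₗ[ℂ] M.carrier)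
          map_act := fun _ _ => rfl
          map_mem := fun {i x} (h : x ∈ M.gr (i + (n + m))) => by
            change x ∈ M.gr (i + m + n)
            rwa [show i + m + n = i + (n + m) by ring]
          map_d := fun x => by
            change (n + m).negOnePow • M.d x = m.negOnePow • n.negOnePow • M.d x
            rw [smul_smul, add_comm, Int.negOnePow_add] }
      inv :=
        { toFun := (LinearMap.id : M.carrier →ₗ[ℂ] M.carrier)
          map_act := fun _ _ => rfl
          map_mem := fun {i x} (h : x ∈ M.gr (i + m + n)) => by
            change x ∈ M.gr (i + (n + m))
            rwa [show i + (n + m) = i + m + n by ring]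
          map_d := fun x => by
            change m.negOnePow • n.negOnePow • M.d x = (n + m).negOnePow • M.d x
            rw [smul_smul, add_comm n, Int.negOnePow_add] }
      hom_inv_id := rfl
      inv_hom_id := rfl }) (fun _ => rfl)

instance : HasShift (DGModule A) ℤ :=
  hasShiftMk _ _
    { F := shiftF
      zero := shiftZeroIso
      add := shiftAddIso
      assoc_hom_app := fun m₁ m₂ m₃ X => by
        ext x
        exact (LinearMap.congr_fun (eqToHom_shiftObj_toFun X (add_assoc m₁ m₂ m₃) _) x).symm
      zero_add_hom_app := fun n X => by
        ext x
        exact (LinearMap.congr_fun (eqToHom_shiftObj_toFun X (zero_add n) _) x).symm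
      add_zero_hom_app := fun n X => by
        ext x
        exact (LinearMap.congr_fun (eqToHom_shiftObj_toFun X (add_zero n) _) x).symm }

/-- The mapping cone of `f : M ⟶ N`: the graded module `N ⊕ M[1]` with differential
`(y, x) ↦ (d y + f x, - d x)`. -/
def cone {M N : DGModule A} (f : M ⟶ N) : DGModule A where
  carrier := N.carrier × M.carrier
  act := LinearMap.mk₂ ℂ (fun p a => (N.act p.1 a, M.act p.2 a))
    (fun _ _ _ => by simp) (fun _ _ _ => by simp) (fun _ _ _ => by simp) (fun _ _ _ => by simp)
  act_one p := by simp [N.act_one, M.act_one]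
  act_mul p a b := by simp [N.act_mul, M.act_mul]
  gr i := (N.gr i).prod (M.gr (i + 1))
  isInternal := isInternal_prod N.isInternal (isInternal_shift M.isInternal 1)
  act_mem {i j p a} hp ha := by
    refine ⟨N.act_mem hp.1 ha, ?_⟩
    have := M.act_mem hp.2 ha
    rwa [show i + 1 + j = i + j + 1 by ring] at this
  d := (N.d ∘ₗ LinearMap.fst ℂ _ _ + f.toFun ∘ₗ LinearMap.snd ℂ _ _).prod
    (-(M.d ∘ₗ LinearMap.snd ℂ _ _))
  d_mem {i p} hp :=
    ⟨Submodule.add_mem _ (N.d_mem hp.1) (f.map_mem hp.2), Submodule.neg_mem _ (M.d_mem hp.2)⟩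
  d_d p := by simp [N.d_d, M.d_d, f.map_d]
  leibniz {i p} hp a := by
    have h1 := N.leibniz hp.1 a
    have h2 := M.leibniz hp.2 a
    refine Prod.ext ?_ ?_
    · simp [h1, f.map_act]
      abel
    · simp [h2, Int.negOnePow_succ]
      abel

/-- The inclusion `N ⟶ cone f`. -/
def coneIncl {M N : DGModule A} (f : M ⟶ N) : N ⟶ cone f where
  toFun := LinearMap.inl ℂ N.carrier M.carrier
  map_act m a := by
    change ((N.act m a, 0) : N.carrier × M.carrier) = (N.act m a, M.act 0 a)
    simp
  map_mem h := ⟨h, Submodule.zero_mem _⟩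
  map_d m := by
    change ((N.d m, 0) : N.carrier × M.carrier) = (N.d m + f.toFun 0, -(M.d 0))
    simp

/-- The projection `cone f ⟶ M[1]`. -/
def coneProj {M N : DGModule A} (f : M ⟶ N) : cone f ⟶ (shiftFunctor (DGModule A) (1 : ℤ)).obj M where
  toFun := LinearMap.snd ℂ N.carrier M.carrier
  map_act _ _ := rfl
  map_mem h := h.2
  map_d p := by
    change -(M.d p.2) = (1 : ℤ).negOnePow • M.d p.2
    simp

variable (A) in
/-- Quasi-isomorphisms of dg modules. -/
def quasiIso : MorphismProperty (DGModule A) :=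
  fun M N f => InducesCohomologyIso M.d N.d f.toFun

lemma inducesCohomologyIso_neg {V W : Type*} [AddCommGroup V] [Module ℂ V] [AddCommGroup W]
    [Module ℂ W] (dV : V →ₗ[ℂ] V) (dW : W →ₗ[ℂ] W) (φ : V →ₗ[ℂ] W) :
    InducesCohomologyIso (-dV) (-dW) φ ↔ InducesCohomologyIso dV dW φ := by
  have key : ∀ (dV : V →ₗ[ℂ] V) (dW : W →ₗ[ℂ] W),
      InducesCohomologyIso dV dW φ → InducesCohomologyIso (-dV) (-dW) φ := by
    rintro dV dW ⟨h1, h2⟩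
    refine ⟨fun x hx hy => ?_, fun y hy => ?_⟩
    · obtain ⟨y, hy⟩ := hy
      obtain ⟨x', hx'⟩ := h1 x (by simpa using hx) ⟨-y, by simpa using hy⟩
      exact ⟨-x', by simpa using hx'⟩
    · obtain ⟨x, y', hx, hy'⟩ := h2 y (by simpa using hy)
      exact ⟨x, -y', by simpa using hx, by simpa using hy'⟩
  exact ⟨fun h => by simpa using key _ _ h, key dV dW⟩

instance : (quasiIso A).IsCompatibleWithShift ℤ where
  condition n := by
    ext M N f
    change InducesCohomologyIso (n.negOnePow • M.d) (n.negOnePow • N.d) f.toFun ↔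
      InducesCohomologyIso M.d N.d f.toFun
    rcases Int.even_or_odd n with h | h
    · simp [Int.negOnePow_even n h]
    · simpa [Int.negOnePow_odd n h] using inducesCohomologyIso_neg M.d N.d f.toFun

end DGModule

/-! ## The derived category and perfect modules -/

/-- The derived category `D(A)`: the localization of the category of right dg `A`-modules at the
quasi-isomorphisms, with the shift induced from dg modules. -/
abbrev DerivedCat (A : DGAlgebra.{w}) : Type (w + 1) := (DGModule.quasiIso A).Localization

namespace DerivedCat

variable (A : DGAlgebra.{w})

/-- The localization functor from dg modules to the derived category. -/
abbrev Q : DGModule A ⥤ DerivedCat A := (DGModule.quasiIso A).Q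

/-- The action of a scalar `z : ℂ` on the derived category, as an endomorphism of its identity
functor; the `ℂ`-linear structure of `D(A)` is `z • f = f ≫ z`. -/
def scalar (z : ℂ) : 𝟭 (DerivedCat A) ⟶ 𝟭 (DerivedCat A) :=
  Localization.liftNatTrans (Q A) (DGModule.quasiIso A) (Q A) (Q A) (𝟭 _) (𝟭 _)
    { app := fun M => (Q A).map (DGModule.scalar z M)
      naturality := fun M N f => by
        rw [← Functor.map_comp, ← Functor.map_comp]
        congr 1
        ext m
        exact (f.toFun.map_smul z m).symm }

variable {A}

/-- The standard triangle `M ⟶ N ⟶ cone f ⟶ M[1]` in the derived category. -/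
def coneTriangle {M N : DGModule A} (f : M ⟶ N) : Triangle (DerivedCat A) :=
  Triangle.mk ((Q A).map f) ((Q A).map (DGModule.coneIncl f))
    ((Q A).map (DGModule.coneProj f) ≫ ((Q A).commShiftIso (1 : ℤ)).hom.app M)

/-- The distinguished triangles of the derived category: those isomorphic to a standard triangle. -/
def IsDistinguished (t : Triangle (DerivedCat A)) : Prop :=
  ∃ (M N : DGModule A) (f : M ⟶ N), Nonempty (t ≅ coneTriangle f)

variable (A) in
/-- The objects of the perfect derived category `perf(A)`: the smallest full subcategory of the
derived category that contains `A` and is closed under isomorphisms, shifts, cones and direct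
summands. -/
inductive IsPerfect : DerivedCat A → Prop
  | free : IsPerfect ((Q A).obj (DGModule.free A))
  | shift (n : ℤ) {X : DerivedCat A} : IsPerfect X →
      IsPerfect ((shiftFunctor (DerivedCat A) n).obj X)
  | cone {t : Triangle (DerivedCat A)} : IsDistinguished t → IsPerfect t.obj₁ →
      IsPerfect t.obj₂ → IsPerfect t.obj₃
  | retract {X Y : DerivedCat A} : Retract X Y → IsPerfect Y → IsPerfect X

end DerivedCat

/-! ## Dg bimodules and smoothness -/

/-- A dg `A`-bimodule, i.e. a dg module over `A^op ⊗ A`; `lact a m` is `a · m` and `ract m a` is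
`m · a`. -/
structure DGBimodule (A : DGAlgebra.{w}) where
  carrier : Type w
  [addCommGroup : AddCommGroup carrier]
  [module : Module ℂ carrier]
  lact : A.carrier →ₗ[ℂ] carrier →ₗ[ℂ] carrier
  ract : carrier →ₗ[ℂ] A.carrier →ₗ[ℂ] carrier
  one_lact : ∀ m : carrier, lact 1 m = m
  mul_lact : ∀ (a b : A.carrier) (m : carrier), lact (a * b) m = lact a (lact b m)
  ract_one : ∀ m : carrier, ract m 1 = m
  ract_mul : ∀ (m : carrier) (a b : A.carrier), ract m (a * b) = ract (ract m a) b
  lact_ract : ∀ (a : A.carrier) (m : carrier) (b : A.carrier),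
    ract (lact a m) b = lact a (ract m b)
  gr : ℤ → Submodule ℂ carrier
  isInternal : DirectSum.IsInternal gr
  lact_mem : ∀ {i j : ℤ} {a : A.carrier} {m : carrier}, a ∈ A.gr i → m ∈ gr j →
    lact a m ∈ gr (i + j)
  ract_mem : ∀ {i j : ℤ} {m : carrier} {a : A.carrier}, m ∈ gr i → a ∈ A.gr j →
    ract m a ∈ gr (i + j)
  d : carrier →ₗ[ℂ] carrier
  d_mem : ∀ {i : ℤ} {m : carrier}, m ∈ gr i → d m ∈ gr (i + 1)
  d_d : ∀ m : carrier, d (d m) = 0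
  leibniz_lact : ∀ {i : ℤ} {a : A.carrier}, a ∈ A.gr i → ∀ m : carrier,
    d (lact a m) = lact (A.d a) m + i.negOnePow • lact a (d m)
  leibniz_ract : ∀ {i : ℤ} {m : carrier}, m ∈ gr i → ∀ a : A.carrier,
    d (ract m a) = ract (d m) a + i.negOnePow • ract m (A.d a)

attribute [instance] DGBimodule.addCommGroup DGBimodule.module

namespace DGBimodule

variable {A : DGAlgebra.{w}}

/-- Morphisms of dg bimodules: bilinear maps of degree `0` commuting with the differentials. -/
structure Hom (M N : DGBimodule A) where
  toFun : M.carrier →ₗ[ℂ] N.carrier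
  map_lact : ∀ (a : A.carrier) (m : M.carrier), toFun (M.lact a m) = N.lact a (toFun m)
  map_ract : ∀ (m : M.carrier) (a : A.carrier), toFun (M.ract m a) = N.ract (toFun m) a
  map_mem : ∀ {i : ℤ} {m : M.carrier}, m ∈ M.gr i → toFun m ∈ N.gr i
  map_d : ∀ m : M.carrier, toFun (M.d m) = N.d (toFun m)

variable (A) in
/-- The diagonal bimodule `A`. -/
def diagonal : DGBimodule A where
  carrier := A.carrier
  lact := LinearMap.mul ℂ A.carrier
  ract := LinearMap.mul ℂ A.carrier
  one_lact m := by simp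
  mul_lact a b m := by simp [mul_assoc]
  ract_one m := by simp
  ract_mul m a b := by simp [mul_assoc]
  lact_ract a m b := by simp [mul_assoc]
  gr := A.gr
  isInternal := A.isInternal
  lact_mem ha hm := A.mul_mem ha hm
  ract_mem hm ha := A.mul_mem hm ha
  d := A.d
  d_mem := A.d_mem
  d_d := A.d_d
  leibniz_lact ha m := A.leibniz ha m
  leibniz_ract hm a := A.leibniz hm a

/-- `F` is isomorphic to the free dg bimodule `A ⊗ A`: it has a closed element `u` of degree `0`
such that `a ⊗ b ↦ a · u · b` is a bijection `A ⊗ A → F`. (The grading and the differential of `F`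
are then forced to be those of `A ⊗ A`.) -/
def IsFreeOfRankOne (F : DGBimodule A) : Prop :=
  ∃ u ∈ F.gr 0, F.d u = 0 ∧
    Function.Bijective (TensorProduct.lift (F.ract ∘ₗ F.lact.flip u) :
      A.carrier ⊗[ℂ] A.carrier →ₗ[ℂ] F.carrier)

/-- Short exact sequences of dg bimodules. -/
def ShortExact {X Y Z : DGBimodule A} (f : Hom X Y) (g : Hom Y Z) : Prop :=
  Function.Injective f.toFun ∧ Function.Exact f.toFun g.toFun ∧ Function.Surjective g.toFun

/-- Quasi-isomorphisms of dg bimodules. -/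
def QuasiIso {X Y : DGBimodule A} (f : Hom X Y) : Prop := InducesCohomologyIso X.d Y.d f.toFun

/-- Perfect dg bimodules, i.e. those which lie in the thick subcategory generated by `A^op ⊗ A` in
the derived category of dg `A^op ⊗ A`-modules. Since the distinguished triangles of that category
are, up to isomorphism, given by the short exact sequences of dg bimodules, this is the smallest
class of dg bimodules that contains the free bimodule `A ⊗ A`, is invariant under
quasi-isomorphisms, has the two out of three property for short exact sequences (which includes
closure under shifts) and is closed under direct summands. -/
inductive IsPerfect : DGBimodule A → Prop
  | free {F : DGBimodule A} : IsFreeOfRankOne F → IsPerfect F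
  | of_quasiIso_left {X Y : DGBimodule A} (f : Hom X Y) : QuasiIso f → IsPerfect X → IsPerfect Y
  | of_quasiIso_right {X Y : DGBimodule A} (f : Hom X Y) : QuasiIso f → IsPerfect Y → IsPerfect X
  | ext₁ {X Y Z : DGBimodule A} (f : Hom X Y) (g : Hom Y Z) : ShortExact f g →
      IsPerfect Y → IsPerfect Z → IsPerfect X
  | ext₂ {X Y Z : DGBimodule A} (f : Hom X Y) (g : Hom Y Z) : ShortExact f g →
      IsPerfect X → IsPerfect Z → IsPerfect Y
  | ext₃ {X Y Z : DGBimodule A} (f : Hom X Y) (g : Hom Y Z) : ShortExact f g →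
      IsPerfect X → IsPerfect Y → IsPerfect Z
  | summand {X Y : DGBimodule A} (i : Hom X Y) (r : Hom Y X) :
      r.toFun ∘ₗ i.toFun = LinearMap.id → IsPerfect Y → IsPerfect X

end DGBimodule

namespace DGAlgebra

/-- `A` is smooth if the diagonal bimodule is perfect. -/
def IsSmooth (A : DGAlgebra.{w}) : Prop := (DGBimodule.diagonal A).IsPerfect

/-- `A` is proper if its total cohomology `ker d / im d` is finite-dimensional. -/
def IsProper (A : DGAlgebra.{w}) : Prop :=
  Module.Finite ℂ (LinearMap.ker A.d ⧸ (LinearMap.range A.d).submoduleOf (LinearMap.ker A.d))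

end DGAlgebra

/-! ## Triangulated categories -/

section Triangulated

variable (T : Type u) [Category.{v} T] [Preadditive T] [HasZeroObject T] [HasShift T ℤ]
  [∀ n : ℤ, (shiftFunctor T n).Additive] [Pretriangulated T]

/-- An exact `ℂ`-linear equivalence between a triangulated category `T` and `perf(A)`, given as a
fully faithful functor to the derived category with essential image the perfect objects. -/
structure PerfEquivalence [Linear ℂ T] (A : DGAlgebra.{w}) where
  functor : T ⥤ DerivedCat A
  full : functor.Full
  faithful : functor.Faithful
  essImage_iff : ∀ X : DerivedCat A, functor.essImage X ↔ DerivedCat.IsPerfect A X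
  map_smul : ∀ (z : ℂ) {X Y : T} (f : X ⟶ Y),
    functor.map (z • f) = functor.map f ≫ (DerivedCat.scalar A z).app (functor.obj Y)
  commShift : functor.CommShift ℤ
  distinguished_iff : ∀ t : Triangle T,
    t ∈ distTriang T ↔ DerivedCat.IsDistinguished (functor.mapTriangle.obj t)

variable {T}

/-- A Serre functor: an exact autoequivalence `S` (the exactness and the equivalence are recorded by
the type classes on `S`) with isomorphisms `Hom(X, Y) ≅ Hom(Y, S X)^*` natural in `X` and `Y`. -/
def IsSerreFunctor [Linear ℂ T] (S : T ⥤ T) [S.IsEquivalence] [S.CommShift ℤ]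
    [S.IsTriangulated] : Prop :=
  ∃ η : ∀ X Y : T, (X ⟶ Y) ≃ₗ[ℂ] Module.Dual ℂ (Y ⟶ S.obj X),
    ∀ {X X' Y Y' : T} (f : X' ⟶ X) (h : X ⟶ Y) (g : Y ⟶ Y') (k : Y' ⟶ S.obj X'),
      η X' Y' (f ≫ h ≫ g) k = η X Y h (g ≫ k ≫ S.map f)

/-- `IsTower [A₁, …, A_p] E`: there is a sequence `0 = E₀ → E₁ → ⋯ → E_p = E` together with
distinguished triangles `E_{i-1} → E_i → A_i → E_{i-1}[1]`. -/
inductive IsTower : List T → T → Prop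
  | zero {E : T} : IsZero E → IsTower [] E
  | step {l : List T} {E E' B : T} (f : E ⟶ E') (g : E' ⟶ B)
      (h : B ⟶ (shiftFunctor T (1 : ℤ)).obj E) :
      Triangle.mk f g h ∈ distTriang T → IsTower l E → IsTower (l ++ [B]) E'

/-- `G` is a split-generator: the smallest triangulated subcategory that is closed under direct
summands and contains `G` is the whole category. -/
def IsSplitGenerator (G : T) : Prop :=
  (ObjectProperty.singleton G).IsClassicalTriangulatedGenerator

/-- The complexity `δ_t(G, E)`: the infimum of `∑ exp (n_i t)` over all towers with factors
`G[n_1], …, G[n_p]` and with total object `E ⊕ M` for some `M`. -/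
def complexity (t : ℝ) (G E : T) : ℝ≥0∞ :=
  ⨅ (M : T) (l : List ℤ) (_ : IsTower (l.map fun n => (shiftFunctor T n).obj G) (E ⊞ M)),
    ENNReal.ofReal (l.map fun n : ℤ => Real.exp (n * t)).sum

/-- `h` is the entropy function `t ↦ h_t(F)` of the exact endofunctor `F`: for every
split-generator `G`, and there is one, `h t` is the limit of `(1/n) log δ_t(G, Fⁿ G)`. -/
def IsEntropy (F : T ⥤ T) (h : ℝ → EReal) : Prop :=
  (∃ G : T, IsSplitGenerator G) ∧ ∀ G : T, IsSplitGenerator G → ∀ t : ℝ,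
    Tendsto (fun n : ℕ => ENNReal.log (complexity t G (F.obj^[n] G)) / (n : EReal)) atTop (𝓝 (h t))

/-- `s` is the upper Serre dimension of a triangulated category with Serre functor `S`: the limit
of `h_t(S) / t` as `t → +∞`. -/
def IsUpperSerreDim (S : T ⥤ T) (s : EReal) : Prop :=
  ∃ h : ℝ → EReal, IsEntropy S h ∧ Tendsto (fun t : ℝ => h t / (t : EReal)) atTop (𝓝 s)

variable (T) in
/-- The Grothendieck group of a triangulated category. -/
abbrev GrothendieckGroup : Type u :=
  FreeAbelianGroup T ⧸ AddSubgroup.closure {x : FreeAbelianGroup T | ∃ t ∈ distTriang T,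
    x = FreeAbelianGroup.of t.obj₂ - FreeAbelianGroup.of t.obj₁ - FreeAbelianGroup.of t.obj₃}

/-- The class of an object in the Grothendieck group. -/
def GrothendieckGroup.cls (E : T) : GrothendieckGroup T :=
  QuotientAddGroup.mk (FreeAbelianGroup.of E)

/-- A Bridgeland stability condition with respect to `v : K(T) → Λ` and a norm `N` on `Λ ⊗ ℝ`. -/
structure StabilityCondition {Λ : Type*} [AddCommGroup Λ] (v : GrothendieckGroup T →+ Λ)
    (N : Seminorm ℝ (ℝ ⊗[ℤ] Λ)) where
  /-- the central charge -/
  Z : Λ →+ ℂ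
  /-- the slicing, a family of full additive subcategories -/
  P : ℝ → ObjectProperty T
  of_iso : ∀ {φ : ℝ} {E E' : T}, (E ≅ E') → P φ E → P φ E'
  zero_mem : ∀ {φ : ℝ} {E : T}, IsZero E → P φ E
  biprod_mem : ∀ {φ : ℝ} {E E' : T}, P φ E → P φ E' → P φ (E ⊞ E')
  charge : ∀ {φ : ℝ} {E : T}, P φ E → ¬ IsZero E → ∃ m : ℝ, 0 < m ∧
    Z (v (GrothendieckGroup.cls E)) = m * Complex.exp (Complex.I * Real.pi * φ)
  shift_iff : ∀ (φ : ℝ) (E : T), P (φ + 1) ((shiftFunctor T (1 : ℤ)).obj E) ↔ P φ E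
  hom_eq_zero : ∀ {φ₁ φ₂ : ℝ} {E₁ E₂ : T}, φ₂ < φ₁ → P φ₁ E₁ → P φ₂ E₂ →
    ∀ f : E₁ ⟶ E₂, f = 0
  /-- existence of Harder–Narasimhan filtrations -/
  exists_HN : ∀ E : T, ¬ IsZero E → ∃ l : List (ℝ × T), IsTower (l.map Prod.snd) E ∧
    (∀ x ∈ l, P x.1 x.2) ∧ (l.map Prod.fst).Pairwise (· > ·)
  /-- the support property -/
  support : ∃ C : ℝ, 0 < C ∧ ∀ {φ : ℝ} {E : T}, P φ E → ¬ IsZero E →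
    N (1 ⊗ₜ[ℤ] v (GrothendieckGroup.cls E)) < C * ‖Z (v (GrothendieckGroup.cls E))‖

/-- The global dimension of a stability condition: the supremum of `φ₂ - φ₁` over all `φ₁, φ₂` such
that there is a nonzero morphism from an object of `P φ₁` to an object of `P φ₂`. -/
def StabilityCondition.gldim {Λ : Type*} [AddCommGroup Λ] {v : GrothendieckGroup T →+ Λ}
    {N : Seminorm ℝ (ℝ ⊗[ℤ] Λ)} (σ : StabilityCondition v N) : EReal :=
  sSup {x : EReal | ∃ (φ₁ φ₂ : ℝ) (E₁ E₂ : T) (f : E₁ ⟶ E₂),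
    σ.P φ₁ E₁ ∧ σ.P φ₂ E₂ ∧ f ≠ 0 ∧ x = ((φ₂ - φ₁ : ℝ) : EReal)}

end Triangulated

end

noncomputable section

/-! ### Towers, direct summands and distinguished triangles. -/

section Towers

open ZeroObject

variable {T : Type u} [Category.{v} T] [Preadditive T] [HasZeroObject T] [HasShift T ℤ]
  [∀ n : ℤ, (shiftFunctor T n).Additive] [Pretriangulated T]

/-! Let `G` be the object of `T` corresponding to the free module `A`, let `b_k(E)` be the dimension
of `H^k(E)`, and put `P_t(E) = ∑ b_k(E) e^{-kt}` (`PerfEquivalence.betti`,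
`PerfEquivalence.poincare`). The proof replaces complexity by `P_t`, reads off the Serre dimension
from the lowest nonzero degree of the cohomology of `S^n G`, and bounds this degree by phases.

Complexity versus cohomology. Since `P_t` is subadditive on triangles and a shift by `n` multiplies
it by `e^{nt}`, one has `P_t(E) ≤ P_t(G) δ_t(G,E)` (`poincare_le_mul_complexity`); properness makes
`P_t(G)` finite. Conversely, smoothness builds the diagonal bimodule from finitely many shifts of `A
⊗ A`. Applying `X ⊗_A -` builds `X` from `X ⊗_ℂ A` by a recipe independent of `X`
(`exists_built_of_isPerfect`), and `X ⊗_ℂ A` is a sum of `b_k(X)` copies of `A[-k]` by Künneth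
(`exists_quasiIso_freeSum`). Hence `δ_t(G,E) ≤ C P_t(E)` with `C` independent of `E`
(`exists_complexity_le_poincare`). The tensor product is used only for iterated cell attachments
(`TensorFunctor`). An object `E` may be a mere summand of such a tower, but `E ⊞ E[1]` is always the
total object of one.

The Serre dimension. By Fekete's lemma `h_t(S)` is the growth rate of `P_t(S^n G)`
(`exists_isEntropy`). If `k_n` is the lowest degree in which `S^n G` has cohomology, then for `t >
0` the number `P_t(S^n G)` lies between `e^{-k_n t}` and `e^{-k_n t}` times the total Betti number,
which is at most exponential in `n`. So `h_t(S)/t` differs from `limsup(-k_n/n)` by `O(1/t)`, and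
this limsup is the upper Serre dimension (`tendsto_growth_div`, `exists_isUpperSerreDim`).

Phases. Let `g` be a real bound for the global dimension. The top Harder–Narasimhan factor of `S E`
maps nontrivially to `S E`, so by Serre duality it receives a nonzero map from `E`; thus `S` raises
an upper bound for the phases by at most `g` (`PhaseIn.serre`). If the phases of `G` lie in `[a,b]`,
those of `S^n G` are at most `b + ng`. As `H^k(S^n G)` is `Hom(G, S^n G[k])`, its nonvanishing
forces `-k ≤ ng + b - a` (`exists_forall_betti_ne_zero`). With `k = k_n`, dividing by `n` gives the
theorem. -/

lemma distTriang_of_iso {X Y Z X' Y' Z' : T} {f : X ⟶ Y} {g : Y ⟶ Z}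
    {h : Z ⟶ (shiftFunctor T (1 : ℤ)).obj X} (ht : Triangle.mk f g h ∈ distTriang T) {f' : X' ⟶ Y'}
    {g' : Y' ⟶ Z'} {h' : Z' ⟶ (shiftFunctor T (1 : ℤ)).obj X'} (e₁ : X ≅ X') (e₂ : Y ≅ Y')
    (e₃ : Z ≅ Z') (h₁ : f ≫ e₂.hom = e₁.hom ≫ f') (h₂ : g ≫ e₃.hom = e₂.hom ≫ g')
    (h₃ : h ≫ (shiftFunctor T (1 : ℤ)).map e₁.hom = e₃.hom ≫ h') :
    Triangle.mk f' g' h' ∈ distTriang T :=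
  isomorphic_distinguished _ ht _ (Triangle.isoMk (Triangle.mk f g h) (Triangle.mk f' g' h')
    e₁ e₂ e₃ h₁ h₂ h₃).symm

lemma exists_distTriang_of_iso {t : Triangle T} (ht : t ∈ distTriang T) {X Y Z : T}
    (e₁ : t.obj₁ ≅ X) (e₂ : t.obj₂ ≅ Y) (e₃ : t.obj₃ ≅ Z) :
    ∃ (f : X ⟶ Y) (g : Y ⟶ Z) (h : Z ⟶ (shiftFunctor T (1 : ℤ)).obj X),
      Triangle.mk f g h ∈ distTriang T := by
  refine ⟨e₁.inv ≫ t.mor₁ ≫ e₂.hom, e₂.inv ≫ t.mor₂ ≫ e₃.hom,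
    e₃.inv ≫ t.mor₃ ≫ (shiftFunctor T (1 : ℤ)).map e₁.hom,
    distTriang_of_iso ht e₁ e₂ e₃ (by simp) (by simp) (by simp)⟩

def boolProdIso (X : Bool → T) : (∏ᶜ X) ≅ X true ⊞ X false where
  hom := biprod.lift (Pi.π X true) (Pi.π X false)
  inv := Pi.lift fun b => match b with
    | true => biprod.fst
    | false => biprod.snd
  hom_inv_id := by
    refine Pi.hom_ext _ _ fun b => ?_
    cases b <;> simp
  inv_hom_id := by
    ext <;> simp

lemma exists_distTriang_biprod {t t' : Triangle T} (ht : t ∈ distTriang T)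
    (ht' : t' ∈ distTriang T) :
    ∃ (f : t.obj₁ ⊞ t'.obj₁ ⟶ t.obj₂ ⊞ t'.obj₂) (g : t.obj₂ ⊞ t'.obj₂ ⟶ t.obj₃ ⊞ t'.obj₃)
      (h : t.obj₃ ⊞ t'.obj₃ ⟶ (shiftFunctor T (1 : ℤ)).obj (t.obj₁ ⊞ t'.obj₁)),
      Triangle.mk f g h ∈ distTriang T := by
  let s : Bool → Triangle T := fun b => match b with
    | true => t
    | false => t'
  have hs : productTriangle s ∈ distTriang T :=
    productTriangle_distinguished s (by rintro (_ | _) <;> assumption)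
  exact exists_distTriang_of_iso hs (boolProdIso fun b => (s b).obj₁)
    (boolProdIso fun b => (s b).obj₂) (boolProdIso fun b => (s b).obj₃)

lemma exists_distTriang_shift {E E' B : T} {f : E ⟶ E'} {g : E' ⟶ B}
    {h : B ⟶ (shiftFunctor T (1 : ℤ)).obj E} (ht : Triangle.mk f g h ∈ distTriang T) (n : ℤ) :
    ∃ (f' : (shiftFunctor T n).obj E ⟶ (shiftFunctor T n).obj E')
      (g' : (shiftFunctor T n).obj E' ⟶ (shiftFunctor T n).obj B)
      (h' : (shiftFunctor T n).obj B ⟶ (shiftFunctor T (1 : ℤ)).obj ((shiftFunctor T n).obj E)),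
      Triangle.mk f' g' h' ∈ distTriang T :=
  ⟨_, _, _, Triangle.shift_distinguished _ ht n⟩

/-- The complement is the cone of the inclusion: a split monomorphism has vanishing connecting map,
so its triangle splits. -/
lemma Retract.exists_iso_biprod {R E : T} (r : Retract R E) : ∃ M : T, Nonempty (E ≅ R ⊞ M) := by
  obtain ⟨C, g, h, hd⟩ := distinguished_cocone_triangle r.i
  have : Mono r.i := mono_of_mono_fac r.retract
  have h0 : h = 0 := Triangle.mor₃_eq_zero_of_mono₁ _ hd this
  obtain ⟨e, -⟩ := exists_iso_binaryBiproduct_of_distTriang _ hd h0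
  exact ⟨C, ⟨e⟩⟩

namespace IsTower

lemma of_iso {l : List T} {E E' : T} (h : IsTower l E) (e : E ≅ E') : IsTower l E' := by
  cases h with
  | zero h => exact .zero (h.of_iso e.symm)
  | step f g h ht hE =>
    refine .step (f ≫ e.hom) (e.inv ≫ g) h ?_ hE
    exact distTriang_of_iso ht (Iso.refl _) e (Iso.refl _) (by simp) (by simp) (by simp)

lemma single (B : T) : IsTower [B] B :=
  .step (l := []) _ _ _ (contractible_distinguished₁ B) (.zero (isZero_zero T))

/-- The factors of `B` are pulled back to `E'` one at a time from the top: the octahedral axiom for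
`E' ⟶ B ⟶ (last factor)` exhibits the fibre of the composite as an extension of the preceding stage
of `B` by `E`. -/
lemma append [IsTriangulated T] {l l' : List T} {E E' B : T} {f : E ⟶ E'} {g : E' ⟶ B}
    {h : B ⟶ (shiftFunctor T (1 : ℤ)).obj E} (ht : Triangle.mk f g h ∈ distTriang T)
    (hE : IsTower l E) (hB : IsTower l' B) : IsTower (l ++ l') E' := by
  induction hB generalizing E' with
  | zero h0 =>
    have : IsIso f := (Triangle.isZero₃_iff_isIso₁ _ ht).1 h0
    simpa using hE.of_iso (asIso f)
  | step f' g' h' ht' _ ih =>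
    obtain ⟨E₁, a, b, hab⟩ := distinguished_cocone_triangle₁ (g ≫ g')
    have o := Triangulated.someOctahedron' rfl ht ht' hab
    rw [← List.append_assoc]
    exact .step _ _ _ hab (ih o.mem)

lemma map {l : List T} {E : T} (h : IsTower l E) (F : T ⥤ T) [F.CommShift ℤ]
    [F.IsTriangulated] : IsTower (l.map F.obj) (F.obj E) := by
  induction h with
  | zero h0 => exact .zero (F.map_isZero h0)
  | step f g h ht _ ih =>
    rw [List.map_append]
    exact .step _ _ _ (F.map_distinguished _ ht) ih

lemma shift {l : List T} {E : T} (h : IsTower l E) (n : ℤ) :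
    IsTower (l.map (shiftFunctor T n).obj) ((shiftFunctor T n).obj E) := by
  induction h with
  | zero h0 => exact .zero ((shiftFunctor T n).map_isZero h0)
  | step f g h ht _ ih =>
    rw [List.map_append]
    obtain ⟨_, _, _, ht'⟩ := exists_distTriang_shift ht n
    exact .step _ _ _ ht' ih

lemma congr {l l' : List T} {E : T} (h : IsTower l E)
    (hl : List.Forall₂ (fun X Y => Nonempty (X ≅ Y)) l l') : IsTower l' E := by
  induction h generalizing l' with
  | zero h0 =>
    cases hl
    exact .zero h0
  | step f g h ht _ ih =>
    obtain ⟨l₁, l₂, h₁, h₂, rfl⟩ : ∃ l₁ l₂, List.Forall₂ (fun X Y => Nonempty (X ≅ Y)) _ l₁ ∧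
        List.Forall₂ (fun X Y => Nonempty (X ≅ Y)) [_] l₂ ∧ l' = l₁ ++ l₂ :=
      ⟨_, _, (List.forall₂_take_append _ _ _ hl.flip).flip,
        (List.forall₂_drop_append _ _ _ hl.flip).flip, (List.take_append_drop _ _).symm⟩
    cases h₂ with
    | cons e h₂ =>
      cases h₂
      obtain ⟨e⟩ := e
      refine .step f (g ≫ e.hom) (e.inv ≫ h) ?_ (ih h₁)
      exact distTriang_of_iso ht (Iso.refl _) (Iso.refl _) e (by simp) (by simp) (by simp)

lemma congr_map {ι : Type*} {L : List ι} {f g : ι → T} {E : T} (h : IsTower (L.map f) E)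
    (e : ∀ i, f i ≅ g i) : IsTower (L.map g) E :=
  h.congr (by
    rw [List.forall₂_map_left_iff, List.forall₂_map_right_iff, List.forall₂_same]
    exact fun i _ => ⟨e i⟩)

lemma shift_map {L : List ℤ} {G E : T} (h : IsTower (L.map fun n => (shiftFunctor T n).obj G) E)
    (n : ℤ) : IsTower ((L.map (· + n)).map fun m => (shiftFunctor T m).obj G)
      ((shiftFunctor T n).obj E) := by
  have h1 := h.shift n
  rw [List.map_map] at h1 ⊢
  exact h1.congr_map fun m => ((shiftFunctorAdd T m n).app G).symm

end IsTower

/-- `Built L Y E`: the object `E` is a direct summand of the total object of a tower with factors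
`Y[n]`, `n ∈ L`. -/
def Built (L : List ℤ) (Y E : T) : Prop :=
  ∃ M : T, IsTower (L.map fun n => (shiftFunctor T n).obj Y) (E ⊞ M)

def biprodAssocIso (X Y Z : T) : (X ⊞ Y) ⊞ Z ≅ X ⊞ (Y ⊞ Z) where
  hom := biprod.lift (biprod.fst ≫ biprod.fst) (biprod.map biprod.snd (𝟙 _))
  inv := biprod.lift (biprod.map (𝟙 _) biprod.fst) (biprod.snd ≫ biprod.snd)

namespace Built

lemma of_isTower {L : List ℤ} {Y E : T}
    (h : IsTower (L.map fun n => (shiftFunctor T n).obj Y) E) : Built L Y E :=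
  ⟨0, h.of_iso (isoBiprodZero (isZero_zero T))⟩

lemma of_isZero {Y E : T} (h : IsZero E) : Built [] Y E :=
  .of_isTower (.zero h)

lemma refl (Y : T) : Built [0] Y Y :=
  .of_isTower ((IsTower.single _).of_iso ((shiftFunctorZero T ℤ).app Y))

lemma of_retract {L : List ℤ} {Y E R : T} (h : Built L Y E) (r : Retract R E) :
    Built L Y R := by
  obtain ⟨M, hM⟩ := h
  obtain ⟨C, ⟨e⟩⟩ := Retract.exists_iso_biprod r
  exact ⟨C ⊞ M, hM.of_iso (biprod.mapIso e (Iso.refl M) ≪≫ biprodAssocIso _ _ _)⟩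

lemma of_iso {L : List ℤ} {Y E E' : T} (h : Built L Y E) (e : E ≅ E') : Built L Y E' :=
  h.of_retract (Retract.ofIso e.symm)

/-- Adding the split triangle on the two complements to the given triangle turns it into one between
total objects of towers. -/
lemma extension [IsTriangulated T] {L L' : List ℤ} {Y E E' B : T} {f : E ⟶ E'} {g : E' ⟶ B}
    {h : B ⟶ (shiftFunctor T (1 : ℤ)).obj E} (ht : Triangle.mk f g h ∈ distTriang T)
    (hE : Built L Y E) (hB : Built L' Y B) : Built (L ++ L') Y E' := by
  obtain ⟨N, hN⟩ := hE
  obtain ⟨M, hM⟩ := hB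
  obtain ⟨_, _, _, hd⟩ := exists_distTriang_biprod ht (binaryBiproductTriangle_distinguished N M)
  refine ⟨N ⊞ M, ?_⟩
  rw [List.map_append]
  exact IsTower.append hd hN hM

lemma shift {L : List ℤ} {Y E : T} (h : Built L Y E) (n : ℤ) :
    Built (L.map (· + n)) Y ((shiftFunctor T n).obj E) := by
  obtain ⟨M, hM⟩ := h
  have := preservesBinaryBiproducts_of_preservesBiproducts (shiftFunctor T n)
  exact ⟨_, (hM.shift_map n).of_iso ((shiftFunctor T n).mapBiprod E M)⟩

lemma map {L : List ℤ} {Y E : T} (h : Built L Y E) (F : T ⥤ T) [F.CommShift ℤ]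
    [F.IsTriangulated] : Built L (F.obj Y) (F.obj E) := by
  obtain ⟨M, hM⟩ := h
  have := preservesBinaryBiproducts_of_preservesBiproducts F
  refine ⟨F.obj M, IsTower.of_iso ?_ (F.mapBiprod E M)⟩
  have h1 := hM.map F
  rw [List.map_map] at h1
  exact h1.congr_map fun m => (F.commShiftIso m).app Y

/-- Each factor `E[n]` is replaced by a shifted copy of the tower for `E`; the complements of the
copies are absorbed by `extension`. -/
lemma of_isTower_of_built [IsTriangulated T] {L L' : List ℤ} {Y E E' : T} (h : Built L Y E)
    (h' : IsTower (L'.map fun n => (shiftFunctor T n).obj E) E') :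
    Built (L'.flatMap fun n => L.map (· + n)) Y E' := by
  generalize hl : (L'.map fun n => (shiftFunctor T n).obj E) = l at h'
  induction h' generalizing L' with
  | zero h0 =>
    obtain rfl := List.map_eq_nil_iff.1 hl
    exact .of_isZero h0
  | step f g k ht _ ih =>
    obtain ⟨l₁, l₂, rfl, h₁, h₂⟩ := List.map_eq_append_iff.1 hl
    obtain ⟨n, l₃, rfl, rfl, h₃⟩ := List.map_eq_cons_iff.1 h₂
    obtain rfl := List.map_eq_nil_iff.1 h₃
    rw [List.flatMap_append, List.flatMap_singleton]
    exact extension ht (ih h₁) (h.shift n)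

lemma trans [IsTriangulated T] {L L' : List ℤ} {Y E E' : T} (h : Built L Y E)
    (h' : Built L' E E') : Built (L'.flatMap fun n => L.map (· + n)) Y E' := by
  obtain ⟨M, hM⟩ := h'
  exact (of_isTower_of_built h hM).of_retract ⟨biprod.inl, biprod.fst, by simp⟩

/-- The direct sum of an object and its shift is the total object of a tower, if the object is a
direct summand of such an object. -/
lemma exists_isTower_biprod_shift [IsTriangulated T] {L : List ℤ} {Y E : T} (h : Built L Y E) :
    ∃ L' : List ℤ, IsTower (L'.map fun n => (shiftFunctor T n).obj Y)
      (E ⊞ (shiftFunctor T (1 : ℤ)).obj E) := by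
  obtain ⟨M, hM⟩ := h
  -- The triangle `M ⟶ 0 ⟶ M[1]` is added to the split one: the outer terms become `E ⊞ M` and its
  -- shift, while `M` cancels in the middle.
  obtain ⟨_, _, _, hd⟩ := exists_distTriang_biprod
    (binaryBiproductTriangle_distinguished E ((shiftFunctor T (1 : ℤ)).obj E))
    (contractible_distinguished₂ M)
  have := preservesBinaryBiproducts_of_preservesBiproducts (shiftFunctor T (1 : ℤ))
  refine ⟨L ++ L.map (· + 1), ?_⟩
  rw [List.map_append]
  exact (IsTower.append hd hM ((hM.shift_map 1).of_iso
    ((shiftFunctor T (1 : ℤ)).mapBiprod E M))).of_iso (isoBiprodZero (isZero_zero T)).symm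

end Built

/-- The objects built from shifts of `G` by extensions and direct summands. -/
def builtProperty (G : T) : ObjectProperty T := fun E => ∃ L : List ℤ, Built L G E

instance (G : T) : (builtProperty G).IsStableUnderRetracts where
  of_retract r := fun ⟨L, h⟩ => ⟨L, h.of_retract r⟩

instance [IsTriangulated T] (G : T) : (builtProperty G).IsTriangulated where
  exists_zero := ⟨0, isZero_zero T, [], .of_isZero (isZero_zero T)⟩
  isStableUnderShiftBy n := ⟨fun _ ⟨_, h⟩ => ⟨_, h.shift n⟩⟩
  toIsTriangulatedClosed₂ := .mk' fun _ ht ⟨_, h₁⟩ ⟨_, h₃⟩ => ⟨_, Built.extension ht h₁ h₃⟩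

lemma IsSplitGenerator.exists_built [IsTriangulated T] {G : T} (hG : IsSplitGenerator G) (E : T) :
    ∃ L : List ℤ, Built L G E := by
  have h : (ObjectProperty.singleton G).triangEnvelope ≤ builtProperty G := by
    rw [ObjectProperty.triangEnvelope_le_iff, ObjectProperty.singleton_le_iff]
    exact ⟨_, Built.refl G⟩
  rw [show (ObjectProperty.singleton G).triangEnvelope = ⊤ from hG] at h
  exact h E trivial

/-! ### Complexity: submultiplicativity and behaviour under exact functors. -/

lemma complexity_le_of_built {t : ℝ} {G E : T} {L : List ℤ} (h : Built L G E) :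
    complexity t G E ≤ ENNReal.ofReal (L.map fun n : ℤ => Real.exp (n * t)).sum := by
  obtain ⟨M, hM⟩ := h
  exact iInf_le_of_le M (iInf_le_of_le L (iInf_le _ hM))

lemma complexity_lt_iff {t : ℝ} {G E : T} {c : ℝ≥0∞} : complexity t G E < c ↔
    ∃ L : List ℤ, Built L G E ∧ ENNReal.ofReal (L.map fun n : ℤ => Real.exp (n * t)).sum < c := by
  simp only [complexity, iInf_lt_iff, Built, exists_prop]
  constructor
  · rintro ⟨M, L, h, h'⟩
    exact ⟨L, ⟨M, h⟩, h'⟩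
  · rintro ⟨L, ⟨M, h⟩, h'⟩
    exact ⟨M, L, h, h'⟩

lemma le_complexity_iff {t : ℝ} {G E : T} {c : ℝ≥0∞} : c ≤ complexity t G E ↔
    ∀ L : List ℤ, Built L G E → c ≤ ENNReal.ofReal (L.map fun n : ℤ => Real.exp (n * t)).sum := by
  rw [← not_lt, complexity_lt_iff]
  simp

lemma IsSplitGenerator.complexity_ne_top [IsTriangulated T] {G : T} (hG : IsSplitGenerator G)
    (t : ℝ) (E : T) : complexity t G E ≠ ⊤ := by
  obtain ⟨L, h⟩ := hG.exists_built E
  exact ne_top_of_le_ne_top ENNReal.ofReal_ne_top (complexity_le_of_built h)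

lemma sum_flatMap_exp (t : ℝ) (L L' : List ℤ) :
    ((L'.flatMap fun n => L.map (· + n)).map fun n : ℤ => Real.exp (n * t)).sum =
      (L.map fun n : ℤ => Real.exp (n * t)).sum * (L'.map fun n : ℤ => Real.exp (n * t)).sum := by
  induction L' with
  | nil => simp
  | cons n L' ih =>
    rw [List.flatMap_cons, List.map_append, List.sum_append, ih, List.map_cons, List.sum_cons,
      mul_add, List.map_map]
    congr 1
    rw [← List.sum_map_mul_right]
    congr 1
    refine List.map_congr_left fun m _ => ?_
    simp [add_mul, Real.exp_add]

lemma sum_exp_nonneg (t : ℝ) (L : List ℤ) : 0 ≤ (L.map fun n : ℤ => Real.exp (n * t)).sum :=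
  List.sum_nonneg (by
    simp only [List.mem_map]
    rintro _ ⟨n, -, rfl⟩
    positivity)

/-- Substituting towers multiplies weights, by `sum_flatMap_exp`. The finiteness hypotheses keep the
product of the two infima away from `0 · ∞`. -/
lemma complexity_trans [IsTriangulated T] {t : ℝ} {G E E' : T} (h : complexity t G E ≠ ⊤)
    (h' : complexity t E E' ≠ ⊤) :
    complexity t G E' ≤ complexity t G E * complexity t E E' := by
  refine ENNReal.le_mul_of_forall_lt (.inr h') (.inl h) fun a ha b hb => ?_
  obtain ⟨L, hL, hL'⟩ := complexity_lt_iff.1 ha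
  obtain ⟨K, hK, hK'⟩ := complexity_lt_iff.1 hb
  refine (complexity_le_of_built (hL.trans hK)).trans ?_
  rw [sum_flatMap_exp, ENNReal.ofReal_mul (sum_exp_nonneg t L)]
  exact mul_le_mul' hL'.le hK'.le

lemma complexity_map_le (t : ℝ) (G E : T) (F : T ⥤ T) [F.CommShift ℤ] [F.IsTriangulated] :
    complexity t (F.obj G) (F.obj E) ≤ complexity t G E :=
  le_complexity_iff.2 fun _ h => complexity_le_of_built (h.map F)

lemma complexity_iterate_le (t : ℝ) (G E : T) (F : T ⥤ T) [F.CommShift ℤ] [F.IsTriangulated]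
    (n : ℕ) : complexity t (F.obj^[n] G) (F.obj^[n] E) ≤ complexity t G E := by
  induction n with
  | zero => exact le_rfl
  | succ n ih =>
    rw [Function.iterate_succ_apply', Function.iterate_succ_apply']
    exact (complexity_map_le t _ _ F).trans ih

end Towers

/-! ### Homogeneous components and cohomology of dg modules. -/

namespace DGModule

variable {A : DGAlgebra.{w}}

section Components

variable {V W : Type*} [AddCommGroup V] [Module ℂ V] [AddCommGroup W] [Module ℂ W]

lemma linearMap_ext_of_isInternal {g : ℤ → Submodule ℂ V} (hg : DirectSum.IsInternal g)
    {φ ψ : V →ₗ[ℂ] W} (h : ∀ i, ∀ x ∈ g i, φ x = ψ x) : φ = ψ := by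
  have h1 : (⨆ i, g i) ≤ LinearMap.eqLocus φ ψ := iSup_le fun i x hx => h i x hx
  rw [hg.submodule_iSup_eq_top] at h1
  exact LinearMap.ext fun x => h1 trivial

lemma bijective_coeLinearMap {g : ℤ → Submodule ℂ V} (hg : DirectSum.IsInternal g) :
    Function.Bijective (DirectSum.coeLinearMap g) := hg

/-- The projection of an internal direct sum onto a summand, as an endomorphism. -/
def component {g : ℤ → Submodule ℂ V} (hg : DirectSum.IsInternal g) (k : ℤ) : V →ₗ[ℂ] V :=
  (g k).subtype ∘ₗ DirectSum.component ℂ ℤ (fun i => g i) k ∘ₗ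
    (LinearEquiv.ofBijective _ (bijective_coeLinearMap hg)).symm.toLinearMap

variable {g : ℤ → Submodule ℂ V} (hg : DirectSum.IsInternal g)

lemma component_mem (k : ℤ) (x : V) : component hg k x ∈ g k := Subtype.mem _

lemma component_of_mem_aux {i : ℤ} {x : V} (hx : x ∈ g i) :
    (LinearEquiv.ofBijective _ (bijective_coeLinearMap hg)).symm x =
      DirectSum.lof ℂ ℤ (fun i => g i) i ⟨x, hx⟩ := by
  rw [LinearEquiv.symm_apply_eq]
  simp

lemma component_of_mem {k : ℤ} {x : V} (hx : x ∈ g k) : component hg k x = x := by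
  simp [component, component_of_mem_aux hg hx, DirectSum.component.lof_self]

lemma component_of_mem_ne {k i : ℤ} {x : V} (hx : x ∈ g i) (h : i ≠ k) :
    component hg k x = 0 := by
  simp [component, component_of_mem_aux hg hx, DirectSum.component.of, h]

/-- A linear map of degree `n` commutes with the projections onto the graded pieces. -/
lemma map_component {g' : ℤ → Submodule ℂ W} (hg' : DirectSum.IsInternal g') {φ : V →ₗ[ℂ] W}
    {n : ℤ} (hφ : ∀ {i : ℤ} {x : V}, x ∈ g i → φ x ∈ g' (i + n)) (k : ℤ) (x : V) :
    φ (component hg k x) = component hg' (k + n) (φ x) := by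
  refine LinearMap.congr_fun (f := φ ∘ₗ component hg k) (g := component hg' (k + n) ∘ₗ φ)
    (linearMap_ext_of_isInternal hg fun i y hy => ?_) x
  by_cases h : i = k
  · subst h
    simp [component_of_mem hg hy, component_of_mem hg' (hφ hy)]
  · have h' : i + n ≠ k + n := fun h' => h (add_right_cancel h')
    simp [component_of_mem_ne hg hy h, component_of_mem_ne hg' (hφ hy) h']

end Components

lemma d_component (M : DGModule A) (k : ℤ) (m : M.carrier) :
    M.d (component M.isInternal k m) = component M.isInternal (k + 1) (M.d m) :=
  map_component _ _ (fun h => M.d_mem h) k m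

lemma Hom.map_component {M N : DGModule A} (f : M ⟶ N) (k : ℤ) (m : M.carrier) :
    f.toFun (component M.isInternal k m) = component N.isInternal k (f.toFun m) := by
  have := DGModule.map_component M.isInternal N.isInternal (φ := f.toFun) (n := 0)
    (fun {i x} h => by simpa using f.map_mem h) k m
  simpa using this

/-- A homogeneous boundary is the differential of a homogeneous element. -/
lemma exists_d_eq_of_mem (M : DGModule A) {k : ℤ} {m : M.carrier} (hm : m ∈ M.gr k)
    (h : m ∈ LinearMap.range M.d) : ∃ x ∈ M.gr (k - 1), M.d x = m := by
  obtain ⟨x, rfl⟩ := h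
  refine ⟨component M.isInternal (k - 1) x, component_mem _ _ _, ?_⟩
  rw [d_component, sub_add_cancel, component_of_mem _ hm]

/-! ### Cohomology -/

/-- The cocycles of degree `k`. -/
def cocycles (M : DGModule A) (k : ℤ) : Submodule ℂ M.carrier := LinearMap.ker M.d ⊓ M.gr k

/-- The coboundaries of degree `k`, as a submodule of the cocycles. -/
def coboundaries (M : DGModule A) (k : ℤ) : Submodule ℂ (M.cocycles k) :=
  (LinearMap.range M.d).submoduleOf (M.cocycles k)

/-- The cohomology of a dg module in degree `k`. -/
abbrev H (M : DGModule A) (k : ℤ) : Type w := M.cocycles k ⧸ M.coboundaries k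

/-- The class of a cocycle. -/
def H.mk {M : DGModule A} {k : ℤ} (m : M.carrier) (hm : m ∈ M.cocycles k) : M.H k :=
  (M.coboundaries k).mkQ ⟨m, hm⟩

lemma H.mk_eq_iff {M : DGModule A} {k : ℤ} {m m' : M.carrier} {hm : m ∈ M.cocycles k}
    {hm' : m' ∈ M.cocycles k} : H.mk m hm = H.mk m' hm' ↔ m - m' ∈ LinearMap.range M.d :=
  Submodule.Quotient.eq _

lemma H.mk_eq_zero_iff {M : DGModule A} {k : ℤ} {m : M.carrier} {hm : m ∈ M.cocycles k} :
    H.mk m hm = 0 ↔ m ∈ LinearMap.range M.d :=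
  Submodule.Quotient.mk_eq_zero _

lemma H.exists_rep {M : DGModule A} {k : ℤ} (c : M.H k) : ∃ m hm, H.mk (M := M) m hm = c := by
  obtain ⟨⟨m, hm⟩, h⟩ := Submodule.Quotient.mk_surjective _ c
  exact ⟨m, hm, h⟩

lemma Hom.map_mem_cocycles {M N : DGModule A} (f : M ⟶ N) {k : ℤ} {m : M.carrier}
    (hm : m ∈ M.cocycles k) : f.toFun m ∈ N.cocycles k := by
  refine ⟨?_, f.map_mem hm.2⟩
  exact (f.map_d m).symm.trans ((congrArg f.toFun hm.1).trans (map_zero _))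

/-- The map induced on cohomology by a morphism of dg modules. -/
def Hom.mapH {M N : DGModule A} (f : M ⟶ N) (k : ℤ) : M.H k →ₗ[ℂ] N.H k :=
  Submodule.mapQ _ _ (f.toFun.restrict fun _ hm => f.map_mem_cocycles hm) (by
    rintro ⟨x, hx⟩ ⟨y, hy⟩
    exact ⟨f.toFun y, by rw [← f.map_d]; exact congrArg f.toFun hy⟩)

lemma Hom.mapH_mk {M N : DGModule A} (f : M ⟶ N) {k : ℤ} {m : M.carrier}
    (hm : m ∈ M.cocycles k) :
    f.mapH k (H.mk m hm) = H.mk (f.toFun m) (f.map_mem_cocycles hm) := rfl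

variable (A) in
/-- Cohomology in degree `k` as a functor. -/
def cohomology (k : ℤ) : DGModule A ⥤ ModuleCat.{w} ℂ where
  obj M := ModuleCat.of ℂ (M.H k)
  map f := ModuleCat.ofHom (Hom.mapH f k)
  map_id M := ModuleCat.hom_ext (LinearMap.ext fun c => by
    obtain ⟨m, hm, rfl⟩ := H.exists_rep c
    rfl)
  map_comp f g := ModuleCat.hom_ext (LinearMap.ext fun c => by
    obtain ⟨m, hm, rfl⟩ := H.exists_rep c
    rfl)

/-- Quasi-isomorphisms are defined through total cohomology. The graded projections intertwine the
differentials, so applying them to preimages and primitives gives the statement degree by degree. -/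
lemma bijective_mapH {M N : DGModule A} {f : M ⟶ N} (hf : quasiIso A f) (k : ℤ) :
    Function.Bijective (Hom.mapH f k) := by
  refine ⟨(injective_iff_map_eq_zero _).2 fun c hc => ?_, fun c => ?_⟩
  · obtain ⟨m, hm, rfl⟩ := H.exists_rep c
    rw [Hom.mapH_mk, H.mk_eq_zero_iff] at hc
    obtain ⟨y, hy⟩ := hc
    obtain ⟨x, hx⟩ := hf.1 m hm.1 ⟨y, hy.symm⟩
    rw [H.mk_eq_zero_iff]
    exact ⟨x, hx.symm⟩
  · obtain ⟨n, hn, rfl⟩ := H.exists_rep c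
    obtain ⟨x, y, hx, hxy⟩ := hf.2 n hn.1
    have hx' : component M.isInternal k x ∈ M.cocycles k :=
      ⟨(d_component M k x).trans (by rw [hx, map_zero]), component_mem _ _ _⟩
    refine ⟨H.mk _ hx', ?_⟩
    rw [Hom.mapH_mk, H.mk_eq_iff]
    refine ⟨-component N.isInternal (k - 1) y, ?_⟩
    have h1 := congrArg (component N.isInternal k) hxy
    rw [component_of_mem _ hn.2, map_add] at h1
    rw [map_neg, d_component, Hom.map_component, sub_add_cancel]
    exact (sub_eq_iff_eq_add'.2 (by rw [← sub_eq_add_neg]; exact eq_sub_of_add_eq h1.symm)).symm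

/-- A morphism which is bijective is an isomorphism on cohomology. -/
lemma quasiIso_of_bijective {M N : DGModule A} {f : M ⟶ N} (hf : Function.Bijective f.toFun) :
    quasiIso A f := by
  refine ⟨fun x _ ⟨y, hy⟩ => ?_, fun y hy => ?_⟩
  · obtain ⟨z, rfl⟩ := hf.2 y
    exact ⟨z, hf.1 (hy.trans (f.map_d z).symm)⟩
  · obtain ⟨z, rfl⟩ := hf.2 y
    refine ⟨z, 0, hf.1 ?_, by simp⟩
    rw [f.map_d, hy, map_zero]

lemma cohomology_inverts (k : ℤ) : (quasiIso A).IsInvertedBy (cohomology A k) :=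
  fun _ _ f hf => by
    rw [ConcreteCategory.isIso_iff_bijective]
    exact bijective_mapH hf k

/-- The cohomology of a shift. -/
lemma rank_H_shift (M : DGModule A) (n k : ℤ) :
    Module.rank ℂ ((shiftObj n M).H k) = Module.rank ℂ (M.H (k + n)) := by
  have hd : ∀ m : M.carrier, (shiftObj n M).d m = M.d m ∨ (shiftObj n M).d m = -M.d m := fun m => by
    change n.negOnePow • M.d m = _ ∨ n.negOnePow • M.d m = _
    rcases Int.even_or_odd n with h | h
    · simp [Int.negOnePow_even n h]
    · simp [Int.negOnePow_odd n h]
  have hc : (shiftObj n M).cocycles k = M.cocycles (k + n) := by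
    ext m
    refine and_congr_left' ?_
    change (shiftObj n M).d m = 0 ↔ M.d m = 0
    rcases hd m with h | h
    · rw [h]
      rfl
    · rw [h]
      exact neg_eq_zero (a := M.d m)
  have hr : LinearMap.range (shiftObj n M).d = LinearMap.range M.d := by
    ext m
    constructor
    · rintro ⟨x, rfl⟩
      rcases hd x with h | h
      · exact ⟨x, h.symm⟩
      · exact ⟨-(show M.carrier from x), (map_neg M.d _).trans h.symm⟩
    · rintro ⟨x, rfl⟩
      rcases hd x with h | h
      · exact ⟨x, h⟩
      · exact ⟨-(show (shiftObj n M).carrier from x), (map_neg (shiftObj n M).d _).trans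
          ((congrArg Neg.neg h).trans (neg_neg (M.d x)))⟩
  refine LinearEquiv.rank_eq (Submodule.Quotient.equiv _ _ (LinearEquiv.ofEq _ _ hc) ?_)
  ext ⟨m, hm⟩
  constructor
  · rintro ⟨x, hx, hxm⟩
    obtain rfl : x.1 = m := congrArg Subtype.val hxm
    change _ ∈ LinearMap.range _
    rw [← hr]
    exact hx
  · intro hx
    refine ⟨⟨m, hc ▸ hm⟩, ?_, rfl⟩
    change _ ∈ LinearMap.range _
    rw [hr]
    exact hx

/-! ### Homotopic maps -/

/-- The cylinder of a dg module `M`: triples `(a, (b, c))` with `a, b` in `M` and `c` in `M[1]`. -/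
def cylinder (M : DGModule A) : DGModule A := by
  -- The cone of the zero map is the direct sum of `M` and a shifted contractible cone. Starting
  -- from `M[-1]` puts `b` in `M` and `c` in `M[1]`.
  exact cone (M := cone (𝟙 (shiftObj (-1) M))) (N := M)
    { toFun := 0
      map_act := fun _ _ => by simp
      map_mem := fun _ => Submodule.zero_mem _
      map_d := fun _ => by simp }

lemma cylinder_d (M : DGModule A) (a b c : M.carrier) :
    M.cylinder.d (a, (b, c)) = (M.d a, (M.d b - c, -M.d c)) := by
  change ((M.d a + 0, -(((-1 : ℤ).negOnePow • M.d b + c, -((-1 : ℤ).negOnePow • M.d c)))) :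
    M.carrier × (M.carrier × M.carrier)) = _
  have h : (-1 : ℤ).negOnePow = -1 := by simp
  rw [h]
  simp [sub_eq_add_neg, add_comm]

lemma mem_cylinder {M : DGModule A} {i : ℤ} {a b c : M.carrier} :
    (a, (b, c)) ∈ M.cylinder.gr i ↔ a ∈ M.gr i ∧ b ∈ M.gr i ∧ c ∈ M.gr (i + 1) := by
  change (a ∈ M.gr i ∧ b ∈ M.gr (i + 1 + -1) ∧ c ∈ M.gr (i + 1 + 1 + -1)) ↔ _
  rw [show i + 1 + -1 = i by ring, show i + 1 + 1 + -1 = i + 1 by ring]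

/-- The projection of the cylinder. -/
def cylinderProj (M : DGModule A) : M.cylinder ⟶ M where
  toFun := LinearMap.fst ℂ M.carrier (M.carrier × M.carrier)
  map_act _ _ := rfl
  map_mem := fun {_ m} h => (mem_cylinder (a := m.1) (b := m.2.1) (c := m.2.2).1 h).1
  map_d m := congrArg Prod.fst (M.cylinder_d m.1 m.2.1 m.2.2)

lemma quasiIso_cylinderProj (M : DGModule A) : quasiIso A M.cylinderProj := by
  refine ⟨?_, fun y hy => ⟨(y, (0, 0)), 0, ?_, ?_⟩⟩
  · rintro ⟨a, (b : M.carrier), (c : M.carrier)⟩ h ⟨y, hy⟩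
    replace h : ((M.d a, (M.d b - c, -M.d c)) : M.carrier × (M.carrier × M.carrier)) = 0 :=
      (M.cylinder_d a b c).symm.trans h
    have hy : a = M.d y := hy
    have hc : M.d b - c = 0 := congrArg (fun p => p.2.1) h
    refine ⟨(y, (0, -b)), Eq.trans ?_ (M.cylinder_d y 0 (-b)).symm⟩
    rw [hy]
    refine Prod.ext rfl (Prod.ext ?_ ?_)
    · change b = M.d 0 - -b
      simp
    · change c = -M.d (-b)
      rw [map_neg, neg_neg]
      exact (sub_eq_zero.1 hc).symm
  · refine (M.cylinder_d y 0 0).trans ?_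
    rw [hy, map_zero, neg_zero, sub_zero]
    rfl
  · rw [map_zero, add_zero]
    rfl

/-- Homotopic maps become equal in the derived category. -/
lemma Q_map_eq_of_homotopy {M N : DGModule A} (f g : M ⟶ N) (h : M.carrier →ₗ[ℂ] N.carrier)
    (h_act : ∀ m a, h (M.act m a) = N.act (h m) a)
    (h_mem : ∀ {i : ℤ} {m : M.carrier}, m ∈ M.gr (i + 1) → h m ∈ N.gr i)
    (h_d : ∀ m, N.d (h m) + h (M.d m) = f.toFun m - g.toFun m) :
    (DerivedCat.Q A).map f = (DerivedCat.Q A).map g := by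
  let s₀ : M ⟶ M.cylinder :=
    { toFun := LinearMap.inl ℂ M.carrier (M.carrier × M.carrier)
      map_act := fun m a => by
        change ((M.act m a, (0, 0)) : M.carrier × (M.carrier × M.carrier)) =
          (M.act m a, (M.act 0 a, M.act 0 a))
        simp
      map_mem := fun h => mem_cylinder.2 ⟨h, Submodule.zero_mem _, Submodule.zero_mem _⟩
      map_d := fun m => by
        refine Eq.trans ?_ (M.cylinder_d m 0 0).symm
        change ((M.d m, (0, 0)) : M.carrier × (M.carrier × M.carrier)) = _
        simp }
  let s₁ : M ⟶ M.cylinder :=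
    { toFun := LinearMap.prod LinearMap.id (LinearMap.inl ℂ M.carrier M.carrier)
      map_act := fun m a => by
        change ((M.act m a, (M.act m a, 0)) : M.carrier × (M.carrier × M.carrier)) =
          (M.act m a, (M.act m a, M.act 0 a))
        simp
      map_mem := fun h => mem_cylinder.2 ⟨h, h, Submodule.zero_mem _⟩
      map_d := fun m => by
        refine Eq.trans ?_ (M.cylinder_d m m 0).symm
        change ((M.d m, (M.d m, 0)) : M.carrier × (M.carrier × M.carrier)) = _
        simp }
  let ψ : M.cylinder ⟶ N :=
    { toFun := LinearMap.coprod g.toFun (LinearMap.coprod (f.toFun - g.toFun) (-h))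
      map_act := by
        rintro ⟨a, (b : M.carrier), (c : M.carrier)⟩ x
        change g.toFun (M.act a x) + ((f.toFun (M.act b x) - g.toFun (M.act b x)) +
          -h (M.act c x)) = N.act (g.toFun a + ((f.toFun b - g.toFun b) + -h c)) x
        rw [f.map_act, g.map_act, g.map_act, h_act]
        simp only [map_add, map_sub, map_neg, LinearMap.add_apply, LinearMap.sub_apply,
          LinearMap.neg_apply]
      map_mem := by
        rintro i ⟨a, b, c⟩ hm
        obtain ⟨ha, hb, hc⟩ := mem_cylinder.1 hm
        exact Submodule.add_mem _ (g.map_mem ha) (Submodule.add_mem _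
          (Submodule.sub_mem _ (f.map_mem hb) (g.map_mem hb)) (Submodule.neg_mem _ (h_mem hc)))
      map_d := by
        rintro ⟨a, (b : M.carrier), (c : M.carrier)⟩
        refine Eq.trans (congrArg _ (M.cylinder_d a b c)) ?_
        change g.toFun (M.d a) + ((f.toFun (M.d b - c) - g.toFun (M.d b - c)) +
          -h (-M.d c)) = N.d (g.toFun a + ((f.toFun b - g.toFun b) + -h c))
        have hc := h_d c
        simp only [map_sub, map_add, map_neg, f.map_d, g.map_d, neg_neg, eq_sub_iff_add_eq] at hc ⊢
        rw [← hc]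
        abel }
  -- Two sections of one quasi-isomorphism agree in the localization; composing them with `ψ` gives
  -- `g` and `f`.
  have h₀ : s₀ ≫ M.cylinderProj = 𝟙 M := rfl
  have h₁ : s₁ ≫ M.cylinderProj = 𝟙 M := rfl
  have hi : IsIso ((DerivedCat.Q A).map M.cylinderProj) :=
    (quasiIso A).Q_inverts _ (quasiIso_cylinderProj M)
  have hs : (DerivedCat.Q A).map s₀ = (DerivedCat.Q A).map s₁ := by
    rw [← cancel_mono ((DerivedCat.Q A).map M.cylinderProj), ← Functor.map_comp,
      ← Functor.map_comp, h₀, h₁]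
  have hg : s₀ ≫ ψ = g := by
    ext m
    change g.toFun m + ((f.toFun 0 - g.toFun 0) + -h 0) = g.toFun m
    simp
  have hf : s₁ ≫ ψ = f := by
    ext m
    change g.toFun m + ((f.toFun m - g.toFun m) + -h 0) = f.toFun m
    simp
  rw [← hf, ← hg, Functor.map_comp, Functor.map_comp, hs]

end DGModule

namespace DGModule

variable {A : DGAlgebra.{w}}

/-! ### Cones and short exact sequences -/

/-- Short exact sequences of dg modules. -/
structure IsShortExact {X Y Z : DGModule A} (f : X ⟶ Y) (g : Y ⟶ Z) : Prop where
  injective : Function.Injective f.toFun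
  exact : Function.Exact f.toFun g.toFun
  surjective : Function.Surjective g.toFun

/-- The morphism from the cone of `f` induced by a morphism `g` with `f ≫ g = 0`. -/
def coneDesc {X Y Z : DGModule A} (f : X ⟶ Y) (g : Y ⟶ Z) (h : ∀ x, g.toFun (f.toFun x) = 0) :
    cone f ⟶ Z where
  toFun := g.toFun ∘ₗ LinearMap.fst ℂ Y.carrier X.carrier
  map_act p a := g.map_act p.1 a
  map_mem hp := g.map_mem hp.1
  map_d p := by
    change g.toFun (Y.d p.1 + f.toFun p.2) = Z.d (g.toFun p.1)
    rw [map_add, h, add_zero, g.map_d]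

/-- By a diagram chase the third term of a short exact sequence is the cone of its first map, so
such sequences become distinguished triangles in `D(A)`. -/
lemma quasiIso_coneDesc {X Y Z : DGModule A} {f : X ⟶ Y} {g : Y ⟶ Z} (h : IsShortExact f g) :
    quasiIso A (coneDesc f g h.exact.apply_apply_eq_zero) := by
  refine ⟨?_, fun z hz => ?_⟩
  · rintro ⟨y, x⟩ hd ⟨z, hz⟩
    change g.toFun y = Z.d z at hz
    replace hd : ((Y.d y + f.toFun x, -X.d x) : Y.carrier × X.carrier) = 0 := hd
    have hd₁ : Y.d y + f.toFun x = 0 := congrArg Prod.fst hd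
    obtain ⟨y', rfl⟩ := h.surjective z
    obtain ⟨x', hx'⟩ := (h.exact (y - Y.d y')).1 (by rw [map_sub, g.map_d, hz, sub_self])
    have hx : x = -X.d x' := h.injective (by
      rw [map_neg, f.map_d, hx', map_sub, Y.d_d, sub_zero]
      exact eq_neg_of_add_eq_zero_right hd₁)
    refine ⟨(y', x'), ?_⟩
    refine Prod.ext ?_ hx
    change y = Y.d y' + f.toFun x'
    rw [hx']
    abel
  · obtain ⟨y, rfl⟩ := h.surjective z
    obtain ⟨x, hx⟩ := (h.exact (Y.d y)).1 (by rw [g.map_d, hz])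
    have hx' : X.d x = 0 := h.injective (by rw [f.map_d, hx, Y.d_d, map_zero])
    refine ⟨(y, -x), 0, ?_, ?_⟩
    · refine Prod.ext ?_ ?_
      · change Y.d y + f.toFun (-x) = 0
        rw [map_neg, hx, add_neg_cancel]
      · change -X.d (-x) = 0
        rw [map_neg, hx', neg_zero, neg_zero]
    · rw [map_zero, add_zero]
      rfl

/-- The morphism `X[1] ⟶ cone g` induced by a morphism `f` with `f ≫ g = 0`. -/
def coneLift {X Y Z : DGModule A} (f : X ⟶ Y) (g : Y ⟶ Z) (h : ∀ x, g.toFun (f.toFun x) = 0) :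
    shiftObj 1 X ⟶ cone g where
  toFun := LinearMap.inr ℂ Z.carrier Y.carrier ∘ₗ f.toFun
  map_act (x : X.carrier) a := by
    change ((0, f.toFun (X.act x a)) : Z.carrier × Y.carrier) = (Z.act 0 a, Y.act (f.toFun x) a)
    rw [f.map_act, map_zero, LinearMap.zero_apply]
  map_mem hx := ⟨Submodule.zero_mem _, f.map_mem hx⟩
  map_d (x : X.carrier) := by
    change ((0, f.toFun ((1 : ℤ).negOnePow • X.d x)) : Z.carrier × Y.carrier) =
      (Z.d 0 + g.toFun (f.toFun x), -Y.d (f.toFun x))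
    rw [h, map_zero, add_zero, Int.negOnePow_one, Units.neg_smul, one_smul, map_neg, f.map_d]

lemma shiftObj_one_d (X : DGModule A) (x : X.carrier) : (shiftObj 1 X).d x = -X.d x := by
  change (1 : ℤ).negOnePow • X.d x = _
  rw [Int.negOnePow_one, Units.neg_smul, one_smul]

/-- The companion of `quasiIso_coneDesc`: the first term is recovered, up to shift, from the cone of
the second map. -/
lemma quasiIso_coneLift {X Y Z : DGModule A} {f : X ⟶ Y} {g : Y ⟶ Z} (h : IsShortExact f g) :
    quasiIso A (coneLift f g h.exact.apply_apply_eq_zero) := by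
  refine ⟨?_, ?_⟩
  · rintro (x : X.carrier) - ⟨⟨z, y⟩, hzy⟩
    replace hzy : ((0, f.toFun x) : Z.carrier × Y.carrier) = (Z.d z + g.toFun y, -Y.d y) := hzy
    obtain ⟨h₁, h₂⟩ := Prod.mk.inj hzy
    obtain ⟨y', rfl⟩ := h.surjective z
    obtain ⟨x', hx'⟩ := (h.exact (y + Y.d y')).1 (by rw [map_add, g.map_d, add_comm, ← h₁])
    refine ⟨x', Eq.trans ?_ (shiftObj_one_d X x').symm⟩
    refine h.injective ?_
    rw [h₂, map_neg, f.map_d, hx', map_add, Y.d_d, add_zero]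
  · rintro ⟨z, y⟩ hd
    replace hd : ((Z.d z + g.toFun y, -Y.d y) : Z.carrier × Y.carrier) = 0 := hd
    have hd₁ : Z.d z + g.toFun y = 0 := congrArg Prod.fst hd
    have hd₂ : -Y.d y = 0 := congrArg Prod.snd hd
    obtain ⟨y', rfl⟩ := h.surjective z
    obtain ⟨x', hx'⟩ := (h.exact (y + Y.d y')).1 (by rw [map_add, g.map_d, add_comm, hd₁])
    refine ⟨x', (0, y'), (shiftObj_one_d X x').trans ?_, ?_⟩
    · refine h.injective (Eq.trans ?_ (map_zero f.toFun).symm)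
      rw [map_neg, f.map_d, hx', map_add, Y.d_d, add_zero]
      exact hd₂
    · change ((g.toFun y', y) : Z.carrier × Y.carrier) =
        ((0, f.toFun x') : Z.carrier × Y.carrier) + (Z.d 0 + g.toFun y', -Y.d y')
      rw [hx', map_zero]
      refine Prod.ext ?_ ?_
      · simp
      · simp

lemma isShortExact_cone {M N : DGModule A} (f : M ⟶ N) :
    IsShortExact (Z := shiftObj 1 M) (coneIncl f) (coneProj f) where
  injective x y h := congrArg Prod.fst h
  exact := by
    rintro ⟨n, m⟩
    constructor
    · intro h
      have hm : m = 0 := h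
      exact ⟨n, by rw [hm]; rfl⟩
    · rintro ⟨x, hx⟩
      exact (congrArg Prod.snd hx).symm
  surjective m := ⟨(0, m), rfl⟩

/-- The morphism of cones induced by a commutative square. -/
def coneMap {M N M' N' : DGModule A} (f : M ⟶ N) (f' : M' ⟶ N') (α : M ⟶ M') (β : N ⟶ N')
    (h : ∀ m, β.toFun (f.toFun m) = f'.toFun (α.toFun m)) : cone f ⟶ cone f' where
  toFun := LinearMap.prodMap β.toFun α.toFun
  map_act p a := Prod.ext (β.map_act p.1 a) (α.map_act p.2 a)
  map_mem hp := ⟨β.map_mem hp.1, α.map_mem hp.2⟩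
  map_d p := by
    refine Prod.ext ?_ ?_
    · change β.toFun (N.d p.1 + f.toFun p.2) = N'.d (β.toFun p.1) + f'.toFun (α.toFun p.2)
      rw [map_add, β.map_d, h]
    · change α.toFun (-M.d p.2) = -M'.d (α.toFun p.2)
      rw [map_neg, α.map_d]

/-- The five lemma, done on elements: primitives and representatives are chosen first in the
`M`-coordinate, and the resulting defect is then corrected in the `N`-coordinate. -/
lemma quasiIso_coneMap {M N M' N' : DGModule A} {f : M ⟶ N} {f' : M' ⟶ N'} {α : M ⟶ M'}
    {β : N ⟶ N'} (h : ∀ m, β.toFun (f.toFun m) = f'.toFun (α.toFun m)) (hα : quasiIso A α)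
    (hβ : quasiIso A β) : quasiIso A (coneMap f f' α β h) := by
  refine ⟨?_, ?_⟩
  · rintro ⟨n, m⟩ hd ⟨⟨n', m'⟩, hnm⟩
    replace hd : ((N.d n + f.toFun m, -M.d m) : N.carrier × M.carrier) = 0 := hd
    have hd₁ : N.d n + f.toFun m = 0 := congrArg Prod.fst hd
    have hd₂ : M.d m = 0 := neg_eq_zero.1 (congrArg Prod.snd hd)
    replace hnm : ((β.toFun n, α.toFun m) : N'.carrier × M'.carrier) =
      (N'.d n' + f'.toFun m', -M'.d m') := hnm
    obtain ⟨h₁, h₂⟩ := Prod.mk.inj hnm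
    obtain ⟨m₁, rfl⟩ := hα.1 m hd₂ ⟨-m', by rw [h₂, map_neg]⟩
    obtain ⟨m₂, q, hm₂, hq⟩ := hα.2 (α.toFun m₁ + m')
      (by rw [map_add, ← α.map_d, h₂, neg_add_cancel])
    have hm' : m' = α.toFun m₂ + M'.d q - α.toFun m₁ := by rw [← hq]; abel
    have hfm : f.toFun (M.d m₁) = f.toFun (M.d (m₁ - m₂)) := by rw [map_sub, hm₂, sub_zero]
    obtain ⟨r, hr⟩ := hβ.1 (n + f.toFun (m₁ - m₂))
      (by rw [map_add, ← f.map_d, ← hfm, hd₁]) ⟨n' + f'.toFun q, by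
        rw [map_add, h₁, hm', map_add, ← f'.map_d, h, map_sub, map_sub, map_add]
        simp only [map_sub]
        abel⟩
    refine ⟨(r, -(m₁ - m₂)), Prod.ext ?_ ?_⟩
    · change n = N.d r + f.toFun (-(m₁ - m₂))
      rw [← hr, map_neg]
      abel
    · change M.d m₁ = -M.d (-(m₁ - m₂))
      rw [map_neg, neg_neg, map_sub, hm₂, sub_zero]
  · rintro ⟨n', m'⟩ hd
    replace hd : ((N'.d n' + f'.toFun m', -M'.d m') : N'.carrier × M'.carrier) = 0 := hd
    have hd₁ : N'.d n' + f'.toFun m' = 0 := congrArg Prod.fst hd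
    have hd₂ : M'.d m' = 0 := neg_eq_zero.1 (congrArg Prod.snd hd)
    obtain ⟨m, q, hm, rfl⟩ := hα.2 m' hd₂
    have hβf : β.toFun (f.toFun m) = N'.d (-(n' + f'.toFun q)) := by
      rw [map_neg, map_add, ← f'.map_d, h, eq_neg_iff_add_eq_zero, ← hd₁, map_add]
      abel
    obtain ⟨r, hr⟩ := hβ.1 (f.toFun m) (by rw [← f.map_d, hm, map_zero]) ⟨_, hβf⟩
    obtain ⟨s, t, hs, hst⟩ := hβ.2 (β.toFun r + (n' + f'.toFun q)) (by
      rw [map_add, ← β.map_d, ← hr, hβf, map_neg, neg_add_cancel])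
    refine ⟨(s - r, m), (t, -q), Prod.ext ?_ ?_, Prod.ext ?_ ?_⟩
    · change N.d (s - r) + f.toFun m = 0
      rw [map_sub, hs, hr, zero_sub, neg_add_cancel]
    · change -M.d m = 0
      rw [hm, neg_zero]
    · change n' = β.toFun (s - r) + (N'.d t + f'.toFun (-q))
      rw [map_sub, map_neg, show β.toFun s = β.toFun r + (n' + f'.toFun q) - N'.d t by
        rw [hst]; abel]
      abel
    · change α.toFun m + M'.d q = α.toFun m + -M'.d (-q)
      rw [map_neg, neg_neg]

/-! ### Morphisms from the shifts of the free module -/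

/-- The morphism `A[m] ⟶ X` defined by a cocycle of degree `-m`. -/
def ofCocycle (m : ℤ) (X : DGModule A) (z : X.carrier) (hz : z ∈ X.cocycles (-m)) :
    shiftObj m (free A) ⟶ X where
  toFun := X.act z
  map_act (a : A.carrier) b := X.act_mul z a b
  map_mem {i} (a : A.carrier) (ha : a ∈ A.gr (i + m)) := by
    have h := X.act_mem hz.2 ha
    rwa [show -m + (i + m) = i by ring] at h
  map_d (a : A.carrier) := by
    have h1 := X.leibniz hz.2 a
    have h2 : X.d z = 0 := hz.1
    rw [h2, map_zero, LinearMap.zero_apply, zero_add, Int.negOnePow_neg] at h1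
    exact (map_zsmul (X.act z) ((m.negOnePow : ℤˣ) : ℤ) (A.d a)).trans h1.symm

lemma d_one (A : DGAlgebra.{w}) : A.d 1 = 0 := by
  have h := A.leibniz A.one_mem 1
  simpa using h

lemma one_mem_cocycles (m : ℤ) : (1 : A.carrier) ∈ (shiftObj m (free A)).cocycles (-m) := by
  refine ⟨?_, ?_⟩
  · change m.negOnePow • A.d 1 = 0
    rw [d_one, smul_zero]
  · change (1 : A.carrier) ∈ A.gr (-m + m)
    rw [neg_add_cancel]
    exact A.one_mem

end DGModule

/-! ### Maps from `A[m]` in the derived category as cohomology classes. -/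

namespace DerivedCat

variable {A : DGAlgebra.{w}}

open DGModule

variable (A) in
/-- Cohomology of objects of the derived category. -/
def cohomology (k : ℤ) : DerivedCat A ⥤ ModuleCat.{w} ℂ :=
  Localization.Construction.lift (DGModule.cohomology A k) (cohomology_inverts k)

lemma cohomology_map_Q_map (k : ℤ) {M N : DGModule A} (f : M ⟶ N) (c : M.H k) :
    (cohomology A k).map ((Q A).map f) c = Hom.mapH f k c := by
  have h : (cohomology A k).map ((Q A).map f) = ModuleCat.ofHom (Hom.mapH f k) := by
    refine (Functor.congr_hom (Localization.Construction.fac (DGModule.cohomology A k)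
      (cohomology_inverts k)) f).trans ?_
    exact (id_comp _).trans (comp_id ((DGModule.cohomology A k).map f))
  rw [h]
  rfl

/-- The morphism from a shift of the free module determined by a cohomology class. -/
def homOfClass (m : ℤ) (X : DGModule A) (c : X.H (-m)) :
    (Q A).obj (shiftObj m (free A)) ⟶ (Q A).obj X :=
  (Q A).map (ofCocycle m X _ (H.exists_rep c).choose_spec.choose)

/-- Independence of the representative: if `z' - z = d x`, then `a ↦ x · a` is a homotopy between
the two maps. -/
lemma homOfClass_mk (m : ℤ) (X : DGModule A) (z : X.carrier) (hz : z ∈ X.cocycles (-m)) :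
    homOfClass m X (H.mk z hz) = (Q A).map (ofCocycle m X z hz) := by
  have h := H.mk_eq_iff.1 (H.exists_rep (H.mk z hz)).choose_spec.choose_spec
  set z' := (H.exists_rep (H.mk z hz)).choose with hz'
  have hz₁ : z' ∈ X.cocycles (-m) := (H.exists_rep (H.mk z hz)).choose_spec.choose
  obtain ⟨x, hx, hxz⟩ := X.exists_d_eq_of_mem (Submodule.sub_mem _ hz₁.2 hz.2) h
  refine Q_map_eq_of_homotopy (M := shiftObj m (free A)) _ _ (X.act x)
    (fun a b => X.act_mul x a b) (fun {i} (a : A.carrier) (ha : a ∈ A.gr (i + 1 + m)) => ?_)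
    (fun (a : A.carrier) => ?_)
  · have h1 := X.act_mem hx ha
    rwa [show -m - 1 + (i + 1 + m) = i by ring] at h1
  · have h1 := X.leibniz hx a
    have h2 : X.act x ((shiftObj m (free A)).d a) = m.negOnePow • X.act x (A.d a) :=
      map_zsmul (X.act x) ((m.negOnePow : ℤˣ) : ℤ) (A.d a)
    refine (congrArg₂ (· + ·) h1 h2).trans ?_
    -- The Leibniz sign `(-1)^{-m-1}` of `x` is opposite to the sign `(-1)^m` of the shifted
    -- differential, so the terms in `x · d a` cancel.
    rw [hxz, Int.negOnePow_sub, Int.negOnePow_neg, Int.negOnePow_one]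
    change X.act (z' - z) a + _ + _ = X.act z' a - X.act z a
    simp

/-- The morphism from a shift of the free module to an object of the derived category determined
by a cohomology class. -/
def homOfClass' (m : ℤ) (Z : DerivedCat A) (c : (cohomology A (-m)).obj Z) :
    (Q A).obj (shiftObj m (free A)) ⟶ Z :=
  homOfClass m ((Localization.Construction.objEquiv (quasiIso A)).symm Z) c

lemma homOfClass'_mk (m : ℤ) (X : DGModule A) (z : X.carrier) (hz : z ∈ X.cocycles (-m)) :
    homOfClass' m ((Q A).obj X) (H.mk z hz) = (Q A).map (ofCocycle m X z hz) :=
  homOfClass_mk m X z hz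

/-- Every morphism of the localization is a composite of images of dg maps and inverses of
quasi-isomorphisms. Naturality is visible for the former, passes to inverses because cohomology
inverts quasi-isomorphisms, and is stable under composition. -/
lemma homOfClass'_comp (m : ℤ) {Z Z' : DerivedCat A} (f : Z ⟶ Z')
    (c : (cohomology A (-m)).obj Z) :
    homOfClass' m Z' ((cohomology A (-m)).map f c) = homOfClass' m Z c ≫ f := by
  let P : MorphismProperty (DerivedCat A) := fun Z Z' f =>
    ∀ c : ((cohomology A (-m)).obj Z),
      homOfClass' m Z' ((cohomology A (-m)).map f c) = homOfClass' m Z c ≫ f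
  have hQ : ∀ ⦃M N : DGModule A⦄ (g : M ⟶ N), P ((Q A).map g) := by
    intro M N g c
    obtain ⟨z, hz, rfl⟩ := H.exists_rep (M := M) c
    refine (congrArg (homOfClass' m ((Q A).obj N))
      (cohomology_map_Q_map (-m) g (H.mk z hz))).trans ?_
    refine (homOfClass_mk m N _ (g.map_mem_cocycles hz)).trans ?_
    refine Eq.trans ?_ (congrArg (· ≫ (Q A).map g) (homOfClass_mk m M z hz).symm)
    refine Eq.trans ?_ (Functor.map_comp _ _ _)
    congr 1
    ext a
    exact (g.map_act z a).symm
  have : P = ⊤ := by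
    have : P.IsStableUnderComposition := ⟨fun f g hf hg c => by
      rw [Functor.map_comp, ModuleCat.comp_apply, hg, hf, assoc]⟩
    refine Localization.Construction.morphismProperty_eq_top P hQ fun M N g hg c => ?_
    let i := Localization.Construction.wIso g hg
    have h1 := hQ g ((cohomology A (-m)).map i.inv c)
    have h2 : (cohomology A (-m)).map ((Q A).map g) ((cohomology A (-m)).map i.inv c) = c := by
      rw [← ModuleCat.comp_apply, ← Functor.map_comp]
      have : i.inv ≫ (Q A).map g = 𝟙 _ := i.inv_hom_id
      rw [this, CategoryTheory.Functor.map_id]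
      rfl
    rw [h2] at h1
    have h3 : (Q A).map g ≫ i.inv = 𝟙 _ := i.hom_inv_id
    change homOfClass' m _ ((cohomology A (-m)).map i.inv c) = homOfClass' m _ c ≫ i.inv
    rw [h1, assoc, h3, comp_id]
  have h : P f := by rw [this]; trivial
  exact h c

/-- The class of the unit of `A` in the cohomology of `A[m]`. -/
def oneClass (A : DGAlgebra.{w}) (m : ℤ) : (shiftObj m (free A)).H (-m) :=
  H.mk (show A.carrier from 1) (one_mem_cocycles m)

/-- The Yoneda argument: the class of the unit corresponds to the identity of `A[m]`, so by
naturality `f` is determined by the image of that class. -/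
lemma exists_eq_map_ofCocycle (m : ℤ) (X : DGModule A)
    (f : (Q A).obj (shiftObj m (free A)) ⟶ (Q A).obj X) :
    ∃ z hz, f = (Q A).map (ofCocycle m X z hz) := by
  obtain ⟨z, hz, h⟩ := H.exists_rep (M := X) ((cohomology A (-m)).map f (oneClass A m))
  refine ⟨z, hz, ?_⟩
  have h1 := homOfClass'_comp m f (oneClass A m)
  have h2 : ofCocycle m (shiftObj m (free A)) (show A.carrier from 1) (one_mem_cocycles m) =
      𝟙 (shiftObj m (free A)) := by
    ext a
    exact one_mul (show A.carrier from a)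
  have h3 : homOfClass' m ((Q A).obj (shiftObj m (free A))) (oneClass A m) = 𝟙 _ := by
    refine (homOfClass_mk m (shiftObj m (free A)) _ (one_mem_cocycles m)).trans ?_
    rw [h2]
    exact CategoryTheory.Functor.map_id _ _
  rw [h3, id_comp] at h1
  exact h1.symm.trans ((congrArg (homOfClass' m ((Q A).obj X)) h.symm).trans
    (homOfClass'_mk m X z hz))

lemma mapH_ofCocycle_oneClass (m : ℤ) (X : DGModule A) (z : X.carrier)
    (hz : z ∈ X.cocycles (-m)) :
    Hom.mapH (ofCocycle m X z hz) (-m) (oneClass A m) = H.mk z hz := by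
  refine H.mk_eq_iff.2 ?_
  have h : X.act z 1 - z = 0 := by rw [X.act_one, sub_self]
  exact ⟨0, (map_zero _).trans h.symm⟩

/-- If all morphisms `A[m] ⟶ X` coincide, then the cohomology in degree `-m` vanishes. -/
lemma subsingleton_H (m : ℤ) (X : DGModule A)
    [Subsingleton ((Q A).obj (shiftObj m (free A)) ⟶ (Q A).obj X)] : Subsingleton (X.H (-m)) := by
  have key : ∀ c c' : X.H (-m), c = c' := by
    intro c c'
    obtain ⟨z, hz, rfl⟩ := H.exists_rep c
    obtain ⟨z', hz', rfl⟩ := H.exists_rep c'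
    have h := Subsingleton.elim ((Q A).map (ofCocycle m X z hz))
      ((Q A).map (ofCocycle m X z' hz'))
    rw [← mapH_ofCocycle_oneClass, ← mapH_ofCocycle_oneClass, ← cohomology_map_Q_map,
      ← cohomology_map_Q_map, h]
  exact ⟨key⟩

lemma rank_cohomology_congr (k : ℤ) {Z Z' : DerivedCat A} (i : Z ≅ Z') :
    Module.rank ℂ ((cohomology A k).obj Z) = Module.rank ℂ ((cohomology A k).obj Z') :=
  LinearEquiv.rank_eq ((cohomology A k).mapIso i).toLinearEquiv

/-- Quasi-isomorphic dg modules are isomorphic in the derived category. -/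
def isoOfQuasiIso {M N : DGModule A} (f : M ⟶ N) (hf : quasiIso A f) :
    (Q A).obj M ≅ (Q A).obj N :=
  Localization.Construction.wIso f hf

end DerivedCat

/-! ### Transport between `T` and perfect dg modules; cohomology as a lower bound for complexity. -/

section Perf

variable {T : Type u} [Category.{v} T] [Preadditive T] [Linear ℂ T] [HasZeroObject T]
  [HasShift T ℤ] [∀ n : ℤ, (shiftFunctor T n).Additive] [Pretriangulated T] {A : DGAlgebra.{w}}

open DerivedCat DGModule

lemma DerivedCat.IsDistinguished.of_iso {t t' : Triangle (DerivedCat A)} (h : IsDistinguished t)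
    (i : t ≅ t') : IsDistinguished t' := by
  obtain ⟨M, N, f, ⟨j⟩⟩ := h
  exact ⟨M, N, f, ⟨i.symm ≪≫ j⟩⟩

lemma DerivedCat.isDistinguished_coneTriangle {M N : DGModule A} (f : M ⟶ N) :
    IsDistinguished (coneTriangle f) := ⟨M, N, f, ⟨Iso.refl _⟩⟩

lemma DerivedCat.IsPerfect.of_iso {X Y : DerivedCat A} (h : IsPerfect A X) (i : X ≅ Y) :
    IsPerfect A Y := .retract (Retract.ofIso i.symm) h

namespace PerfEquivalence

variable (e : PerfEquivalence T A)

instance : e.functor.Full := e.full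
instance : e.functor.Faithful := e.faithful
instance : e.functor.CommShift ℤ := e.commShift

lemma isPerfect_obj (E : T) : IsPerfect A (e.functor.obj E) :=
  (e.essImage_iff _).1 (e.functor.obj_mem_essImage E)

lemma exists_iso {X : DerivedCat A} (h : IsPerfect A X) :
    ∃ E : T, Nonempty (e.functor.obj E ≅ X) :=
  (e.essImage_iff X).2 h

lemma isPerfect_of_iso {E : T} {X : DerivedCat A} (i : e.functor.obj E ≅ X) : IsPerfect A X :=
  (e.isPerfect_obj E).of_iso i

lemma exists_distTriang {t : Triangle (DerivedCat A)} (ht : IsDistinguished t) {E₁ E₂ E₃ : T}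
    (i₁ : e.functor.obj E₁ ≅ t.obj₁) (i₂ : e.functor.obj E₂ ≅ t.obj₂)
    (i₃ : e.functor.obj E₃ ≅ t.obj₃) :
    ∃ (f : E₁ ⟶ E₂) (g : E₂ ⟶ E₃) (h : E₃ ⟶ (shiftFunctor T (1 : ℤ)).obj E₁),
      Triangle.mk f g h ∈ distTriang T ∧ e.functor.map f = i₁.hom ≫ t.mor₁ ≫ i₂.inv := by
  refine ⟨e.functor.preimage (i₁.hom ≫ t.mor₁ ≫ i₂.inv),
    e.functor.preimage (i₂.hom ≫ t.mor₂ ≫ i₃.inv),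
    e.functor.preimage (i₃.hom ≫ t.mor₃ ≫ (shiftFunctor (DerivedCat A) (1 : ℤ)).map i₁.inv ≫
      (e.functor.commShiftIso (1 : ℤ)).inv.app E₁), ?_, e.functor.map_preimage _⟩
  rw [e.distinguished_iff]
  refine ht.of_iso (Iso.symm ?_)
  refine Triangle.isoMk _ _ i₁ i₂ i₃ ?_ ?_ ?_
  · change e.functor.map (e.functor.preimage _) ≫ i₂.hom = i₁.hom ≫ t.mor₁
    simp
  · change e.functor.map (e.functor.preimage _) ≫ i₃.hom = i₂.hom ≫ t.mor₂
    simp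
  · change (e.functor.map (e.functor.preimage _) ≫ (e.functor.commShiftIso (1 : ℤ)).hom.app E₁) ≫
      (shiftFunctor (DerivedCat A) (1 : ℤ)).map i₁.hom = i₃.hom ≫ t.mor₃
    rw [e.functor.map_preimage]
    simp [← Functor.map_comp]

/-- The standard triangle of a morphism of perfect dg modules lifts to `T`. -/
lemma exists_cone {M N : DGModule A} (f : M ⟶ N) {E₁ E₂ : T}
    (i₁ : e.functor.obj E₁ ≅ (Q A).obj M) (i₂ : e.functor.obj E₂ ≅ (Q A).obj N) :
    ∃ (E₃ : T) (u : E₁ ⟶ E₂) (g : E₂ ⟶ E₃) (h : E₃ ⟶ (shiftFunctor T (1 : ℤ)).obj E₁),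
      Triangle.mk u g h ∈ distTriang T ∧ e.functor.map u = i₁.hom ≫ (Q A).map f ≫ i₂.inv ∧
        Nonempty (e.functor.obj E₃ ≅ (Q A).obj (cone f)) := by
  obtain ⟨E₃, ⟨i₃⟩⟩ := e.exists_iso (IsPerfect.cone (isDistinguished_coneTriangle f)
    (e.isPerfect_of_iso i₁) (e.isPerfect_of_iso i₂))
  obtain ⟨u, g, h, hd, hu⟩ := e.exists_distTriang (isDistinguished_coneTriangle f) i₁ i₂ i₃
  exact ⟨E₃, u, g, h, hd, hu, ⟨i₃⟩⟩

/-- The first map of a triangle determines its third object, so comparison with the triangle from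
`exists_cone` suffices. -/
lemma nonempty_iso_cone {M N : DGModule A} (f : M ⟶ N) {E₁ E₂ E₃ : T} {u : E₁ ⟶ E₂}
    {g : E₂ ⟶ E₃} {h : E₃ ⟶ (shiftFunctor T (1 : ℤ)).obj E₁}
    (hd : Triangle.mk u g h ∈ distTriang T) (i₁ : e.functor.obj E₁ ≅ (Q A).obj M)
    (i₂ : e.functor.obj E₂ ≅ (Q A).obj N)
    (hu : e.functor.map u = i₁.hom ≫ (Q A).map f ≫ i₂.inv) :
    Nonempty (e.functor.obj E₃ ≅ (Q A).obj (cone f)) := by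
  obtain ⟨E₃', u', g', h', hd', hu', ⟨i₃⟩⟩ := e.exists_cone f i₁ i₂
  obtain rfl : u = u' := e.functor.map_injective (hu.trans hu'.symm)
  exact ⟨e.functor.mapIso (Triangle.π₃.mapIso (isoTriangleOfIso₁₂ _ _ hd hd' (Iso.refl _)
    (Iso.refl _) ((comp_id u).trans (id_comp u).symm))) ≪≫ i₃⟩

/-- The equivalence commutes with shifts. -/
def shiftIso {E : T} {X : DGModule A} (i : e.functor.obj E ≅ (Q A).obj X) (n : ℤ) :
    e.functor.obj ((shiftFunctor T n).obj E) ≅ (Q A).obj (shiftObj n X) :=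
  (e.functor.commShiftIso n).app E ≪≫ (shiftFunctor (DerivedCat A) n).mapIso i ≪≫
    (((Q A).commShiftIso n).app X).symm

/-- The object of `T` that corresponds to the free module of rank one is a split-generator. -/
lemma isSplitGenerator [IsTriangulated T] {G : T}
    (i : e.functor.obj G ≅ (Q A).obj (free A)) : IsSplitGenerator G := by
  have key : ∀ X : DerivedCat A, IsPerfect A X → ∀ E : T, (e.functor.obj E ≅ X) →
      (ObjectProperty.singleton G).triangEnvelope E := by
    intro X hX
    induction hX with
    | free =>
      intro E j
      exact ((ObjectProperty.singleton G).triangEnvelope.prop_iff_of_iso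
        (e.functor.preimageIso (j ≪≫ i.symm))).2 (ObjectProperty.le_triangEnvelope _ _ (by simp))
    | shift n hX ih =>
      intro E j
      obtain ⟨E', ⟨i'⟩⟩ := e.exists_iso hX
      exact ((ObjectProperty.singleton G).triangEnvelope.prop_iff_of_iso (e.functor.preimageIso
        (j ≪≫ (shiftFunctor (DerivedCat A) n).mapIso i'.symm ≪≫
          ((e.functor.commShiftIso n).app E').symm))).2
        ((ObjectProperty.singleton G).triangEnvelope.le_shift n _ (ih E' i'))
    | cone ht h₁ h₂ ih₁ ih₂ =>
      intro E j
      obtain ⟨E₁, ⟨i₁⟩⟩ := e.exists_iso h₁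
      obtain ⟨E₂, ⟨i₂⟩⟩ := e.exists_iso h₂
      obtain ⟨f, g, h, hd, -⟩ := e.exists_distTriang ht i₁ i₂ j
      exact ObjectProperty.ext_of_isTriangulatedClosed₃ _ _ hd (ih₁ E₁ i₁) (ih₂ E₂ i₂)
    | retract r hY ih =>
      intro E j
      obtain ⟨E', ⟨i'⟩⟩ := e.exists_iso hY
      refine ObjectProperty.prop_of_retract _ ?_ (ih E' i')
      exact
        { i := e.functor.preimage (j.hom ≫ r.i ≫ i'.inv)
          r := e.functor.preimage (i'.hom ≫ r.r ≫ j.inv)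
          retract := e.functor.map_injective (by simp) }
  exact eq_top_iff.2 fun E _ => key _ (e.isPerfect_obj E) E (Iso.refl _)

/-! ### Betti numbers -/

/-- The dimension of the cohomology in degree `k` of the dg module corresponding to `E`. -/
def betti (k : ℤ) (E : T) : ℕ∞ :=
  Cardinal.toENat (Module.rank ℂ ((DerivedCat.cohomology A k).obj (e.functor.obj E)))

lemma betti_eq {E : T} {X : DGModule A} (i : e.functor.obj E ≅ (Q A).obj X) (k : ℤ) :
    e.betti k E = Cardinal.toENat (Module.rank ℂ (X.H k)) :=
  congrArg Cardinal.toENat (rank_cohomology_congr k i)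

lemma exists_module_iso (E : T) : ∃ X : DGModule A, Nonempty (e.functor.obj E ≅ (Q A).obj X) :=
  ⟨(Localization.Construction.objEquiv (quasiIso A)).symm (e.functor.obj E), ⟨Iso.refl _⟩⟩

lemma betti_shift (k n : ℤ) (E : T) :
    e.betti k ((shiftFunctor T n).obj E) = e.betti (k + n) E := by
  obtain ⟨X, ⟨i⟩⟩ := e.exists_module_iso E
  rw [e.betti_eq (e.shiftIso i n), e.betti_eq i, rank_H_shift]

lemma betti_le_of_retract (k : ℤ) {R E : T} (r : Retract R E) : e.betti k R ≤ e.betti k E := by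
  refine Cardinal.toENat.monotone' (LinearMap.rank_le_of_injective
    ((DerivedCat.cohomology A k).map (e.functor.map r.i)).hom ?_)
  refine Function.LeftInverse.injective
    (g := ((DerivedCat.cohomology A k).map (e.functor.map r.r)).hom) fun c => ?_
  have h : (DerivedCat.cohomology A k).map (e.functor.map r.i) ≫
      (DerivedCat.cohomology A k).map (e.functor.map r.r) = 𝟙 _ := by
    rw [← Functor.map_comp, ← Functor.map_comp, r.retract]
    simp
  exact congrArg (fun f => f.hom c) h

/-- `H^k(E)` is `H^0(E[k])`, whose elements are detected by maps `G ⟶ E[k]`. -/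
lemma betti_eq_zero {G : T} (i : e.functor.obj G ≅ (Q A).obj (free A)) {E : T} {k : ℤ}
    (h : ∀ f : G ⟶ (shiftFunctor T k).obj E, f = 0) : e.betti k E = 0 := by
  obtain ⟨X, ⟨j⟩⟩ := e.exists_module_iso ((shiftFunctor T k).obj E)
  have h0 := e.betti_shift 0 k E
  rw [zero_add] at h0
  rw [← h0, e.betti_eq j]
  let i' : e.functor.obj G ≅ (Q A).obj (shiftObj 0 (free A)) :=
    i ≪≫ (Q A).mapIso (shiftZeroIso.app (free A)).symm
  have : Subsingleton ((Q A).obj (shiftObj 0 (free A)) ⟶ (Q A).obj X) := ⟨fun a b => by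
    have hc : ∀ c : (Q A).obj (shiftObj 0 (free A)) ⟶ (Q A).obj X,
        c = i'.inv ≫ e.functor.map 0 ≫ j.hom := fun c => by
      have := h (e.functor.preimage (i'.hom ≫ c ≫ j.inv))
      rw [← this]
      simp
    rw [hc a, hc b]⟩
  have := subsingleton_H 0 X
  rw [neg_zero] at this
  rw [rank_subsingleton', map_zero]

lemma betti_eq_zero_of_isZero {G : T} (i : e.functor.obj G ≅ (Q A).obj (free A)) {E : T}
    (h : IsZero E) (k : ℤ) : e.betti k E = 0 :=
  e.betti_eq_zero i fun _ => ((shiftFunctor T k).map_isZero h).eq_of_tgt _ _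

/-- Exactness of `H^k(M) ⟶ H^k(N) ⟶ H^k(cone f)` at the middle term, followed by rank–nullity. -/
lemma rank_H_le {M N : DGModule A} (f : M ⟶ N) (k : ℤ) :
    Module.rank ℂ (N.H k) ≤ Module.rank ℂ (M.H k) + Module.rank ℂ ((cone f).H k) := by
  rw [← LinearMap.rank_range_add_rank_ker (Hom.mapH (coneIncl f) k), add_comm]
  refine add_le_add (le_trans (Submodule.rank_mono ?_) (rank_range_le (Hom.mapH f k)))
    (Submodule.rank_le _)
  intro c hc
  obtain ⟨n, hn, rfl⟩ := H.exists_rep c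
  rw [LinearMap.mem_ker, Hom.mapH_mk, H.mk_eq_zero_iff] at hc
  obtain ⟨⟨y, x⟩, hyx⟩ := hc
  replace hyx : ((N.d y + f.toFun x, -M.d x) : N.carrier × M.carrier) = (n, 0) := hyx
  obtain ⟨h₁, h₂⟩ := Prod.mk.inj hyx
  have hx : M.d x = 0 := neg_eq_zero.1 h₂
  have hxk : component M.isInternal k x ∈ M.cocycles k :=
    ⟨(d_component M k x).trans (by rw [hx, map_zero]), component_mem _ _ _⟩
  refine ⟨H.mk (component M.isInternal k x) hxk, ?_⟩
  rw [Hom.mapH_mk, H.mk_eq_iff, Hom.map_component]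
  refine ⟨-component N.isInternal (k - 1) y, ?_⟩
  have h3 := congrArg (component N.isInternal k) h₁
  rw [component_of_mem _ hn.2, map_add] at h3
  rw [map_neg, d_component, sub_add_cancel]
  exact neg_eq_iff_eq_neg.2 (by rw [neg_sub]; exact eq_sub_of_add_eq h3)

lemma betti_le_add (k : ℤ) {E E' B : T} {f : E ⟶ E'} {g : E' ⟶ B}
    {h : B ⟶ (shiftFunctor T (1 : ℤ)).obj E} (ht : Triangle.mk f g h ∈ distTriang T) :
    e.betti k E' ≤ e.betti k E + e.betti k B := by
  obtain ⟨M, N, φ, ⟨j⟩⟩ := (e.distinguished_iff _).1 ht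
  let j₁ : e.functor.obj E ≅ (Q A).obj M := Triangle.π₁.mapIso j
  let j₂ : e.functor.obj E' ≅ (Q A).obj N := Triangle.π₂.mapIso j
  let j₃ : e.functor.obj B ≅ (Q A).obj (cone φ) := Triangle.π₃.mapIso j
  rw [e.betti_eq j₁, e.betti_eq j₂, e.betti_eq j₃, ← map_add]
  exact Cardinal.toENat.monotone' (rank_H_le φ k)

/-- The generating function `∑ₖ dim Hᵏ(E) exp (-kt)`. -/
def poincare (t : ℝ) (E : T) : ℝ≥0∞ :=
  ∑' k : ℤ, (e.betti k E : ℝ≥0∞) * ENNReal.ofReal (Real.exp (-k * t))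

/-- This is why the weight is `e^{-kt}`: a shift by `n` then costs the factor `e^{nt}`, exactly as
in the definition of complexity. -/
lemma poincare_shift (t : ℝ) (n : ℤ) (E : T) : e.poincare t ((shiftFunctor T n).obj E) =
    e.poincare t E * ENNReal.ofReal (Real.exp (n * t)) := by
  rw [poincare, poincare, ← ENNReal.tsum_mul_right]
  refine Eq.trans (tsum_congr fun k => ?_) ((Equiv.addRight n).tsum_eq _)
  rw [e.betti_shift, mul_assoc, ← ENNReal.ofReal_mul (Real.exp_nonneg _), ← Real.exp_add]
  simp only [Equiv.coe_addRight]
  congr 3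
  push_cast
  ring_nf

lemma poincare_le_add (t : ℝ) {E E' B : T} {f : E ⟶ E'} {g : E' ⟶ B}
    {h : B ⟶ (shiftFunctor T (1 : ℤ)).obj E} (ht : Triangle.mk f g h ∈ distTriang T) :
    e.poincare t E' ≤ e.poincare t E + e.poincare t B := by
  rw [poincare, poincare, poincare, ← ENNReal.tsum_add]
  refine ENNReal.tsum_le_tsum fun k => ?_
  rw [← add_mul, ← ENat.toENNReal_add]
  gcongr
  exact e.betti_le_add k ht

lemma poincare_le_of_retract (t : ℝ) {R E : T} (r : Retract R E) :
    e.poincare t R ≤ e.poincare t E := by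
  refine ENNReal.tsum_le_tsum fun k => ?_
  gcongr
  exact e.betti_le_of_retract k r

lemma poincare_eq_zero_of_isZero {G : T} (i : e.functor.obj G ≅ (Q A).obj (free A)) (t : ℝ)
    {E : T} (h : IsZero E) : e.poincare t E = 0 := by
  simp [poincare, e.betti_eq_zero_of_isZero i h]

lemma poincare_le_of_isTower {G : T} (i : e.functor.obj G ≅ (Q A).obj (free A)) (t : ℝ)
    {l : List T} {E : T} (h : IsTower l E) : e.poincare t E ≤ (l.map (e.poincare t)).sum := by
  induction h with
  | zero h0 => simp [e.poincare_eq_zero_of_isZero i t h0]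
  | step f g h ht _ ih =>
    rw [List.map_append, List.sum_append]
    refine (e.poincare_le_add t ht).trans ?_
    simpa using add_le_add_left ih _

lemma poincare_le_of_built {G : T} (i : e.functor.obj G ≅ (Q A).obj (free A)) (t : ℝ)
    {L : List ℤ} {Y E : T} (h : Built L Y E) : e.poincare t E ≤
      e.poincare t Y * ENNReal.ofReal (L.map fun n : ℤ => Real.exp (n * t)).sum := by
  obtain ⟨M, hM⟩ := h
  refine (e.poincare_le_of_retract t (R := E) (E := E ⊞ M)
    ⟨biprod.inl, biprod.fst, by simp⟩).trans ((e.poincare_le_of_isTower i t hM).trans ?_)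
  clear hM
  rw [List.map_map]
  induction L with
  | nil => simp
  | cons n L ih =>
    rw [List.map_cons, List.sum_cons, List.map_cons, List.sum_cons,
      ENNReal.ofReal_add (Real.exp_nonneg _) (sum_exp_nonneg t L), mul_add]
    refine add_le_add ?_ ih
    rw [Function.comp_apply, e.poincare_shift]

/-- Half of the comparison: subadditivity along towers, with the infimum taken over all towers. -/
lemma poincare_le_mul_complexity {G : T} (i : e.functor.obj G ≅ (Q A).obj (free A)) (t : ℝ)
    {Y E : T} (hY : e.poincare t Y ≠ ⊤) (hE : complexity t Y E ≠ ⊤) :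
    e.poincare t E ≤ e.poincare t Y * complexity t Y E := by
  refine ENNReal.le_mul_of_forall_lt (.inr hE) (.inl hY) fun a ha b hb => ?_
  obtain ⟨L, hL, hL'⟩ := complexity_lt_iff.1 hb
  exact (e.poincare_le_of_built i t hL).trans (mul_le_mul' ha.le hL'.le)

end PerfEquivalence

/-! ### Finiteness of cohomology for proper dg algebras. -/

namespace DGModule

/-- The total cohomology of a dg module. -/
abbrev TotalH (M : DGModule A) : Type w :=
  LinearMap.ker M.d ⧸ (LinearMap.range M.d).submoduleOf (LinearMap.ker M.d)

/-- The map from the cohomology in degree `k` to the total cohomology. -/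
def toTotalH (M : DGModule A) (k : ℤ) : M.H k →ₗ[ℂ] M.TotalH :=
  Submodule.mapQ _ _ (Submodule.inclusion inf_le_left) fun _ h => h

lemma toTotalH_injective (M : DGModule A) (k : ℤ) : Function.Injective (M.toTotalH k) := by
  refine (injective_iff_map_eq_zero _).2 fun c hc => ?_
  obtain ⟨m, hm, rfl⟩ := H.exists_rep c
  have h : ((LinearMap.range M.d).submoduleOf (LinearMap.ker M.d)).mkQ ⟨m, hm.1⟩ = 0 := hc
  have h' := (Submodule.Quotient.mk_eq_zero _).1 h
  exact H.mk_eq_zero_iff.2 h'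

/-- Projecting a linear relation to one degree leaves a single term, and the projection of its
primitive shows that this term is a coboundary. -/
lemma linearIndependent_toTotalH (M : DGModule A) {ι : Type*} (k : ι → ℤ)
    (hk : Function.Injective k) (c : ∀ i, M.H (k i)) (hc : ∀ i, c i ≠ 0) :
    LinearIndependent ℂ fun i => M.toTotalH (k i) (c i) := by
  choose z hz hzc using fun i => H.exists_rep (c i)
  obtain rfl : (fun i => H.mk (z i) (hz i)) = c := funext hzc
  rw [linearIndependent_iff']
  intro s a h j hj
  have h1 : ((LinearMap.range M.d).submoduleOf (LinearMap.ker M.d)).mkQ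
      (∑ i ∈ s, a i • (⟨z i, (hz i).1⟩ : LinearMap.ker M.d)) = 0 := by
    rw [map_sum, ← h]
    rfl
  have h2 := (Submodule.Quotient.mk_eq_zero _).1 h1
  obtain ⟨y, hy⟩ := h2
  have h3 := congrArg (component M.isInternal (k j)) hy
  simp only [Submodule.subtype_apply, map_sum, map_smul] at h3
  rw [Finset.sum_eq_single j (fun i _ hij => by
      rw [component_of_mem_ne _ (hz i).2 fun h => hij (hk h), smul_zero]) (fun h => (h hj).elim),
    component_of_mem _ (hz j).2] at h3
  by_contra ha
  refine hc j (H.mk_eq_zero_iff.2 ⟨(a j)⁻¹ • component M.isInternal (k j - 1) y, ?_⟩)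
  rw [map_smul, d_component, sub_add_cancel, h3, smul_smul, inv_mul_cancel₀ ha, one_smul]

lemma finite_nontrivial_H (M : DGModule A) [Module.Finite ℂ M.TotalH] :
    {k : ℤ | Nontrivial (M.H k)}.Finite := by
  have hc : ∀ k : {k : ℤ | Nontrivial (M.H k)}, ∃ c : M.H k, c ≠ 0 := fun k =>
    have : Nontrivial (M.H k) := k.2
    exists_ne 0
  choose c hc using hc
  have : Finite {k : ℤ | Nontrivial (M.H k)} := (M.linearIndependent_toTotalH (fun k : {k : ℤ | _} => (k : ℤ))
    Subtype.val_injective c hc).finite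
  exact Set.toFinite _

end DGModule

lemma PerfEquivalence.poincare_free_ne_top (e : PerfEquivalence T A) (hA : A.IsProper) {G : T}
    (i : e.functor.obj G ≅ (Q A).obj (free A)) (t : ℝ) : e.poincare t G ≠ ⊤ := by
  have : Module.Finite ℂ (free A).TotalH := hA
  have hf := (free A).finite_nontrivial_H
  rw [poincare, tsum_eq_sum (s := hf.toFinset)]
  · refine ENNReal.sum_ne_top.2 fun k _ => ENNReal.mul_ne_top ?_ ENNReal.ofReal_ne_top
    have := Module.Finite.of_injective _ ((free A).toTotalH_injective k)
    rw [e.betti_eq i, ENat.toENNReal_ne_top, ← lt_top_iff_ne_top, Cardinal.toENat_lt_top]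
    exact Module.rank_lt_aleph0 ℂ _
  · intro k hk
    have : Subsingleton ((free A).H k) := by
      rw [← not_nontrivial_iff_subsingleton]
      simpa using hk
    rw [e.betti_eq i, rank_subsingleton', map_zero, ENat.toENNReal_zero, zero_mul]

end Perf

/-! ### Exact tensor products with iterated cell attachments. -/

section Tensor

variable {A : DGAlgebra.{w}}

open DerivedCat DGModule

/-- The right dg module underlying a dg bimodule. -/
def DGBimodule.toModule (P : DGBimodule A) : DGModule A where
  carrier := P.carrier
  act := P.ract
  act_one := P.ract_one
  act_mul := P.ract_mul
  gr := P.gr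
  isInternal := P.isInternal
  act_mem := P.ract_mem
  d := P.d
  d_mem := P.d_mem
  d_d := P.d_d
  leibniz := P.leibniz_ract

/-- The morphism of shifted right dg modules underlying a morphism of dg bimodules. -/
def DGBimodule.Hom.shiftToModule {P P' : DGBimodule A} (f : DGBimodule.Hom P P') (m : ℤ) :
    shiftObj m P.toModule ⟶ shiftObj m P'.toModule where
  toFun := f.toFun
  map_act := f.map_ract
  map_mem h := f.map_mem h
  map_d (p : P.carrier) :=
    (map_zsmul f.toFun ((m.negOnePow : ℤˣ) : ℤ) (P.d p)).trans
      (congrArg (fun y : P'.carrier => m.negOnePow • y) (f.map_d p))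

lemma DGBimodule.QuasiIso.shiftToModule {P P' : DGBimodule A} {f : DGBimodule.Hom P P'}
    (hf : DGBimodule.QuasiIso f) (m : ℤ) : quasiIso A (f.shiftToModule m) := by
  change InducesCohomologyIso (m.negOnePow • P.d) (m.negOnePow • P'.d) f.toFun
  rcases Int.even_or_odd m with h | h
  · rw [Int.negOnePow_even m h, one_smul, one_smul]
    exact hf
  · rw [Int.negOnePow_odd m h, Units.neg_smul, Units.neg_smul, one_smul, one_smul,
      inducesCohomologyIso_neg]
    exact hf

variable (A) in
/-- The unit of `A` as an element of the diagonal bimodule. -/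
def DGBimodule.diagonalOne : (DGBimodule.diagonal A).carrier := (1 : A.carrier)

/-- A model for the functor `P ↦ X ⊗_A P` from dg bimodules to dg modules with a pairing
`X × P → X ⊗_A P`, for a dg module `X` such that this functor is exact. -/
structure TensorFunctor (X : DGModule A) where
  obj : DGBimodule A → DGModule A
  map : ∀ {P P' : DGBimodule A}, DGBimodule.Hom P P' → (obj P ⟶ obj P')
  pair : ∀ P : DGBimodule A, X.carrier →ₗ[ℂ] P.carrier →ₗ[ℂ] (obj P).carrier
  pair_ract : ∀ {P : DGBimodule A} (x : X.carrier) (p : P.carrier) (a : A.carrier),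
    pair P x (P.ract p a) = (obj P).act (pair P x p) a
  act_pair : ∀ {P : DGBimodule A} (x : X.carrier) (p : P.carrier) (a : A.carrier),
    pair P (X.act x a) p = pair P x (P.lact a p)
  pair_mem : ∀ {P : DGBimodule A} {i j : ℤ} {x : X.carrier} {p : P.carrier}, x ∈ X.gr i →
    p ∈ P.gr j → pair P x p ∈ (obj P).gr (i + j)
  d_pair : ∀ {P : DGBimodule A} {i : ℤ} {x : X.carrier}, x ∈ X.gr i → ∀ p : P.carrier,
    (obj P).d (pair P x p) = pair P (X.d x) p + i.negOnePow • pair P x (P.d p)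
  map_pair : ∀ {P P' : DGBimodule A} (f : DGBimodule.Hom P P') (x : X.carrier) (p : P.carrier),
    (map f).toFun (pair P x p) = pair P' x (f.toFun p)
  isShortExact : ∀ {P P' P'' : DGBimodule A} {f : DGBimodule.Hom P P'}
    {g : DGBimodule.Hom P' P''}, DGBimodule.ShortExact f g → IsShortExact (map f) (map g)
  quasiIso : ∀ {P P' : DGBimodule A} {f : DGBimodule.Hom P P'}, DGBimodule.QuasiIso f →
    quasiIso A (map f)
  retract : ∀ {P P' : DGBimodule A} {i : DGBimodule.Hom P P'} {r : DGBimodule.Hom P' P},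
    r.toFun ∘ₗ i.toFun = LinearMap.id → ∀ y, (map r).toFun ((map i).toFun y) = y
  bijective_unit : Function.Bijective fun x =>
    pair (DGBimodule.diagonal A) x (DGBimodule.diagonalOne A)
  bijective_free : ∀ {P : DGBimodule A} {u : P.carrier},
    Function.Bijective (TensorProduct.lift (P.ract ∘ₗ P.lact.flip u) :
      A.carrier ⊗[ℂ] A.carrier →ₗ[ℂ] P.carrier) →
    Function.Bijective (TensorProduct.lift ((pair P).compl₂ (P.ract u)))

variable (A) in
/-- The zero dg module. -/
def DGModule.zero : DGModule A where
  carrier := PUnit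
  act := 0
  act_one _ := rfl
  act_mul _ _ _ := rfl
  gr _ := ⊤
  isInternal := by
    rw [DirectSum.isInternal_submodule_iff_iSupIndep_and_iSup_eq_top]
    exact ⟨fun _ => Submodule.disjoint_def.2 fun _ _ _ => rfl, Subsingleton.elim _ _⟩
  act_mem _ _ := trivial
  d := 0
  d_mem _ := trivial
  d_d _ := rfl
  leibniz _ _ := rfl

instance : Subsingleton (DGModule.zero A).carrier := inferInstanceAs (Subsingleton PUnit)

namespace TensorFunctor

variable (A) in
/-- The zero functor. -/
def zero : TensorFunctor (DGModule.zero A) where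
  obj _ := DGModule.zero A
  map _ := 𝟙 _
  pair _ := 0
  pair_ract _ _ _ := rfl
  act_pair _ _ _ := rfl
  pair_mem _ _ := trivial
  d_pair _ _ := rfl
  map_pair _ _ _ := rfl
  isShortExact _ := ⟨fun _ _ _ => rfl, fun _ => ⟨fun _ => ⟨PUnit.unit, rfl⟩, fun _ => rfl⟩,
    fun _ => ⟨PUnit.unit, rfl⟩⟩
  quasiIso _ := quasiIso_of_bijective ⟨fun _ _ _ => rfl, fun _ => ⟨PUnit.unit, rfl⟩⟩
  retract _ _ := rfl
  bijective_unit := ⟨fun _ _ _ => rfl, fun _ => ⟨PUnit.unit, rfl⟩⟩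
  bijective_free _ := by
    refine ⟨fun x y _ => ?_, fun _ => ⟨0, rfl⟩⟩
    have h : ∀ x : (DGModule.zero A).carrier ⊗[ℂ] A.carrier, x = 0 := fun x => by
      induction x with
      | zero => rfl
      | tmul m a => rw [Subsingleton.elim m 0, TensorProduct.zero_tmul]
      | add x y hx hy => rw [hx, hy, add_zero]
    rw [h x, h y]

variable {X : DGModule A} (τ : TensorFunctor X)

/-- Left multiplication with a cocycle of `X`. -/
def mulLeft (m : ℤ) (z : X.carrier) (hz : z ∈ X.cocycles (-m)) (P : DGBimodule A) :
    shiftObj m P.toModule ⟶ τ.obj P where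
  toFun := τ.pair P z
  map_act p a := τ.pair_ract z p a
  map_mem {i} (p : P.carrier) (hp : p ∈ P.gr (i + m)) := by
    have h := τ.pair_mem hz.2 hp
    rwa [show -m + (i + m) = i by ring] at h
  map_d (p : P.carrier) := by
    have h1 := τ.d_pair hz.2 p
    have h2 : X.d z = 0 := hz.1
    rw [h2, map_zero, LinearMap.zero_apply, zero_add, Int.negOnePow_neg] at h1
    exact (map_zsmul (τ.pair P z) ((m.negOnePow : ℤˣ) : ℤ) (P.d p)).trans h1.symm

/-- The pairing of a dg module with an attached cell. -/
def attachPair (P : DGBimodule A) :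
    (X.carrier × A.carrier) →ₗ[ℂ] P.carrier →ₗ[ℂ] (τ.obj P).carrier × P.carrier :=
  LinearMap.mk₂ ℂ (fun x p => (τ.pair P x.1 p, P.lact x.2 p))
    (fun _ _ _ => by simp) (fun _ _ _ => by simp) (fun _ _ _ => by simp) (fun _ _ _ => by simp)

/-- Tensor products distribute over the direct sum of `X` and the new cell `A`. -/
lemma bijective_lift_attachPair {P : DGBimodule A} {u : P.carrier}
    (hu : Function.Bijective (TensorProduct.lift (P.ract ∘ₗ P.lact.flip u) :
      A.carrier ⊗[ℂ] A.carrier →ₗ[ℂ] P.carrier)) :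
    Function.Bijective (TensorProduct.lift ((τ.attachPair P).compl₂ (P.ract u))) := by
  have h := ((τ.bijective_free hu).prodMap hu).comp
    (TensorProduct.prodLeft ℂ ℂ X.carrier A.carrier A.carrier).bijective
  convert h using 1
  funext y
  induction y with
  | zero => refine Prod.ext ?_ ?_ <;> simp
  | add y y' hy hy' =>
    rw [map_add, hy, hy']
    refine Prod.ext ?_ ?_ <;> simp
  | tmul x a => exact Prod.ext rfl (P.lact_ract x.2 u a).symm

/-- Attaching a cell to a dg module. -/
def attach (m : ℤ) (z : X.carrier) (hz : z ∈ X.cocycles (-m)) :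
    TensorFunctor (cone (ofCocycle m X z hz)) where
  obj P := cone (τ.mulLeft m z hz P)
  map {P P'} f := coneMap _ _ (f.shiftToModule m) (τ.map f) fun p => τ.map_pair f z p
  pair P := τ.attachPair P
  pair_ract {P} x p a := Prod.ext (τ.pair_ract x.1 p a) (P.lact_ract x.2 p a).symm
  act_pair {P} x p a := Prod.ext (τ.act_pair x.1 p a) (P.mul_lact x.2 a p)
  pair_mem {P i j x p} hx hp := by
    refine ⟨τ.pair_mem hx.1 hp, ?_⟩
    have h := P.lact_mem (show (show A.carrier from x.2) ∈ A.gr (i + 1 + m) from hx.2) hp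
    rw [show i + 1 + m + j = i + j + 1 + m by ring] at h
    exact h
  d_pair {P i} := by
    rintro ⟨x, (a : A.carrier)⟩ hx p
    have h₁ := τ.d_pair hx.1 p
    have h₂ := P.leibniz_lact (show a ∈ A.gr (i + 1 + m) from hx.2) p
    refine Prod.ext ?_ ?_
    · change (τ.obj P).d (τ.pair P x p) + τ.pair P z (P.lact a p) =
        τ.pair P (X.d x + X.act z a) p + i.negOnePow • τ.pair P x (P.d p)
      rw [h₁, map_add, LinearMap.add_apply, τ.act_pair]
      abel
    · change -(m.negOnePow • P.d (P.lact a p)) =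
        P.lact (-(m.negOnePow • A.d a)) p + i.negOnePow • P.lact a (P.d p)
      have h₃ : P.lact (m.negOnePow • A.d a) = m.negOnePow • P.lact (A.d a) :=
        map_zsmul P.lact ((m.negOnePow : ℤˣ) : ℤ) (A.d a)
      -- Here `a` has degree `i + 1 + m` in `A`. Its Leibniz sign, the shift sign `(-1)^m` and the
      -- minus sign of the cone combine to `(-1)^i`.
      rw [h₂, smul_add, smul_smul, ← Int.negOnePow_add, map_neg, h₃, LinearMap.neg_apply, neg_add,
        show m + (i + 1 + m) = i + 1 + (m + m) by ring, Int.negOnePow_add,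
        Int.negOnePow_even (m + m) ⟨m, rfl⟩, mul_one, Int.negOnePow_succ, Units.neg_smul, neg_neg]
      rfl
  map_pair {P P'} f x p := Prod.ext (τ.map_pair f x.1 p) (f.map_lact x.2 p)
  isShortExact {P P' P'' f g} h := by
    have h' := τ.isShortExact h
    refine ⟨?_, ?_, ?_⟩
    · rintro ⟨x, p⟩ ⟨x', p'⟩ hx
      exact Prod.ext (h'.injective (congrArg Prod.fst hx)) (h.1 (congrArg Prod.snd hx))
    · rintro ⟨x, p⟩
      constructor
      · intro hx
        obtain ⟨x', hx'⟩ := (h'.exact x).1 (congrArg Prod.fst hx)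
        obtain ⟨p', hp'⟩ := (h.2.1 p).1 (congrArg Prod.snd hx)
        exact ⟨(x', p'), Prod.ext hx' hp'⟩
      · rintro ⟨⟨x', p'⟩, hx⟩
        exact Prod.ext ((h'.exact x).2 ⟨x', congrArg Prod.fst hx⟩)
          ((h.2.1 p).2 ⟨p', congrArg Prod.snd hx⟩)
    · rintro ⟨x, p⟩
      obtain ⟨x', hx'⟩ := h'.surjective x
      obtain ⟨p', hp'⟩ := h.2.2 p
      exact ⟨(x', p'), Prod.ext hx' hp'⟩
  quasiIso h := quasiIso_coneMap _ (h.shiftToModule m) (τ.quasiIso h)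
  retract h := by
    rintro ⟨x, p⟩
    exact Prod.ext (τ.retract h x) (LinearMap.congr_fun h p)
  bijective_unit := by
    have h : (fun x : X.carrier × A.carrier =>
        ((τ.pair (DGBimodule.diagonal A) x.1 (DGBimodule.diagonalOne A), x.2 * 1) :
          (τ.obj (DGBimodule.diagonal A)).carrier × A.carrier)) =
        Prod.map (fun x => τ.pair (DGBimodule.diagonal A) x (DGBimodule.diagonalOne A)) id := by
      funext x
      exact Prod.ext rfl (mul_one _)
    have h' := τ.bijective_unit.prodMap (Function.bijective_id (α := A.carrier))
    rw [← h] at h'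
    exact h'
  bijective_free hu := τ.bijective_lift_attachPair hu

/-- The unit isomorphism `X = X ⊗_A A`. -/
def unit : X ⟶ τ.obj (DGBimodule.diagonal A) where
  toFun := (τ.pair (DGBimodule.diagonal A)).flip (DGBimodule.diagonalOne A)
  map_act x a := by
    change τ.pair (DGBimodule.diagonal A) (X.act x a) (DGBimodule.diagonalOne A) =
      (τ.obj _).act (τ.pair (DGBimodule.diagonal A) x (DGBimodule.diagonalOne A)) a
    rw [τ.act_pair, ← τ.pair_ract]
    congr 1
    exact (mul_one a).trans (one_mul a).symm
  map_mem {i x} hx := by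
    have h := τ.pair_mem (P := DGBimodule.diagonal A) hx A.one_mem
    rw [add_zero] at h
    exact h
  map_d x := by
    refine LinearMap.congr_fun (f := (τ.pair (DGBimodule.diagonal A)).flip
      (DGBimodule.diagonalOne A) ∘ₗ X.d) (g := (τ.obj (DGBimodule.diagonal A)).d ∘ₗ
      (τ.pair (DGBimodule.diagonal A)).flip (DGBimodule.diagonalOne A))
      (linearMap_ext_of_isInternal X.isInternal fun i x hx => ?_) x
    refine Eq.trans ?_ (τ.d_pair (P := DGBimodule.diagonal A) hx (DGBimodule.diagonalOne A)).symm
    have h : (DGBimodule.diagonal A).d (DGBimodule.diagonalOne A) = 0 := d_one A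
    rw [h, map_zero, smul_zero, add_zero]
    rfl

lemma quasiIso_unit : DGModule.quasiIso A τ.unit := quasiIso_of_bijective τ.bijective_unit

end TensorFunctor

/-- The identification `X[n][-n] = X` in the derived category. -/
def DerivedCat.shiftNegIso (n : ℤ) (X : DGModule A) :
    (Q A).obj (shiftObj (-n) (shiftObj n X)) ≅ (Q A).obj X :=
  (Q A).mapIso ((shiftFunctorCompIsoId (DGModule A) n (-n) (add_neg_cancel n)).app X)

end Tensor

/-! ### Building `X ⊗_A P` from `X ⊗_A (A ⊗ A)`. -/

section TensorPerf

variable {T : Type u} [Category.{v} T] [Preadditive T] [Linear ℂ T] [HasZeroObject T]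
  [HasShift T ℤ] [∀ n : ℤ, (shiftFunctor T n).Additive] [Pretriangulated T]
  {A : DGAlgebra.{w}} (e : PerfEquivalence T A)

open DerivedCat DGModule ZeroObject

namespace PerfEquivalence

/-- The triangle `G ⟶ G ⟶ 0` identifies the image of a zero object with the cone of the identity of
`A`, which is acyclic and hence quasi-isomorphic to any zero module. -/
lemma nonempty_iso_of_isZero {G : T} (i : e.functor.obj G ≅ (Q A).obj (free A)) {E : T}
    (h0 : IsZero E) (X : DGModule A) [Subsingleton X.carrier] :
    Nonempty (e.functor.obj E ≅ (Q A).obj X) := by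
  obtain ⟨j⟩ := e.nonempty_iso_cone (𝟙 (free A)) (contractible_distinguished G) i i (by simp)
  let f : cone (𝟙 (free A)) ⟶ X := ⟨0, fun _ _ => Subsingleton.elim _ _,
    fun _ => Submodule.zero_mem _, fun _ => Subsingleton.elim _ _⟩
  have hf : quasiIso A f := by
    refine ⟨?_, fun y _ => ⟨0, 0, map_zero _, Subsingleton.elim _ _⟩⟩
    rintro ⟨(n : A.carrier), (m : A.carrier)⟩ h -
    replace h : ((A.d n + m, -A.d m) : A.carrier × A.carrier) = 0 := h
    have h₁ : A.d n + m = 0 := congrArg Prod.fst h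
    refine ⟨(0, n), ?_⟩
    change ((n, m) : A.carrier × A.carrier) = (A.d 0 + n, -A.d n)
    rw [map_zero, zero_add, eq_neg_of_add_eq_zero_right h₁]
  exact ⟨e.functor.mapIso (h0.iso (isZero_zero T)) ≪≫ j ≪≫ isoOfQuasiIso f hf⟩

/-- The total object of a tower of shifts of the free module corresponds to a dg module with an
exact tensor product. -/
lemma exists_tensorFunctor {G : T} (i : e.functor.obj G ≅ (Q A).obj (free A)) {L : List ℤ} {E : T}
    (h : IsTower (L.map fun n => (shiftFunctor T n).obj G) E) :
    ∃ X : DGModule A, Nonempty (TensorFunctor X) ∧ Nonempty (e.functor.obj E ≅ (Q A).obj X) := by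
  generalize hl : (L.map fun n => (shiftFunctor T n).obj G) = l at h
  induction h generalizing L with
  | zero h0 =>
    exact ⟨DGModule.zero A, ⟨TensorFunctor.zero A⟩, e.nonempty_iso_of_isZero i h0 _⟩
  | @step l E E' B f g k ht _ ih =>
    obtain ⟨l₁, l₂, rfl, h₁, h₂⟩ := List.map_eq_append_iff.1 hl
    obtain ⟨n, l₃, rfl, rfl, h₃⟩ := List.map_eq_cons_iff.1 h₂
    obtain ⟨X, ⟨τ⟩, ⟨j⟩⟩ := ih h₁
    -- Rotating back presents `E'` as the cone of an attaching map `G[n-1] ⟶ E`. Such a map comes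
    -- from a cocycle, so `E'` is obtained by attaching a cell.
    obtain ⟨a, b, c, hd⟩ := exists_distTriang_of_iso (inv_rot_of_distTriang _ ht)
      ((shiftFunctorAdd' T n (-1) (n - 1) (by ring)).app G).symm (Iso.refl E) (Iso.refl E')
    let j' := e.shiftIso i (n - 1)
    obtain ⟨z, hz, hza⟩ := exists_eq_map_ofCocycle (n - 1) X (j'.inv ≫ e.functor.map a ≫ j.hom)
    exact ⟨_, ⟨τ.attach (n - 1) z hz⟩, e.nonempty_iso_cone _ hd j' j (by rw [← hza]; simp)⟩

/-- For a perfect bimodule `P`, the tensor products `X ⊗_A P` are built in a uniform way from the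
tensor products of `X` with the free bimodule of rank one. -/
lemma exists_built_of_isPerfect [IsTriangulated T] {P : DGBimodule A} (hP : P.IsPerfect) :
    ∃ L : List ℤ, ∀ {X : DGModule A} (τ : TensorFunctor X) (Y : T),
      (∀ F : DGBimodule A, F.IsFreeOfRankOne →
        Nonempty (e.functor.obj Y ≅ (Q A).obj (τ.obj F))) →
      ∃ E : T, Nonempty (e.functor.obj E ≅ (Q A).obj (τ.obj P)) ∧ Built L Y E := by
  induction hP with
  | free hF => exact ⟨[0], fun τ Y hY => ⟨Y, hY _ hF, Built.refl Y⟩⟩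
  | of_quasiIso_left f hf _ ih =>
    obtain ⟨L, hL⟩ := ih
    refine ⟨L, fun τ Y hY => ?_⟩
    obtain ⟨E, ⟨j⟩, hE⟩ := hL τ Y hY
    exact ⟨E, ⟨j ≪≫ isoOfQuasiIso _ (τ.quasiIso hf)⟩, hE⟩
  | of_quasiIso_right f hf _ ih =>
    obtain ⟨L, hL⟩ := ih
    refine ⟨L, fun τ Y hY => ?_⟩
    obtain ⟨E, ⟨j⟩, hE⟩ := hL τ Y hY
    exact ⟨E, ⟨j ≪≫ (isoOfQuasiIso _ (τ.quasiIso hf)).symm⟩, hE⟩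
  | ext₁ f g hfg _ _ ih₂ ih₃ =>
    obtain ⟨L₂, hL₂⟩ := ih₂
    obtain ⟨L₃, hL₃⟩ := ih₃
    refine ⟨(L₃ ++ L₂.map (· + 1)).map (· + -1), fun τ Y hY => ?_⟩
    obtain ⟨E₂, ⟨j₂⟩, hE₂⟩ := hL₂ τ Y hY
    obtain ⟨E₃, ⟨j₃⟩, hE₃⟩ := hL₃ τ Y hY
    obtain ⟨E, _, _, _, hd, -, ⟨j⟩⟩ := e.exists_cone (τ.map g) j₂ j₃
    -- The cone of the second map is the first term shifted by one; the final shift by `-1` undoes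
    -- this.
    have hs := quasiIso_coneLift (τ.isShortExact hfg)
    exact ⟨_, ⟨e.shiftIso (j ≪≫ (isoOfQuasiIso _ hs).symm) (-1) ≪≫ shiftNegIso 1 _⟩,
      (Built.extension (rot_of_distTriang _ hd) hE₃ (hE₂.shift 1)).shift (-1)⟩
  | ext₂ f g hfg _ _ ih₁ ih₃ =>
    obtain ⟨L₁, hL₁⟩ := ih₁
    obtain ⟨L₃, hL₃⟩ := ih₃
    refine ⟨(L₁.map (· + 1) ++ L₃.map (· + 1)).map (· + -1), fun τ Y hY => ?_⟩
    obtain ⟨E₁, ⟨j₁⟩, hE₁⟩ := hL₁ τ Y hY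
    obtain ⟨E₃, ⟨j₃⟩, hE₃⟩ := hL₃ τ Y hY
    have hs := quasiIso_coneDesc (τ.isShortExact hfg)
    have hs' := quasiIso_coneLift (isShortExact_cone (τ.map f))
    -- The middle term is recovered from the connecting map: the cone of `cone f ⟶ X[1]` is the
    -- middle term shifted by one, and `cone f` is the third term.
    obtain ⟨E, _, _, _, hd, -, ⟨j⟩⟩ := e.exists_cone (N := shiftObj 1 (τ.obj _))
      (coneProj (τ.map f)) (j₃ ≪≫ (isoOfQuasiIso _ hs).symm) (e.shiftIso j₁ 1)
    exact ⟨_, ⟨e.shiftIso (j ≪≫ (isoOfQuasiIso _ hs').symm) (-1) ≪≫ shiftNegIso 1 _⟩,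
      (Built.extension (rot_of_distTriang _ hd) (hE₁.shift 1) (hE₃.shift 1)).shift (-1)⟩
  | ext₃ f g hfg _ _ ih₁ ih₂ =>
    obtain ⟨L₁, hL₁⟩ := ih₁
    obtain ⟨L₂, hL₂⟩ := ih₂
    refine ⟨L₂ ++ L₁.map (· + 1), fun τ Y hY => ?_⟩
    obtain ⟨E₁, ⟨j₁⟩, hE₁⟩ := hL₁ τ Y hY
    obtain ⟨E₂, ⟨j₂⟩, hE₂⟩ := hL₂ τ Y hY
    have hs := quasiIso_coneDesc (τ.isShortExact hfg)
    obtain ⟨E, _, _, _, hd, -, ⟨j⟩⟩ := e.exists_cone (τ.map f) j₁ j₂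
    exact ⟨E, ⟨j ≪≫ isoOfQuasiIso _ hs⟩,
      Built.extension (rot_of_distTriang _ hd) hE₂ (hE₁.shift 1)⟩
  | summand i r hir _ ih =>
    obtain ⟨L, hL⟩ := ih
    refine ⟨L, fun τ Y hY => ?_⟩
    obtain ⟨E, ⟨j⟩, hE⟩ := hL τ Y hY
    have hret : τ.map i ≫ τ.map r = 𝟙 _ := by
      ext y
      exact τ.retract hir y
    have hret' : (Q A).map (τ.map i) ≫ (Q A).map (τ.map r) = 𝟙 _ := by
      rw [← Functor.map_comp, hret, CategoryTheory.Functor.map_id]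
    obtain ⟨E', ⟨j'⟩⟩ := e.exists_iso (IsPerfect.retract ⟨_, _, hret'⟩ (e.isPerfect_of_iso j))
    refine ⟨E', ⟨j'⟩, hE.of_retract
      { i := e.functor.preimage (j'.hom ≫ (Q A).map (τ.map i) ≫ j.inv)
        r := e.functor.preimage (j.hom ≫ (Q A).map (τ.map r) ≫ j'.inv)
        retract := e.functor.map_injective ?_ }⟩
    simp only [Functor.map_comp, Functor.map_preimage, assoc, Iso.inv_hom_id_assoc,
      CategoryTheory.Functor.map_id]
    rw [reassoc_of% hret', Iso.hom_inv_id]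

end PerfEquivalence

end TensorPerf

/-! ### Contracting a complex of vector spaces onto its cohomology. -/

section Contraction

/-- The paritySign `(-1)ⁿ` as a complex number. -/
def paritySign (n : ℤ) : ℂ := ((n.negOnePow : ℤˣ) : ℤ)

lemma paritySign_smul {V : Type*} [AddCommGroup V] [Module ℂ V] (n : ℤ) (x : V) :
    paritySign n • x = n.negOnePow • x := by
  rw [paritySign, Int.cast_smul_eq_zsmul, Units.smul_def]

lemma paritySign_mul_self (n : ℤ) : paritySign n * paritySign n = 1 := by
  rw [paritySign, ← Int.cast_mul, ← Units.val_mul, Int.units_mul_self, Units.val_one, Int.cast_one]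

lemma paritySign_add (m n : ℤ) : paritySign (m + n) = paritySign m * paritySign n := by
  simp [paritySign, Int.negOnePow_add]

lemma paritySign_succ (n : ℤ) : paritySign (n + 1) = -paritySign n := by
  simp [paritySign, Int.negOnePow_succ]

variable {V : Type*} [AddCommGroup V] [Module ℂ V]

/-- A complex of vector spaces is homotopy equivalent to its cohomology. -/
lemma exists_contraction {J : Type*} [Fintype J] [DecidableEq J] (d : V →ₗ[ℂ] V) (hd : ∀ x, d (d x) = 0)
    (x : J → V) (hx : ∀ j, d (x j) = 0)
    (hspan : ∀ z, d z = 0 → ∃ (c : J → ℂ) (y : V), z = ∑ j, c j • x j + d y)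
    (hind : ∀ (c : J → ℂ) (y : V), ∑ j, c j • x j = d y → c = 0) :
    ∃ (ξ : V →ₗ[ℂ] (J → ℂ)) (h : V →ₗ[ℂ] V), (∀ v, ξ (d v) = 0) ∧
      (∀ i, ξ (x i) = Pi.single i 1) ∧ ∀ v, d (h v) + h (d v) = v - ∑ j, ξ v j • x j := by
  let φ : ((J → ℂ) × V) →ₗ[ℂ] V := (Fintype.linearCombination ℂ x).coprod d
  have hφ : ∀ c y, φ (c, y) = ∑ j, c j • x j + d y := fun c y => by
    simp [φ, Fintype.linearCombination_apply]
  have hmem : ∀ p, φ p ∈ LinearMap.ker d := fun p => by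
    rw [LinearMap.mem_ker, ← Prod.mk.eta (p := p), hφ]
    simp [hd, hx]
  -- Over a field, the decomposition of a cocycle into representatives plus a coboundary can be
  -- chosen linearly and extended to all of `V`.
  obtain ⟨s, hs⟩ := (φ.codRestrict _ hmem).exists_rightInverse_of_surjective (by
    rw [LinearMap.range_eq_top]
    rintro ⟨z, hz⟩
    obtain ⟨c, y, h⟩ := hspan z hz
    exact ⟨(c, y), Subtype.ext ((hφ c y).trans h.symm)⟩)
  obtain ⟨s', hs'⟩ := LinearMap.exists_extend s
  have key : ∀ z, d z = 0 → ∑ j, (s' z).1 j • x j + d (s' z).2 = z := fun z hz => by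
    have h1 : s' z = s ⟨z, hz⟩ := LinearMap.congr_fun hs' ⟨z, hz⟩
    rw [h1, ← hφ]
    exact congrArg Subtype.val (LinearMap.congr_fun hs ⟨z, hz⟩)
  have hzero : ∀ v, (s' (d v)).1 = 0 := fun v => hind _ (v - (s' (d v)).2) (by
    rw [map_sub]
    exact eq_sub_of_add_eq (key _ (hd v)))
  have hdd : ∀ v, d (s' (d v)).2 = d v := fun v => by
    have := key _ (hd v)
    rw [hzero] at this
    simpa using this
  -- Subtracting the chosen primitive of `d v` from `v` projects `V` onto the cocycles; both `ξ` and
  -- `h` are read off from the decomposition of `q v`.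
  let q : V →ₗ[ℂ] V := LinearMap.id - LinearMap.snd ℂ _ _ ∘ₗ s' ∘ₗ d
  have hq : ∀ v, q v = v - (s' (d v)).2 := fun v => rfl
  refine ⟨LinearMap.fst ℂ _ _ ∘ₗ s' ∘ₗ q, LinearMap.snd ℂ _ _ ∘ₗ s' ∘ₗ q, fun v => ?_, fun i => ?_,
    fun v => ?_⟩
  · simp [hq, hd, hzero]
  · have h1 : q (x i) = x i := by simp [hq, hx]
    have h2 := key _ (hx i)
    change (s' (q (x i))).1 = _
    rw [h1]
    refine sub_eq_zero.1 (hind _ (-(s' (x i)).2) ?_)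
    simp only [Pi.sub_apply, sub_smul, Finset.sum_sub_distrib, Pi.single_apply, ite_smul, one_smul,
      zero_smul, Finset.sum_ite_eq', Finset.mem_univ, if_true, map_neg]
    rw [sub_eq_iff_eq_add, neg_add_eq_sub]
    exact eq_sub_of_add_eq h2
  · have h1 := key (q v) (by rw [hq, map_sub, hdd, sub_self])
    change d (s' (q v)).2 + (s' (q (d v))).2 = v - ∑ j, (s' (q v)).1 j • x j
    have h2 : q (d v) = d v := by simp [hq, hd]
    rw [h2, eq_sub_of_add_eq' h1, hq]
    abel

/-- The contraction of a complex of vector spaces onto its cohomology can be chosen compatible with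
the parity. -/
lemma exists_graded_contraction {J : Type*} [Fintype J] [DecidableEq J] (d : V →ₗ[ℂ] V)
    (hd : ∀ x, d (d x) = 0) (ε : V →ₗ[ℂ] V) (hε : ∀ x, ε (ε x) = x) (hdε : ∀ x, d (ε x) = -ε (d x))
    (x : J → V) (k : J → ℤ) (hx : ∀ j, d (x j) = 0) (hxε : ∀ j, ε (x j) = paritySign (k j) • x j)
    (hspan : ∀ z, d z = 0 → ∃ (c : J → ℂ) (y : V), z = ∑ j, c j • x j + d y)
    (hind : ∀ (c : J → ℂ) (y : V), ∑ j, c j • x j = d y → c = 0) :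
    ∃ (ξ : J → V →ₗ[ℂ] ℂ) (h : V →ₗ[ℂ] V), (∀ j v, ξ j (d v) = 0) ∧
      (∀ j v, ξ j (ε v) = paritySign (k j) * ξ j v) ∧ (∀ i j, ξ j (x i) = if i = j then 1 else 0) ∧
      (∀ v, ε (h v) = -h (ε v)) ∧ ∀ v, d (h v) + h (d v) = v - ∑ j, ξ j v • x j := by
  obtain ⟨ξ, h, h₁, h₂, h₃⟩ := exists_contraction d hd x hx hspan hind
  -- Averaging over the involution `ε`: each `ξ j` is projected to its eigenspace of sign `(-1)^{k
  -- j}`, and `h` to the operators anticommuting with `ε`.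
  refine ⟨fun j => (2⁻¹ : ℂ) • (LinearMap.proj j ∘ₗ ξ + paritySign (k j) • LinearMap.proj j ∘ₗ ξ ∘ₗ ε),
    (2⁻¹ : ℂ) • (h - ε ∘ₗ h ∘ₗ ε), fun j v => ?_, fun j v => ?_, fun i j => ?_, fun v => ?_,
    fun v => ?_⟩
  · have : ε (d v) = d (-ε v) := by rw [map_neg, hdε, neg_neg]
    simp [h₁, this, -map_neg]
  · have := paritySign_mul_self (k j)
    simp only [LinearMap.smul_apply, LinearMap.add_apply, LinearMap.comp_apply, LinearMap.proj_apply,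
      smul_eq_mul, hε]
    linear_combination (-(2⁻¹ : ℂ) * ξ (ε v) j) * this
  · have := paritySign_mul_self (k j)
    simp only [LinearMap.smul_apply, LinearMap.add_apply, LinearMap.comp_apply, LinearMap.proj_apply,
      smul_eq_mul, hxε, map_smul, h₂, Pi.single_apply, eq_comm (a := j)]
    split_ifs with hij
    · subst hij
      linear_combination (2⁻¹ : ℂ) * this
    · simp
  · simp only [LinearMap.smul_apply, LinearMap.sub_apply, LinearMap.comp_apply, map_smul, map_sub,
      hε, ← smul_neg, neg_sub]
  · have h₄ := h₃ (ε v)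
    have h₅ := congrArg ε h₄
    simp only [map_add, map_sub, hε, map_sum, map_smul, hxε] at h₅
    have h₆ : d (ε (h (ε v))) + ε (h (ε (d v))) = -(v - ∑ j, ξ (ε v) j • paritySign (k j) • x j) := by
      rw [← h₅, hdε, hdε]
      simp
      abel
    have h₇ := h₃ v
    simp only [LinearMap.smul_apply, LinearMap.sub_apply, LinearMap.add_apply, LinearMap.comp_apply,
      LinearMap.proj_apply, map_smul, map_sub]
    rw [← smul_add, show d (h v) - d (ε (h (ε v))) + (h (d v) - ε (h (ε (d v)))) =
      (d (h v) + h (d v)) - (d (ε (h (ε v))) + ε (h (ε (d v)))) by abel, h₆, h₇]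
    simp only [smul_sub, sub_neg_eq_add, smul_add, smul_eq_mul, mul_add, add_smul,
      Finset.sum_add_distrib, Finset.smul_sum, smul_smul]
    have h₈ : (2⁻¹ : ℂ) • v + (2⁻¹ : ℂ) • v = v := by
      rw [← add_smul]
      norm_num
    simp only [mul_comm (paritySign _)]
    nth_rw 5 [← h₈]
    abel

end Contraction

/-! ### Parity and homogeneous bases of cohomology. -/

namespace DGModule

variable {A : DGAlgebra.{w}}

/-- The parity operator of a graded vector space. -/
def parity {V : Type*} [AddCommGroup V] [Module ℂ V] {g : ℤ → Submodule ℂ V}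
    (hg : DirectSum.IsInternal g) : V →ₗ[ℂ] V :=
  DirectSum.toModule ℂ ℤ V (fun i => paritySign i • (g i).subtype) ∘ₗ
    (LinearEquiv.ofBijective _ (bijective_coeLinearMap hg)).symm.toLinearMap

lemma parity_of_mem {V : Type*} [AddCommGroup V] [Module ℂ V] {g : ℤ → Submodule ℂ V}
    (hg : DirectSum.IsInternal g) {i : ℤ} {x : V} (hx : x ∈ g i) : parity hg x = paritySign i • x := by
  simp [parity, component_of_mem_aux hg hx]

lemma parity_parity {V : Type*} [AddCommGroup V] [Module ℂ V] {g : ℤ → Submodule ℂ V}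
    (hg : DirectSum.IsInternal g) (x : V) : parity hg (parity hg x) = x := by
  refine LinearMap.congr_fun (f := parity hg ∘ₗ parity hg) (g := LinearMap.id)
    (linearMap_ext_of_isInternal hg fun i y hy => ?_) x
  simp [parity_of_mem hg hy, smul_smul, paritySign_mul_self]

lemma d_parity (M : DGModule A) (m : M.carrier) :
    M.d (parity M.isInternal m) = -parity M.isInternal (M.d m) := by
  refine LinearMap.congr_fun (f := M.d ∘ₗ parity M.isInternal) (g := -(parity M.isInternal ∘ₗ M.d))
    (linearMap_ext_of_isInternal M.isInternal fun i y hy => ?_) m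
  simp [parity_of_mem _ hy, parity_of_mem _ (M.d_mem hy), paritySign_succ]

lemma H.mk_sum_smul {M : DGModule A} {k : ℤ} {J : Type*} [Fintype J] (c : J → ℂ)
    (x : J → M.carrier) (hx : ∀ j, x j ∈ M.cocycles k) :
    H.mk (∑ j, c j • x j) (Submodule.sum_mem _ fun j _ => Submodule.smul_mem _ _ (hx j)) =
      ∑ j, c j • H.mk (x j) (hx j) := by
  refine Eq.trans (congrArg (M.coboundaries k).mkQ ?_) (map_sum (M.coboundaries k).mkQ
    (fun j => c j • (⟨x j, hx j⟩ : M.cocycles k)) Finset.univ)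
  exact Subtype.ext (by simp)

lemma mem_of_component_mem {V : Type*} [AddCommGroup V] [Module ℂ V] {g : ℤ → Submodule ℂ V}
    (hg : DirectSum.IsInternal g) {U : Submodule ℂ V} {x : V} (h : ∀ k, component hg k x ∈ U) :
    x ∈ U := by
  obtain ⟨y, rfl⟩ := hg.2 x
  have h' : ∀ k, (y k : V) ∈ U := fun k => by
    have h1 : (LinearEquiv.ofBijective _ (bijective_coeLinearMap hg)).symm
        (DirectSum.coeLinearMap g y) = y :=
      (LinearEquiv.ofBijective _ (bijective_coeLinearMap hg)).symm_apply_apply y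
    have h2 := h k
    change ((LinearEquiv.ofBijective _ (bijective_coeLinearMap hg)).symm
      (DirectSum.coeLinearMap g y) k : V) ∈ U at h2
    rwa [h1] at h2
  classical
  change DirectSum.coeLinearMap g y ∈ U
  rw [DirectSum.coeLinearMap_eq_dfinsuppSum]
  exact Submodule.dfinsuppSum_mem _ _ _ fun k _ => h' k

/-- Representatives of homogeneous bases of the cohomology of a dg module with finite-dimensional
total cohomology. -/
lemma exists_basis_cocycles (M : DGModule A) (K : Finset ℤ)
    (hK : ∀ k ∉ K, Subsingleton (M.H k)) (hfin : ∀ k, Module.Finite ℂ (M.H k)) :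
    ∃ x : (Σ k : K, Fin (Module.finrank ℂ (M.H k))) → M.carrier,
      (∀ j, x j ∈ M.cocycles j.1) ∧
      (∀ z, M.d z = 0 → ∃ (c : (Σ k : K, Fin (Module.finrank ℂ (M.H k))) → ℂ) (y : M.carrier),
        z = ∑ j, c j • x j + M.d y) ∧
      ∀ (c : (Σ k : K, Fin (Module.finrank ℂ (M.H k))) → ℂ) (y : M.carrier),
        ∑ j, c j • x j = M.d y → c = 0 := by
  let b := fun k => Module.finBasis ℂ (M.H k)
  choose x hx hxb using fun j : (Σ k : K, Fin (Module.finrank ℂ (M.H k))) => H.exists_rep (b j.1 j.2)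
  refine ⟨x, hx, ?_, fun c y h => ?_⟩
  · have hhom : ∀ k, M.cocycles k ≤ Submodule.span ℂ (Set.range x) ⊔ LinearMap.range M.d := by
      intro k z hz
      by_cases hk : k ∈ K
      · have h1 := (b k).sum_repr (H.mk z hz)
        have h2 : H.mk (∑ i, (b k).repr (H.mk z hz) i • x ⟨⟨k, hk⟩, i⟩)
            (Submodule.sum_mem _ fun i _ => Submodule.smul_mem _ _ (hx ⟨⟨k, hk⟩, i⟩)) =
              H.mk z hz := by
          refine Eq.trans ?_ h1
          refine (H.mk_sum_smul _ _ fun i => hx ⟨⟨k, hk⟩, i⟩).trans ?_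
          exact Finset.sum_congr rfl fun i _ => congrArg _ (hxb ⟨⟨k, hk⟩, i⟩)
        rw [eq_comm, H.mk_eq_iff] at h2
        rw [← sub_add_cancel z (∑ i, (b k).repr (H.mk z hz) i • x ⟨⟨k, hk⟩, i⟩)]
        exact Submodule.add_mem _ (Submodule.mem_sup_right h2) (Submodule.mem_sup_left
          (Submodule.sum_mem _ fun i _ => Submodule.smul_mem _ _ (Submodule.subset_span ⟨_, rfl⟩)))
      · have := hK k hk
        exact Submodule.mem_sup_right ((H.mk_eq_zero_iff (hm := hz)).1 (Subsingleton.elim _ _))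
    intro z hz
    have hz' : z ∈ Submodule.span ℂ (Set.range x) ⊔ LinearMap.range M.d :=
      mem_of_component_mem M.isInternal fun k => hhom k
        ⟨(d_component M k z).trans (by rw [hz, map_zero]), component_mem _ _ _⟩
    obtain ⟨a, ha, _, ⟨y, rfl⟩, rfl⟩ := Submodule.mem_sup.1 hz'
    obtain ⟨c, rfl⟩ := (Submodule.mem_span_range_iff_exists_fun ℂ).1 ha
    exact ⟨c, y, rfl⟩
  · funext ⟨k, i⟩
    -- Projection to degree `k` kills the representatives of all other degrees, leaving a relation
    -- among basis classes of `H^k`.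
    have h1 := congrArg (component M.isInternal k) h
    rw [map_sum, Fintype.sum_sigma, Finset.sum_eq_single k (fun k' _ hk => Finset.sum_eq_zero
      fun i _ => by rw [map_smul, component_of_mem_ne _ (hx ⟨k', i⟩).2
        (fun h => hk (Subtype.ext h)), smul_zero]) (by simp)] at h1
    have h2 : ∑ i, c ⟨k, i⟩ • x ⟨k, i⟩ ∈ LinearMap.range M.d := by
      refine ⟨component M.isInternal (k - 1) y, ?_⟩
      rw [d_component, sub_add_cancel, ← h1]
      exact Finset.sum_congr rfl fun i _ => by rw [map_smul, component_of_mem _ (hx ⟨k, i⟩).2]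
    replace h2 := (H.mk_sum_smul (k := k) (fun i => c ⟨k, i⟩) (fun i => x ⟨k, i⟩)
      fun i => hx ⟨k, i⟩).symm.trans (H.mk_eq_zero_iff.2 h2)
    replace h2 : ∑ i, c ⟨k, i⟩ • b k i = 0 :=
      (Finset.sum_congr rfl fun i _ => congrArg _ (hxb ⟨k, i⟩).symm).trans h2
    exact Fintype.linearIndependent_iff.1 (b k).linearIndependent _ h2 i

end DGModule

/-! ### Finite sums of shifted free modules. -/

namespace DGModule

variable {A : DGAlgebra.{w}}

lemma isInternal_pi {J : Type} [Fintype J] {V : J → Type*} [∀ j, AddCommGroup (V j)]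
    [∀ j, Module ℂ (V j)] {g : ∀ j, ℤ → Submodule ℂ (V j)}
    (hg : ∀ j, DirectSum.IsInternal (g j)) :
    DirectSum.IsInternal (fun i => Submodule.pi Set.univ fun j => g j i) := by
  classical
  simp only [DirectSum.isInternal_submodule_iff_iSupIndep_and_iSup_eq_top] at hg ⊢
  refine ⟨fun i => ?_, eq_top_iff.2 fun x _ => ?_⟩
  · rw [Submodule.disjoint_def]
    intro x hx hx'
    funext j
    refine Submodule.disjoint_def.1 ((hg j).1 i) _ (hx j trivial) ?_
    have hle : (⨆ (l) (_ : l ≠ i), Submodule.pi Set.univ fun j => g j l) ≤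
        (⨆ (l) (_ : l ≠ i), g j l).comap (LinearMap.proj j) :=
      iSup₂_le fun l hl y hy => (le_iSup₂_of_le l hl le_rfl : g j l ≤ _) (hy j trivial)
    exact hle hx'
  · rw [← Finset.univ_sum_single x]
    refine Submodule.sum_mem _ fun j _ => ?_
    have hle : (⨆ i, g j i) ≤
        (⨆ i, Submodule.pi Set.univ fun j => g j i).comap (LinearMap.single ℂ V j) := by
      refine iSup_le fun l y hy => (le_iSup (fun i => Submodule.pi Set.univ fun j => g j i) l) ?_
      intro j' _
      by_cases h : j' = j
      · subst h
        simpa using hy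
      · simp [h]
    rw [(hg j).2] at hle
    exact hle trivial

variable (A) in
/-- The finite direct sum of the shifted free modules `A[-k j]`. -/
def freeSum {J : Type} [Fintype J] (k : J → ℤ) : DGModule A where
  carrier := J → A.carrier
  act := LinearMap.mk₂ ℂ (fun m a j => m j * a) (fun _ _ _ => by ext; simp [add_mul])
    (fun _ _ _ => by ext; simp) (fun _ _ _ => by ext; simp [mul_add]) (fun _ _ _ => by ext; simp)
  act_one m := by ext; simp
  act_mul m a b := by ext; simp [mul_assoc]
  gr i := Submodule.pi Set.univ fun j => A.gr (i + -k j)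
  isInternal := isInternal_pi fun j => isInternal_shift A.isInternal (-k j)
  act_mem {i l m a} hm ha j _ := by
    have := A.mul_mem (hm j trivial) ha
    rwa [show i + -k j + l = i + l + -k j by ring] at this
  d := LinearMap.pi fun j => paritySign (k j) • A.d ∘ₗ LinearMap.proj j
  d_mem {i m} hm j _ := by
    have := A.d_mem (hm j trivial)
    rw [show i + -k j + 1 = i + 1 + -k j by ring] at this
    exact Submodule.smul_mem _ _ this
  d_d m := by ext; simp [A.d_d]
  leibniz {i m} hm a := by
    ext j
    have := A.leibniz (hm j trivial) a
    change paritySign (k j) • A.d (m j * a) =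
      paritySign (k j) • A.d (m j) * a + i.negOnePow • (m j * A.d a)
    rw [this, smul_add, smul_mul_assoc, ← paritySign_smul, ← paritySign_smul, smul_smul]
    congr 2
    rw [← paritySign_add]
    congr 1
    ring

end DGModule

/-! ### The Künneth formula for the free bimodule. -/

section Kunneth

variable {T : Type u} [Category.{v} T] [Preadditive T] [Linear ℂ T] [HasZeroObject T]
  [HasShift T ℤ] [∀ n : ℤ, (shiftFunctor T n).Additive] [Pretriangulated T]
  {A : DGAlgebra.{w}} (e : PerfEquivalence T A)

open DerivedCat DGModule ZeroObject

/-- A finite direct sum of shifted free modules corresponds to the total object of a tower. -/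
lemma PerfEquivalence.exists_isTower_freeSum {G : T} (i : e.functor.obj G ≅ (Q A).obj (free A))
    {J : Type} [Fintype J] (k : J → ℤ) :
    ∃ (L : List ℤ) (Y : T), IsTower (L.map fun n => (shiftFunctor T n).obj G) Y ∧
      Nonempty (e.functor.obj Y ≅ (Q A).obj (freeSum A k)) ∧
      ∀ f : ℤ → ℝ, (L.map f).sum = ∑ j, f (-k j) := by
  refine Fintype.induction_empty_option (P := fun J _ => ∀ k : J → ℤ, ∃ (L : List ℤ) (Y : T),
    IsTower (L.map fun n => (shiftFunctor T n).obj G) Y ∧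
      Nonempty (e.functor.obj Y ≅ (Q A).obj (freeSum A k)) ∧
      ∀ f : ℤ → ℝ, (L.map f).sum = ∑ j, f (-k j)) ?_ ?_ ?_ J k
  · intro α β _ j ih k
    let := Fintype.ofEquiv β j.symm
    obtain ⟨L, Y, hL, ⟨i'⟩, hs⟩ := ih (k ∘ j)
    let φ : freeSum A (k ∘ j) ⟶ freeSum A k :=
      { toFun := (LinearMap.funLeft ℂ A.carrier j.symm)
        map_act := fun _ _ => rfl
        map_mem := fun {n m} hm b _ => by
          have : m (j.symm b) ∈ A.gr (n + -k (j (j.symm b))) := hm (j.symm b) trivial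
          rwa [j.apply_symm_apply] at this
        map_d := fun m => by
          refine funext fun b : β => ?_
          change paritySign (k (j (j.symm b))) • A.d (m (j.symm b)) = _
          rw [j.apply_symm_apply]
          rfl }
    have hφ : Function.Bijective φ.toFun :=
      (LinearEquiv.funCongrLeft ℂ A.carrier j.symm).bijective
    refine ⟨L, Y, hL, ⟨i' ≪≫ isoOfQuasiIso φ (quasiIso_of_bijective hφ)⟩, fun f => ?_⟩
    rw [hs, ← j.sum_comp]
    rfl
  · intro k
    have : Subsingleton (freeSum A k).carrier := inferInstanceAs (Subsingleton (PEmpty → A.carrier))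
    exact ⟨[], 0, .zero (isZero_zero T), e.nonempty_iso_of_isZero i (isZero_zero T) _, by simp⟩
  · intro α _ ih k
    obtain ⟨L, Y, hL, ⟨i'⟩, hs⟩ := ih (k ∘ some)
    -- The new summand `A[-k none]` is split off as the cone of a zero map from `A[-k none - 1]`.
    let z : shiftObj (-k none - 1) (free A) ⟶ freeSum A (k ∘ some) :=
      ⟨0, fun _ _ => (LinearMap.map_zero₂ (freeSum A (k ∘ some)).act _).symm,
        fun _ => Submodule.zero_mem _, fun _ => (map_zero _).symm⟩
    obtain ⟨Y', u, g, h, hd, -, ⟨i''⟩⟩ := e.exists_cone z (e.shiftIso i (-k none - 1)) i'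
    let toFun : (α → A.carrier) × A.carrier →ₗ[ℂ] (Option α → A.carrier) :=
      LinearMap.pi fun o => o.elim (LinearMap.snd ℂ (α → A.carrier) A.carrier)
          fun a => LinearMap.proj a ∘ₗ LinearMap.fst ℂ (α → A.carrier) A.carrier
    let φ : cone z ⟶ freeSum A k :=
      { toFun := toFun
        map_act := fun m a => by
          refine funext fun o : Option α => ?_
          cases o <;> rfl
        map_mem := fun {n m} hm o _ => by
          cases o with
          | none =>
            have : (show A.carrier from m.2) ∈ A.gr (n + 1 + (-k none - 1)) := hm.2
            rwa [show n + 1 + (-k none - 1) = n + -k none by ring] at this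
          | some a => exact hm.1 a trivial
        map_d := fun m => by
          refine funext fun o : Option α => ?_
          cases o with
          | none =>
            change -((-k none - 1).negOnePow • A.d m.2) = paritySign (k none) • A.d m.2
            rw [paritySign_smul, Int.negOnePow_sub, Int.negOnePow_neg]
            simp
          | some a =>
            change paritySign (k (some a)) • A.d (m.1 a) + 0 = paritySign (k (some a)) • A.d (m.1 a)
            rw [add_zero] }
    have hφ : Function.Bijective φ.toFun := by
      refine ⟨fun x y h => ?_, fun m => ⟨(fun a => m (some a), m none), ?_⟩⟩
      · exact Prod.ext (funext fun a => congrFun h (some a)) (congrFun h none)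
      · refine funext fun o : Option α => ?_
        cases o <;> rfl
    refine ⟨L ++ [-k none], Y', ?_, ⟨i'' ≪≫ isoOfQuasiIso φ (quasiIso_of_bijective hφ)⟩,
      fun f => ?_⟩
    · obtain ⟨_, _, _, hd'⟩ := exists_distTriang_of_iso (rot_of_distTriang _ hd) (Iso.refl _)
        (Iso.refl _) ((shiftFunctorAdd' T (-k none - 1) 1 (-k none) (by ring)).app G).symm
      rw [List.map_append]
      exact .step _ _ _ hd' hL
    · rw [List.map_append, List.sum_append, hs, Fintype.sum_option, add_comm]
      simp

namespace TensorFunctor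

variable {X : DGModule A} (τ : TensorFunctor X)

/-- Künneth formula. -/
lemma exists_quasiIso_freeSum {J : Type} [Fintype J] [DecidableEq J] (k : J → ℤ)
    (x : J → X.carrier) (hx : ∀ j, x j ∈ X.cocycles (k j))
    (hspan : ∀ z, X.d z = 0 → ∃ (c : J → ℂ) (y : X.carrier), z = ∑ j, c j • x j + X.d y)
    (hind : ∀ (c : J → ℂ) (y : X.carrier), ∑ j, c j • x j = X.d y → c = 0)
    {F : DGBimodule A} (hF : F.IsFreeOfRankOne) :
    ∃ ψ : freeSum A k ⟶ τ.obj F, DGModule.quasiIso A ψ := by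
  obtain ⟨u, hu0, hdu, hu⟩ := hF
  obtain ⟨ξ, h, h₁, h₂, h₃, h₄, h₅⟩ := exists_graded_contraction X.d X.d_d (parity X.isInternal)
    (parity_parity X.isInternal) X.d_parity x k (fun j => (hx j).1)
    (fun j => parity_of_mem _ (hx j).2) hspan hind
  let ε := parity X.isInternal
  let Θ := LinearEquiv.ofBijective _ (τ.bijective_free hu)
  let p : X.carrier →ₗ[ℂ] A.carrier →ₗ[ℂ] (τ.obj F).carrier := (τ.pair F).compl₂ (F.ract u)
  have hp : ∀ y a, p y a = τ.pair F y (F.ract u a) := fun _ _ => rfl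
  have hΘ : ∀ y a, Θ (y ⊗ₜ a) = p y a := fun y a => rfl
  have hΘ' : ∀ y a, Θ.symm (p y a) = y ⊗ₜ a := fun y a => by rw [← hΘ, Θ.symm_apply_apply]
  have hext : ∀ {W : Type w} [AddCommGroup W] [Module ℂ W] (φ φ' : (τ.obj F).carrier →ₗ[ℂ] W),
      (∀ y a, φ (p y a) = φ' (p y a)) → ∀ w, φ w = φ' w := by
    intro W _ _ φ φ' hφ w
    have : φ ∘ₗ Θ.toLinearMap = φ' ∘ₗ Θ.toLinearMap := TensorProduct.ext' fun y a => hφ y a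
    simpa using LinearMap.congr_fun this (Θ.symm w)
  -- Writing the Leibniz sign as the parity operator makes the formula linear in `y`, hence valid
  -- for inhomogeneous `y`; this is why the contraction must respect parity.
  have hdp : ∀ y a, (τ.obj F).d (p y a) = p (X.d y) a + p (ε y) (A.d a) := by
    intro y a
    refine LinearMap.congr_fun (f := (τ.obj F).d ∘ₗ p.flip a)
      (g := p.flip a ∘ₗ X.d + p.flip (A.d a) ∘ₗ ε)
      (linearMap_ext_of_isInternal X.isInternal fun i y hy => ?_) y
    have h6 : F.d (F.ract u a) = F.ract u (A.d a) := by
      rw [F.leibniz_ract hu0, hdu]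
      simp
    have h7 := τ.d_pair hy (F.ract u a)
    rw [h6] at h7
    refine h7.trans ?_
    simp [ε, parity_of_mem _ hy, paritySign_smul, hp]
  -- Under `τ F = X ⊗_ℂ A` the contraction is tensored with `A`: `Ξ` is a retraction of `ψ`, and `H`
  -- is a homotopy from the identity to `ψ Ξ`.
  let H : (τ.obj F).carrier →ₗ[ℂ] (τ.obj F).carrier := Θ.toLinearMap ∘ₗ h.rTensor _ ∘ₗ Θ.symm.toLinearMap
  have hH : ∀ y a, H (p y a) = p (h y) a := fun y a => by simp [H, hΘ', hΘ]
  let Ξ : (τ.obj F).carrier →ₗ[ℂ] (J → A.carrier) := LinearMap.pi fun j =>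
    (TensorProduct.lid ℂ A.carrier).toLinearMap ∘ₗ (ξ j).rTensor _ ∘ₗ Θ.symm.toLinearMap
  have hΞ : ∀ y a j, Ξ (p y a) j = ξ j y • a := fun y a j => by simp [Ξ, hΘ']
  let ψ : (J → A.carrier) →ₗ[ℂ] (τ.obj F).carrier := ∑ j, p (x j) ∘ₗ LinearMap.proj j
  have hψ : ∀ m, ψ m = ∑ j, p (x j) (m j) := fun m => by simp [ψ]
  have hΞψ : ∀ m, Ξ (ψ m) = m := fun m => by
    ext j
    rw [hψ, map_sum, Finset.sum_apply]
    simp [hΞ, h₃]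
  have hΞd : ∀ w, Ξ ((τ.obj F).d w) = (freeSum A k).d (Ξ w) := by
    refine hext (Ξ ∘ₗ (τ.obj F).d) ((freeSum A k).d ∘ₗ Ξ) fun y a => ?_
    ext j
    change Ξ ((τ.obj F).d (p y a)) j = paritySign (k j) • A.d (Ξ (p y a) j)
    rw [hdp, map_add, Pi.add_apply, hΞ, hΞ, hΞ, h₁, h₂]
    simp [smul_smul]
  have hHd : ∀ w, (τ.obj F).d (H w) + H ((τ.obj F).d w) = w - ψ (Ξ w) := by
    refine hext ((τ.obj F).d ∘ₗ H + H ∘ₗ (τ.obj F).d) (LinearMap.id - ψ ∘ₗ Ξ) fun y a => ?_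
    change (τ.obj F).d (H (p y a)) + H ((τ.obj F).d (p y a)) = p y a - ψ (Ξ (p y a))
    rw [hH, hdp, hdp, map_add, hH, hH, h₄, hψ]
    have h8 : ∑ j, p (x j) (Ξ (p y a) j) = p (∑ j, ξ j y • x j) a := by simp [hΞ]
    rw [h8, ← LinearMap.sub_apply, ← map_sub, ← h₅, map_add, map_neg]
    simp
    abel
  let ψ' : freeSum A k ⟶ τ.obj F :=
    { toFun := ψ
      map_act := fun m a => by
        refine (hψ _).trans (Eq.trans ?_ (congrArg (fun y => (τ.obj F).act y a) (hψ m).symm))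
        rw [map_sum, LinearMap.sum_apply]
        refine Finset.sum_congr rfl fun j _ => ?_
        rw [hp, hp, ← τ.pair_ract, ← F.ract_mul]
        rfl
      map_mem := fun {i m} hm => by
        refine (hψ m).symm ▸ Submodule.sum_mem _ fun j _ => ?_
        have h9 := τ.pair_mem (hx j).2 (F.ract_mem hu0 (hm j trivial))
        rwa [show k j + (0 + (i + -k j)) = i by ring] at h9
      map_d := fun m => by
        refine (hψ _).trans (Eq.trans ?_ (congrArg (τ.obj F).d (hψ m).symm))
        rw [map_sum]
        refine Finset.sum_congr rfl fun j _ => ?_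
        have h10 : ε (x j) = paritySign (k j) • x j := parity_of_mem _ (hx j).2
        have h11 : X.d (x j) = 0 := (hx j).1
        rw [hdp, h10, h11]
        change p (x j) (paritySign (k j) • A.d (m j)) = _
        simp }
  refine ⟨ψ', ?_, ?_⟩
  · rintro m - ⟨w, hw⟩
    exact ⟨Ξ w, (hΞψ m).symm.trans ((congrArg Ξ hw).trans (hΞd w))⟩
  · intro w hw
    refine ⟨Ξ w, H w, (hΞd w).symm.trans ((congrArg Ξ hw).trans (map_zero Ξ)), ?_⟩
    have h12 := hHd w
    rw [hw, map_zero, add_zero] at h12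
    exact (add_eq_of_eq_sub' h12).symm

end TensorFunctor

end Kunneth

lemma complexity_le_of_retract {T : Type u} [Category.{v} T] [Preadditive T] [HasZeroObject T]
    [HasShift T ℤ] [∀ n : ℤ, (shiftFunctor T n).Additive] [Pretriangulated T] (t : ℝ) {G R E : T}
    (r : Retract R E) : complexity t G R ≤ complexity t G E :=
  le_complexity_iff.2 fun _ h => complexity_le_of_built (h.of_retract r)

/-! ### Smoothness: complexity is bounded by cohomology. -/

section UpperBound

variable {T : Type u} [Category.{v} T] [Preadditive T] [Linear ℂ T] [HasZeroObject T]
  [HasShift T ℤ] [∀ n : ℤ, (shiftFunctor T n).Additive] [Pretriangulated T] [IsTriangulated T]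
  {A : DGAlgebra.{w}} (e : PerfEquivalence T A)

open DerivedCat DGModule

namespace PerfEquivalence

lemma poincare_ne_top (hA : A.IsProper) {G : T} (i : e.functor.obj G ≅ (Q A).obj (free A)) (t : ℝ)
    (E : T) : e.poincare t E ≠ ⊤ := by
  obtain ⟨L, hL⟩ := (e.isSplitGenerator i).exists_built E
  exact ne_top_of_le_ne_top (ENNReal.mul_ne_top (e.poincare_free_ne_top hA i t)
    ENNReal.ofReal_ne_top) (e.poincare_le_of_built i t hL)

lemma betti_ne_top (hA : A.IsProper) {G : T} (i : e.functor.obj G ≅ (Q A).obj (free A)) (k : ℤ)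
    (E : T) : e.betti k E ≠ ⊤ := by
  have h := ENNReal.ne_top_of_tsum_ne_top (e.poincare_ne_top hA i 0 E) k
  intro h'
  simp [h'] at h

/-- At `t = 0` every nonzero Betti number contributes at least `1` to a finite sum. -/
lemma finite_betti_ne_zero (hA : A.IsProper) {G : T} (i : e.functor.obj G ≅ (Q A).obj (free A))
    (E : T) : {k : ℤ | e.betti k E ≠ 0}.Finite := by
  refine (ENNReal.finite_const_le_of_tsum_ne_top (e.poincare_ne_top hA i 0 E) one_ne_zero).subset
    fun k hk => ?_
  have h : 1 ≤ e.betti k E := Order.one_le_iff_ne_zero.2 hk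
  simpa using ENat.toENNReal_le.2 h

/-- By Künneth, `X ⊗_ℂ A` is a sum of copies of `A[-k]`, one for each basis vector of `H^k(X)`. The
obvious tower has weight `∑ b_k(X) e^{-kt}`, and `Y` serves for all `t` simultaneously. -/
lemma exists_built_poincare (hA : A.IsProper) {G : T}
    (i : e.functor.obj G ≅ (Q A).obj (free A)) {E : T} {X : DGModule A}
    (j : e.functor.obj E ≅ (Q A).obj X) (τ : TensorFunctor X) :
    ∃ Y : T, (∀ F : DGBimodule A, F.IsFreeOfRankOne →
        Nonempty (e.functor.obj Y ≅ (Q A).obj (τ.obj F))) ∧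
      ∀ t : ℝ, complexity t G Y ≤ e.poincare t E := by
  classical
  have hfin : ∀ k, Module.Finite ℂ (X.H k) := fun k => by
    have h := e.betti_ne_top hA i k E
    rwa [e.betti_eq j, ← lt_top_iff_ne_top, Cardinal.toENat_lt_top, Module.rank_lt_aleph0_iff] at h
  have hbetti : ∀ k, e.betti k E = (Module.finrank ℂ (X.H k) : ℕ) := fun k => by
    rw [e.betti_eq j, ← Module.finrank_eq_rank, map_natCast]
  have hK := e.finite_betti_ne_zero hA i E
  obtain ⟨x, hx, hspan, hind⟩ := X.exists_basis_cocycles hK.toFinset (fun k hk => by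
    have h : e.betti k E = 0 := by simpa using hk
    rw [hbetti, Nat.cast_eq_zero] at h
    exact Module.finrank_zero_iff.1 h) hfin
  obtain ⟨L, Y, hL, ⟨i'⟩, hs⟩ := e.exists_isTower_freeSum i
    (fun j : (Σ k : hK.toFinset, Fin (Module.finrank ℂ (X.H k))) => (j.1 : ℤ))
  refine ⟨Y, fun F hF => ?_, fun t => ?_⟩
  · obtain ⟨ψ, hψ⟩ := τ.exists_quasiIso_freeSum _ x hx hspan hind hF
    exact ⟨i' ≪≫ isoOfQuasiIso ψ hψ⟩
  · refine (complexity_le_of_built (Built.of_isTower hL)).trans ?_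
    rw [hs, Fintype.sum_sigma, poincare]
    refine le_trans (le_of_eq ?_) (ENNReal.sum_le_tsum hK.toFinset)
    rw [ENNReal.ofReal_sum_of_nonneg (fun _ _ => by positivity), ← Finset.sum_coe_sort hK.toFinset]
    refine Finset.sum_congr rfl fun k _ => ?_
    rw [hbetti]
    simp [ENNReal.ofReal_mul]

/-- For a smooth proper dg algebra the complexity with respect to the free module is bounded by the
generating function of the cohomology. -/
theorem exists_complexity_le_poincare (hsmooth : A.IsSmooth) (hA : A.IsProper) {G : T}
    (i : e.functor.obj G ≅ (Q A).obj (free A)) (t : ℝ) :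
    ∃ C : ℝ≥0∞, C ≠ ⊤ ∧ ∀ E : T, complexity t G E ≤ C * e.poincare t E := by
  obtain ⟨L, hL⟩ := e.exists_built_of_isPerfect hsmooth
  -- The first factor is the cost of building the diagonal bimodule. The second is `1 + e^t`, the
  -- price of passing from `E` to `E ⊞ E[1]`.
  refine ⟨ENNReal.ofReal (L.map fun n : ℤ => Real.exp (n * t)).sum *
    (1 + ENNReal.ofReal (Real.exp ((1 : ℤ) * t))), ?_, fun E => ?_⟩
  · exact ENNReal.mul_ne_top ENNReal.ofReal_ne_top
      (ENNReal.add_ne_top.2 ⟨ENNReal.one_ne_top, ENNReal.ofReal_ne_top⟩)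
  obtain ⟨L₀, hL₀⟩ := (e.isSplitGenerator i).exists_built E
  -- An exact tensor model requires a tower without a complementary summand, which `E ⊞ E[1]` has
  -- even when `E` does not.
  obtain ⟨L', hL'⟩ := hL₀.exists_isTower_biprod_shift
  obtain ⟨X, ⟨τ⟩, ⟨j⟩⟩ := e.exists_tensorFunctor i hL'
  obtain ⟨Y, hY, hYc⟩ := e.exists_built_poincare hA i j τ
  obtain ⟨E', ⟨j'⟩, hE'⟩ := hL τ Y hY
  have hE := hE'.of_iso (e.functor.preimageIso
    (j' ≪≫ (isoOfQuasiIso _ τ.quasiIso_unit).symm ≪≫ j.symm))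
  have hc := complexity_le_of_built (t := t) hE
  refine (complexity_le_of_retract t (E := E ⊞ (shiftFunctor T (1 : ℤ)).obj E)
    ⟨biprod.inl, biprod.fst, by simp⟩).trans ?_
  refine (complexity_trans ((e.isSplitGenerator i).complexity_ne_top t Y)
    (ne_top_of_le_ne_top ENNReal.ofReal_ne_top hc)).trans ?_
  rw [mul_comm, mul_assoc]
  refine mul_le_mul' hc ((hYc t).trans ((e.poincare_le_add t
    (binaryBiproductTriangle_distinguished E ((shiftFunctor T (1 : ℤ)).obj E))).trans ?_))
  rw [e.poincare_shift, add_mul, one_mul, mul_comm (e.poincare t E)]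

end PerfEquivalence

end UpperBound

/-! ### Phases, Serre duality and global dimension. -/

section Slicing

variable {T : Type u} [Category.{v} T] [Preadditive T] [HasZeroObject T] [HasShift T ℤ]
  [∀ n : ℤ, (shiftFunctor T n).Additive] [Pretriangulated T]

lemma IsTower.hom_eq_zero_of_left {l : List T} {E X : T} (h : IsTower l E)
    (hX : ∀ B ∈ l, ∀ f : B ⟶ X, f = 0) (f : E ⟶ X) : f = 0 := by
  induction h with
  | zero h0 => exact h0.eq_of_src _ _
  | step a b c ht _ ih =>
    obtain ⟨k, rfl⟩ := Triangle.yoneda_exact₂ _ ht f (ih (fun B hB => hX B (by simp [hB])) _)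
    exact (congrArg (b ≫ ·) (hX _ (by simp) k)).trans comp_zero

lemma IsTower.hom_eq_zero_of_right {l : List T} {E X : T} (h : IsTower l E)
    (hX : ∀ B ∈ l, ∀ f : X ⟶ B, f = 0) (f : X ⟶ E) : f = 0 := by
  induction h with
  | zero h0 => exact h0.eq_of_tgt _ _
  | step a b c ht _ ih =>
    obtain ⟨k, rfl⟩ := Triangle.coyoneda_exact₂ _ ht f (hX _ (by simp) _)
    exact (congrArg (· ≫ a) (ih (fun B hB => hX B (by simp [hB])) k)).trans zero_comp

namespace StabilityCondition

variable {Λ : Type*} [AddCommGroup Λ] {v : GrothendieckGroup T →+ Λ}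
  {N : Seminorm ℝ (ℝ ⊗[ℤ] Λ)} (σ : StabilityCondition v N)

/-- The objects that are iterated extensions of semistable objects with phases satisfying `p`. -/
def PhaseIn (p : ℝ → Prop) (E : T) : Prop :=
  ∃ l : List (ℝ × T), IsTower (l.map Prod.snd) E ∧ ∀ x ∈ l, σ.P x.1 x.2 ∧ p x.1

variable {σ}

lemma PhaseIn.hom_eq_zero {p q : ℝ → Prop} {E E' : T} (hE : σ.PhaseIn p E) (hE' : σ.PhaseIn q E')
    (h : ∀ a b, p a → q b → b < a) (f : E ⟶ E') : f = 0 := by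
  obtain ⟨l, hl, hlP⟩ := hE
  obtain ⟨l', hl', hlP'⟩ := hE'
  refine hl.hom_eq_zero_of_left (fun B hB f => ?_) f
  refine hl'.hom_eq_zero_of_right (fun B' hB' f => ?_) f
  obtain ⟨x, hx, rfl⟩ := List.mem_map.1 hB
  obtain ⟨x', hx', rfl⟩ := List.mem_map.1 hB'
  exact σ.hom_eq_zero (h _ _ (hlP x hx).2 (hlP' x' hx').2) (hlP x hx).1 (hlP' x' hx').1 f

lemma shift_iff_nat (φ : ℝ) (E : T) (n : ℕ) :
    σ.P (φ + n) ((shiftFunctor T (n : ℤ)).obj E) ↔ σ.P φ E := by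
  induction n with
  | zero =>
    rw [Nat.cast_zero, add_zero]
    exact ⟨σ.of_iso ((shiftFunctorZero T ℤ).app E), σ.of_iso ((shiftFunctorZero T ℤ).app E).symm⟩
  | succ n ih =>
    rw [← ih, ← σ.shift_iff (φ + n), Nat.cast_succ, add_assoc]
    let j := (shiftFunctorAdd' T (n : ℤ) 1 ((n + 1 : ℕ) : ℤ) (by simp)).app E
    exact ⟨σ.of_iso j, σ.of_iso j.symm⟩

lemma P_shift {φ : ℝ} {E : T} (h : σ.P φ E) (n : ℤ) :
    σ.P (φ + n) ((shiftFunctor T n).obj E) := by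
  obtain ⟨m, rfl | rfl⟩ := n.eq_nat_or_neg
  · exact_mod_cast (σ.shift_iff_nat φ E m).2 h
  · rw [← σ.shift_iff_nat _ _ m]
    push_cast
    rw [neg_add_cancel_right]
    exact σ.of_iso ((shiftFunctorCompIsoId T (-(m : ℤ)) m (by simp)).app E).symm h

lemma PhaseIn.shift {p : ℝ → Prop} {E : T} (hE : σ.PhaseIn p E) (n : ℤ) :
    σ.PhaseIn (fun a => p (a - n)) ((shiftFunctor T n).obj E) := by
  obtain ⟨l, hl, hlP⟩ := hE
  refine ⟨l.map fun x => (x.1 + n, (shiftFunctor T n).obj x.2), ?_, ?_⟩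
  · simpa [Function.comp_def] using hl.shift n
  · rintro _ hx
    obtain ⟨x, hx', rfl⟩ := List.mem_map.1 hx
    exact ⟨P_shift (hlP x hx').1 n, by simpa using (hlP x hx').2⟩

variable (σ)

lemma exists_phaseIn (E : T) : ∃ a b : ℝ, σ.PhaseIn (a ≤ ·) E ∧ σ.PhaseIn (· ≤ b) E := by
  by_cases h : IsZero E
  · exact ⟨0, 0, ⟨[], .zero h, by simp⟩, ⟨[], .zero h, by simp⟩⟩
  obtain ⟨l, hl, hlP, -⟩ := σ.exists_HN E h
  obtain ⟨a, ha⟩ := (l.map Prod.fst).toFinset.bddBelow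
  obtain ⟨b, hb⟩ := (l.map Prod.fst).toFinset.bddAbove
  refine ⟨a, b, ⟨l, hl, fun x hx => ⟨hlP x hx, ha ?_⟩⟩, ⟨l, hl, fun x hx => ⟨hlP x hx, hb ?_⟩⟩⟩ <;>
  · exact List.mem_toFinset.2 (List.mem_map_of_mem hx)

variable {σ}

/-- The first nonzero Harder–Narasimhan factor maps nontrivially to the object. -/
lemma exists_hom_ne_zero_of_isTower {l : List (ℝ × T)} {E : T} (hl : IsTower (l.map Prod.snd) E)
    (hlP : ∀ x ∈ l, σ.P x.1 x.2) (hlp : (l.map Prod.fst).Pairwise (· > ·)) :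
    (IsZero E ∧ ∀ x ∈ l, IsZero x.2) ∨ ∃ x ∈ l, (∃ f : x.2 ⟶ E, f ≠ 0) ∧
      ∀ y ∈ l, ¬ IsZero y.2 → y.1 ≤ x.1 := by
  generalize hl' : l.map Prod.snd = l' at hl
  induction hl generalizing l with
  | zero h0 => exact .inl ⟨h0, by simp [List.map_eq_nil_iff.1 hl']⟩
  | @step l' E E' B f g h ht _ ih =>
    obtain ⟨l₁, l₂, rfl, h₁, h₂⟩ := List.map_eq_append_iff.1 hl'
    obtain ⟨b, l₃, rfl, rfl, h₃⟩ := List.map_eq_cons_iff.1 h₂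
    obtain rfl := List.map_eq_nil_iff.1 h₃
    rw [List.map_append, List.pairwise_append] at hlp
    rcases ih (fun x hx => hlP x (by simp [hx])) hlp.1 h₁ with ⟨h0, hz⟩ | ⟨x, hx, ⟨k, hk⟩, hmax⟩
    -- Factors in the list may vanish. When the tower is still zero, its total object becomes `b`,
    -- which is the first nonzero factor unless it is zero too.
    · have : IsIso g := (Triangle.isZero₁_iff_isIso₂ _ ht).1 h0
      by_cases hb : IsZero b.2
      · refine .inl ⟨hb.of_iso (asIso g), fun x hx => ?_⟩
        rcases List.mem_append.1 hx with hx | hx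
        · exact hz x hx
        · rwa [List.mem_singleton.1 hx]
      · refine .inr ⟨b, by simp, ⟨inv g, fun h => hb ?_⟩, fun y hy hy0 => ?_⟩
        · rw [IsZero.iff_id_eq_zero, ← IsIso.inv_hom_id g, h, zero_comp]
        · rcases List.mem_append.1 hy with hy | hy
          · exact (hy0 (hz y hy)).elim
          · rw [List.mem_singleton.1 hy]
    · have hxb : b.1 < x.1 := hlp.2.2 _ (List.mem_map_of_mem hx) _ (by simp)
      refine .inr ⟨x, by simp [hx], ⟨k ≫ f, fun h0 => hk ?_⟩, fun y hy hy0 => ?_⟩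
      -- A map killed by `f` factors through `b[-1]`, whose phase `b.1 - 1` is below `x.1`.
      · obtain ⟨m, rfl⟩ := Triangle.coyoneda_exact₂ _ (inv_rot_of_distTriang _ ht) k h0
        have hP := P_shift (hlP b (by simp)) (-1)
        have : m = 0 := σ.hom_eq_zero (by push_cast; linarith) (hlP x (by simp [hx])) hP m
        exact (congrArg (· ≫ _) this).trans zero_comp
      · rcases List.mem_append.1 hy with hy | hy
        · exact hmax y hy hy0
        · rw [List.mem_singleton.1 hy]
          exact hxb.le

lemma phase_sub_le {g : ℝ} (hg : σ.gldim ≤ g) {φ₁ φ₂ : ℝ} {E₁ E₂ : T} (h₁ : σ.P φ₁ E₁)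
    (h₂ : σ.P φ₂ E₂) (f : E₁ ⟶ E₂) (hf : f ≠ 0) : φ₂ - φ₁ ≤ g :=
  EReal.coe_le_coe_iff.1 (le_trans (le_sSup ⟨φ₁, φ₂, E₁, E₂, f, h₁, h₂, hf, rfl⟩ :
    ((φ₂ - φ₁ : ℝ) : EReal) ≤ σ.gldim) hg)

/-- The highest nonzero factor `x` of `S E` has a nonzero map to `S E`, so `Hom(E, x) ≠ 0` by Serre
duality. Hence some factor of `E`, of phase at most `b`, maps nontrivially to `x`, and the phase of
`x` exceeds that of the factor by at most `g`. -/
lemma PhaseIn.serre [Linear ℂ T] {S : T ⥤ T} [S.IsEquivalence] [S.CommShift ℤ] [S.IsTriangulated]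
    (hS : IsSerreFunctor S) {g : ℝ} (hg : σ.gldim ≤ g) {b : ℝ} {E : T}
    (hE : σ.PhaseIn (· ≤ b) E) : σ.PhaseIn (· ≤ b + g) (S.obj E) := by
  classical
  obtain ⟨η, -⟩ := hS
  by_cases h0 : IsZero (S.obj E)
  · exact ⟨[], .zero h0, by simp⟩
  obtain ⟨l, hl, hlP, hlp⟩ := σ.exists_HN _ h0
  obtain ⟨x, hx, ⟨f, hf⟩, hmax⟩ :=
    (exists_hom_ne_zero_of_isTower hl hlP hlp).resolve_left fun h => h0 h.1
  have hxb : x.1 ≤ b + g := by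
    by_contra hxb
    have hzero : ∀ k : E ⟶ x.2, k = 0 := by
      obtain ⟨l', hl', hlP'⟩ := hE
      refine hl'.hom_eq_zero_of_left fun B hB k => ?_
      obtain ⟨y, hy, rfl⟩ := List.mem_map.1 hB
      by_contra hk
      have h₁ := phase_sub_le hg (hlP' y hy).1 (hlP x hx) k hk
      have h₂ := (hlP' y hy).2
      linarith
    -- A functional that does not vanish on `f` would correspond under duality to a map `E ⟶ x`, and
    -- these are all zero.
    obtain ⟨ξ, hξ⟩ : ∃ ξ : Module.Dual ℂ (x.2 ⟶ S.obj E), ξ f ≠ 0 :=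
      not_forall.1 fun h => hf ((Module.forall_dual_apply_eq_zero_iff ℂ f).1 fun ξ => h ξ)
    refine hξ ?_
    rw [← (η E x.2).apply_symm_apply ξ, hzero ((η E x.2).symm ξ), map_zero, LinearMap.zero_apply]
  -- A zero factor carries a meaningless phase; since it is semistable of every phase, it is
  -- relabelled `b + g`.
  refine ⟨l.map fun y => (if IsZero y.2 then b + g else y.1, y.2), ?_, ?_⟩
  · simpa [Function.comp_def] using hl
  · intro z hz
    obtain ⟨y, hy, rfl⟩ := List.mem_map.1 hz
    by_cases hy0 : IsZero y.2
    · exact ⟨σ.zero_mem hy0, by simp [hy0]⟩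
    · simpa [hy0] using ⟨hlP y hy, (hmax y hy hy0).trans hxb⟩

lemma PhaseIn.serre_iterate [Linear ℂ T] {S : T ⥤ T} [S.IsEquivalence] [S.CommShift ℤ]
    [S.IsTriangulated] (hS : IsSerreFunctor S) {g : ℝ} (hg : σ.gldim ≤ g) {b : ℝ} {E : T}
    (hE : σ.PhaseIn (· ≤ b) E) (n : ℕ) : σ.PhaseIn (· ≤ b + n * g) (S.obj^[n] E) := by
  induction n with
  | zero => simpa using hE
  | succ n ih =>
    rw [Function.iterate_succ_apply']
    rw [Nat.cast_succ, add_one_mul, ← add_assoc]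
    exact ih.serre hS hg

/-- The identity of a nonzero semistable factor contributes the phase difference `0`. -/
lemma gldim_nonneg {E : T} (hE : ¬ IsZero E) : 0 ≤ σ.gldim := by
  obtain ⟨l, hl, hlP, hlp⟩ := σ.exists_HN _ hE
  obtain ⟨x, hx, ⟨f, hf⟩, -⟩ :=
    (exists_hom_ne_zero_of_isTower hl hlP hlp).resolve_left fun h => hE h.1
  refine le_sSup ⟨x.1, x.1, x.2, x.2, 𝟙 _, hlP x hx, hlP x hx, fun h => hf ?_, by simp⟩
  rw [← id_comp f, h, zero_comp]

/-- The cohomology of the iterates of the Serre functor is bounded below in terms of the global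
dimension. -/
lemma exists_forall_betti_ne_zero [Linear ℂ T] {A : DGAlgebra.{w}} (e : PerfEquivalence T A)
    {G : T} (i : e.functor.obj G ≅ (DerivedCat.Q A).obj (DGModule.free A)) {S : T ⥤ T}
    [S.IsEquivalence] [S.CommShift ℤ] [S.IsTriangulated] (hS : IsSerreFunctor S) {g : ℝ}
    (hg : σ.gldim ≤ g) :
    ∃ c : ℝ, ∀ (n : ℕ) (k : ℤ), e.betti k (S.obj^[n] G) ≠ 0 → -(k : ℝ) ≤ n * g + c := by
  obtain ⟨a, b, ha, hb⟩ := σ.exists_phaseIn G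
  refine ⟨b - a, fun n k hk => ?_⟩
  by_contra hlt
  refine hk (e.betti_eq_zero i fun f => ?_)
  -- The phases of `S^n G[k]` are at most `b + ng + k`, which the assumption puts strictly below
  -- `a`.
  refine ha.hom_eq_zero ((hb.serre_iterate hS hg n).shift k) (fun x y hx hy => ?_) f
  linarith

end StabilityCondition

end Slicing

/-! ### Exponential growth rates. -/

section Growth

lemma tendsto_coe_div_natCast (a : ℝ) :
    Tendsto (fun n : ℕ => (a : EReal) / (n : EReal)) atTop (𝓝 0) := by
  have h := EReal.tendsto_coe.2 (tendsto_const_div_atTop_nhds_zero_nat a)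
  simpa only [EReal.coe_div, EReal.coe_natCast, EReal.coe_zero] using h

lemma EReal.zero_le_natCast (n : ℕ) : (0 : EReal) ≤ n := by
  rw [← EReal.coe_natCast, EReal.coe_nonneg]
  exact n.cast_nonneg

lemma ENNReal.exists_log_le_add {u w : ℕ → ℝ≥0∞} {C : ℝ≥0∞} (hC : C ≠ ⊤)
    (h : ∀ n, u n ≤ C * w n) : ∃ a : ℝ, ∀ n : ℕ,
      ENNReal.log (u n) / (n : EReal) ≤ a / (n : EReal) + ENNReal.log (w n) / (n : EReal) := by
  -- `C + 1` replaces `C` so that the logarithm is finite when `C = 0`.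
  refine ⟨Real.log (C + 1).toReal, fun n => ?_⟩
  rw [← ENNReal.log_pos_real (by simp) (by simpa using hC), ← EReal.add_div_of_nonneg_right
    (EReal.zero_le_natCast n), ← ENNReal.log_mul_add]
  refine EReal.div_le_div_right_of_nonneg (EReal.zero_le_natCast n) (ENNReal.log_monotone ?_)
  exact (h n).trans (mul_le_mul_left le_self_add _)

/-- The exponential growth rate only depends on a sequence up to bounded factors. -/
lemma ENNReal.tendsto_log_div_of_le {u w : ℕ → ℝ≥0∞} {c C : ℝ≥0∞} (hC : C ≠ ⊤) (hc : c ≠ ⊤)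
    (h₁ : ∀ n, u n ≤ C * w n) (h₂ : ∀ n, w n ≤ c * u n) {l : EReal}
    (h : Tendsto (fun n : ℕ => ENNReal.log (w n) / (n : EReal)) atTop (𝓝 l)) :
    Tendsto (fun n : ℕ => ENNReal.log (u n) / (n : EReal)) atTop (𝓝 l) := by
  obtain ⟨a, ha⟩ := exists_log_le_add hC h₁
  obtain ⟨b, hb⟩ := exists_log_le_add hc h₂
  have key : ∀ a : ℝ, Tendsto (fun n : ℕ => (a : EReal) / (n : EReal) +
      ENNReal.log (w n) / (n : EReal)) atTop (𝓝 l) := fun a => by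
    have h' := (EReal.continuousAt_add (p := (0, l)) (by simp) (by simp)).tendsto.comp
      ((tendsto_coe_div_natCast a).prodMk_nhds h)
    simpa [Function.comp_def] using h'
  refine tendsto_of_tendsto_of_tendsto_of_le_of_le (key (-b)) (key a) (fun n => ?_) ha
  have h3 : ((b / n : ℝ) : EReal) = b / (n : EReal) := by
    rw [EReal.coe_div, EReal.coe_natCast]
  have h4 : ((-b : ℝ) : EReal) / (n : EReal) = -((b / n : ℝ) : EReal) := by
    rw [← EReal.coe_neg, ← neg_div, EReal.coe_div, EReal.coe_natCast]
  rw [h4, add_comm, ← sub_eq_add_neg]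
  refine EReal.sub_le_of_le_add ?_
  rw [h3, add_comm]
  exact hb n

/-- Fekete's lemma with values in the extended real numbers. -/
lemma Subadditive.exists_tendsto {u : ℕ → ℝ} (hu : Subadditive u) :
    ∃ l : EReal, Tendsto (fun n : ℕ => ((u n / n : ℝ) : EReal)) atTop (𝓝 l) := by
  -- The infimum is taken in the extended reals, so no lower bound is required and the limit may be
  -- `-∞`.
  refine ⟨⨅ n : {n : ℕ // n ≠ 0}, ((u n / n : ℝ) : EReal), tendsto_order.2 ⟨fun a ha => ?_,
    fun a ha => ?_⟩⟩
  · filter_upwards [eventually_ne_atTop 0] with n hn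
    exact ha.trans_le (iInf_le (fun n : {n : ℕ // n ≠ 0} => ((u n / n : ℝ) : EReal)) ⟨n, hn⟩)
  · obtain ⟨⟨n, hn⟩, h⟩ := iInf_lt_iff.1 ha
    obtain ⟨b, hb, hba⟩ := EReal.lt_iff_exists_real_btwn.1 h
    filter_upwards [hu.eventually_div_lt_of_div_lt hn (EReal.coe_lt_coe_iff.1 hb)] with m hm
    exact (EReal.coe_lt_coe_iff.2 hm).trans hba

lemma ENNReal.exists_tendsto_log_div {u : ℕ → ℝ≥0∞} (h0 : ∀ n, u n ≠ 0) (htop : ∀ n, u n ≠ ⊤)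
    (h : ∀ m n, u (m + n) ≤ u m * u n) :
    ∃ l : EReal, Tendsto (fun n : ℕ => ENNReal.log (u n) / (n : EReal)) atTop (𝓝 l) := by
  have hu : Subadditive fun n => Real.log (u n).toReal := fun m n => by
    rw [← EReal.coe_le_coe_iff, EReal.coe_add, ← ENNReal.log_pos_real (h0 _) (htop _),
      ← ENNReal.log_pos_real (h0 _) (htop _), ← ENNReal.log_pos_real (h0 _) (htop _),
      ← ENNReal.log_mul_add]
    exact ENNReal.log_monotone (h m n)
  obtain ⟨l, hl⟩ := hu.exists_tendsto
  refine ⟨l, hl.congr fun n => ?_⟩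
  rw [ENNReal.log_pos_real (h0 n) (htop n), EReal.coe_div, EReal.coe_natCast]

/-- If `N n t` is a sum of at most exponentially many exponentials of `t`, with largest exponent
`α n * t`, then the growth rate of `N` is asymptotically linear in `t`. -/
lemma tendsto_growth_div {N : ℕ → ℝ → ℝ≥0∞} {α : ℕ → ℝ} {h : ℝ → EReal} {c : ℝ} (hc : 0 ≤ c)
    (hα : ∀ n t, 0 < t → ENNReal.ofReal (Real.exp (α n * t)) ≤ N n t)
    (hN : ∀ n t, 0 < t → N n t ≤ ENNReal.ofReal (Real.exp (α n * t + c * (n + 1))))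
    (hlim : ∀ t, Tendsto (fun n : ℕ => ENNReal.log (N n t) / (n : EReal)) atTop (𝓝 (h t))) :
    Tendsto (fun t : ℝ => h t / (t : EReal)) atTop
      (𝓝 (limsup (fun n : ℕ => ((α n / n : ℝ) : EReal)) atTop)) := by
  set s := limsup (fun n : ℕ => ((α n / n : ℝ) : EReal)) atTop
  have hlog : ∀ x : ℝ, ENNReal.log (ENNReal.ofReal (Real.exp x)) = x := fun x => by
    rw [ENNReal.log_ofReal_of_pos (Real.exp_pos x), Real.log_exp]
  have hlim' : ∀ t : ℝ, 0 < t → Tendsto (fun n : ℕ => ENNReal.log (N n t) / (n : EReal) / (t : EReal))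
      atTop (𝓝 (h t / t)) := fun t ht => by
    have := EReal.Tendsto.mul_const (b := ((t⁻¹ : ℝ) : EReal)) (hlim t) (.inr (by simp))
      (.inr (by simp)) 
    simpa only [div_eq_mul_inv, EReal.coe_inv] using this
  -- For fixed `t` the limit over `n` is also a limsup, so the termwise bounds give `s ≤ h t / t ≤ s
  -- + 2c/t`; the squeeze in `t` follows.
  have hlow : ∀ t : ℝ, 0 < t → s ≤ h t / t := fun t ht => by
    rw [← (hlim' t ht).limsup_eq]
    refine limsup_le_limsup ?_
    filter_upwards [eventually_ne_atTop 0] with n hn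
    have h1 := ENNReal.log_monotone (hα n t ht)
    rw [hlog] at h1
    have h2 := EReal.div_le_div_right_of_nonneg (EReal.coe_nonneg.2 ht.le)
      (EReal.div_le_div_right_of_nonneg (EReal.zero_le_natCast n) h1)
    refine le_trans (le_of_eq ?_) h2
    rw [← EReal.coe_natCast, ← EReal.coe_div, ← EReal.coe_div]
    congr 1
    field_simp
  have hupp : ∀ t : ℝ, 0 < t → h t / t ≤ s + ((2 * c / t : ℝ) : EReal) := fun t ht => by
    rw [← EReal.sub_le_iff_le_add (by simp) (by simp)]
    have h1 : Tendsto (fun n : ℕ => ENNReal.log (N n t) / (n : EReal) / (t : EReal) -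
        ((2 * c / t : ℝ) : EReal)) atTop (𝓝 (h t / t - ((2 * c / t : ℝ) : EReal))) := by
      have := (EReal.continuousAt_add (p := (h t / t, ((-(2 * c / t) : ℝ) : EReal))) (by simp)
        (by simp)).tendsto.comp ((hlim' t ht).prodMk_nhds tendsto_const_nhds)
      simpa only [sub_eq_add_neg, EReal.coe_neg, Function.comp_def] using this
    rw [← h1.limsup_eq]
    refine limsup_le_limsup ?_
    filter_upwards [eventually_ge_atTop 1] with n hn
    have hn' : (1 : ℝ) ≤ n := by exact_mod_cast hn
    have h2 := ENNReal.log_monotone (hN n t ht)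
    rw [hlog] at h2
    have h3 := EReal.div_le_div_right_of_nonneg (EReal.coe_nonneg.2 ht.le)
      (EReal.div_le_div_right_of_nonneg (EReal.zero_le_natCast n) h2)
    refine EReal.sub_le_of_le_add (h3.trans ?_)
    rw [← EReal.coe_natCast, ← EReal.coe_div, ← EReal.coe_div, ← EReal.coe_add,
      EReal.coe_le_coe_iff]
    -- The `2` comes from `n + 1 ≤ 2n` for `n ≥ 1`.
    have h4 : c * (n + 1) / n ≤ 2 * c := by
      rw [div_le_iff₀ (by linarith)]
      nlinarith
    calc (α n * t + c * (n + 1)) / n / t = α n / n + c * (n + 1) / n / t := by field_simp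
      _ ≤ α n / n + 2 * c / t := by gcongr
  refine tendsto_of_tendsto_of_tendsto_of_le_of_le' tendsto_const_nhds ?_
    ((eventually_gt_atTop 0).mono hlow) ((eventually_gt_atTop 0).mono hupp)
  have h5 : Tendsto (fun t : ℝ => ((2 * c / t : ℝ) : EReal)) atTop (𝓝 ((0 : ℝ) : EReal)) :=
    EReal.tendsto_coe.2 (tendsto_const_nhds.div_atTop tendsto_id)
  have h6 := (EReal.continuousAt_add (p := (s, ((0 : ℝ) : EReal))) (by simp)
    (by simp)).tendsto.comp (tendsto_const_nhds.prodMk_nhds h5)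
  simpa [Function.comp_def] using h6

lemma limsup_div_le {α : ℕ → ℝ} {g c : ℝ} (h : ∀ n, α n ≤ n * g + c) :
    limsup (fun n : ℕ => ((α n / n : ℝ) : EReal)) atTop ≤ g := by
  have h1 : Tendsto (fun n : ℕ => ((g + c / n : ℝ) : EReal)) atTop (𝓝 ((g + 0 : ℝ) : EReal)) :=
    EReal.tendsto_coe.2 (tendsto_const_nhds.add (tendsto_const_div_atTop_nhds_zero_nat c))
  rw [add_zero] at h1
  rw [← h1.limsup_eq]
  refine limsup_le_limsup ?_
  filter_upwards [eventually_gt_atTop 0] with n hn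
  have hn' : (0 : ℝ) < n := by exact_mod_cast hn
  rw [EReal.coe_le_coe_iff, div_le_iff₀ hn', add_mul, div_mul_cancel₀ _ hn'.ne', mul_comm]
  exact h n

end Growth

lemma isZero_of_iterate {T : Type u} [Category.{v} T] [Preadditive T] (S : T ⥤ T) [S.IsEquivalence] {G : T}
    {n : ℕ} (h : IsZero (S.obj^[n] G)) : IsZero G := by
  induction n with
  | zero => exact h
  | succ n ih =>
    rw [Function.iterate_succ_apply'] at h
    exact ih ((IsZero.iff_id_eq_zero _).2 (S.map_injective (h.eq_of_tgt _ _)))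

/-- Passing through `S^m G`: the exact functor `S^m` does not increase the complexity of `S^n G`
relative to `G`. -/
lemma complexity_iterate_add_le {T : Type u} [Category.{v} T] [Preadditive T] [HasZeroObject T]
    [HasShift T ℤ] [∀ n : ℤ, (shiftFunctor T n).Additive] [Pretriangulated T] [IsTriangulated T]
    (S : T ⥤ T) [S.CommShift ℤ] [S.IsTriangulated] {G : T} (hG : IsSplitGenerator G) (t : ℝ) (m n : ℕ) :
    complexity t G (S.obj^[m + n] G) ≤
      complexity t G (S.obj^[m] G) * complexity t G (S.obj^[n] G) := by
  have h := complexity_iterate_le t G (S.obj^[n] G) S m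
  rw [← Function.iterate_add_apply] at h
  exact (complexity_trans (hG.complexity_ne_top _ _)
    (ne_top_of_le_ne_top (hG.complexity_ne_top _ _) h)).trans (mul_le_mul_right h _)

/-! ### Entropy and the upper Serre dimension through cohomology. -/

section SerreDimension

variable {T : Type u} [Category.{v} T] [Preadditive T] [Linear ℂ T] [HasZeroObject T]
  [HasShift T ℤ] [∀ n : ℤ, (shiftFunctor T n).Additive] [Pretriangulated T] [IsTriangulated T]
  {A : DGAlgebra.{w}} (e : PerfEquivalence T A)

open DerivedCat DGModule

namespace PerfEquivalence

/-- At `t = 0` the weight of a tower is its number of factors, so complexity below `1` forces an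
empty tower, and the object is a summand of zero. -/
lemma isZero_of_poincare_eq_zero (hsmooth : A.IsSmooth) (hA : A.IsProper) {G : T}
    (i : e.functor.obj G ≅ (Q A).obj (free A)) {t : ℝ} {E : T} (h : e.poincare t E = 0) :
    IsZero E := by
  have hb : ∀ k, e.betti k E = 0 := fun k => by
    have h' := ENNReal.tsum_eq_zero.1 h k
    simpa [(Real.exp_pos _).not_ge] using h'
  obtain ⟨C, -, hC⟩ := e.exists_complexity_le_poincare hsmooth hA i 0
  have h0 : complexity 0 G E < 1 := (hC E).trans_lt (by simp [poincare, hb])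
  obtain ⟨L, ⟨M, hL⟩, hL1⟩ := complexity_lt_iff.1 h0
  have hL0 : L = [] := by
    rw [ENNReal.ofReal_lt_one] at hL1
    simpa using hL1
  subst hL0
  replace hL : IsTower [] (E ⊞ M) := hL
  generalize hl : ([] : List T) = l at hL
  cases hL with
  | zero h0 =>
    rw [IsZero.iff_id_eq_zero, ← biprod.inl_fst (X := E) (Y := M), h0.eq_of_tgt biprod.inl 0,
      zero_comp]
  | step => simp at hl

variable (S : T ⥤ T)

/-- If `G` vanishes, so does all of `T`; every complexity is `0`, and its logarithm `-∞` survives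
both divisions. -/
lemma isUpperSerreDim_bot (hsmooth : A.IsSmooth) (hA : A.IsProper) {G : T}
    (i : e.functor.obj G ≅ (Q A).obj (free A)) (hG0 : IsZero G) : IsUpperSerreDim S ⊥ := by
  have hG := e.isSplitGenerator i
  have hzero : ∀ E : T, IsZero E := fun E => by
    obtain ⟨L, hL⟩ := hG.exists_built E
    refine e.isZero_of_poincare_eq_zero hsmooth hA i (t := 0) (le_zero_iff.1
      ((e.poincare_le_of_built i 0 hL).trans ?_))
    rw [e.poincare_eq_zero_of_isZero i 0 hG0, zero_mul]
  refine ⟨fun _ => ⊥, ⟨⟨G, hG⟩, fun G' _ t => ?_⟩, ?_⟩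
  · refine tendsto_const_nhds.congr' ?_
    filter_upwards [eventually_gt_atTop 0] with n hn
    have h0 : complexity t G' (S.obj^[n] G') = 0 := by
      simpa using complexity_le_of_built (t := t) (Built.of_isZero (Y := G') (hzero (S.obj^[n] G')))
    rw [h0, ENNReal.log_zero, ← EReal.coe_natCast,
      EReal.bot_div_of_pos_ne_top (by exact_mod_cast hn) (EReal.coe_ne_top _)]
  · refine tendsto_const_nhds.congr' ?_
    filter_upwards [eventually_gt_atTop 0] with t ht
    rw [EReal.bot_div_of_pos_ne_top (by exact_mod_cast ht) (EReal.coe_ne_top _)]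

variable [S.CommShift ℤ] [S.IsTriangulated]

/-- The entropy of an autoequivalence is the growth rate of the cohomology. -/
lemma exists_isEntropy [S.IsEquivalence] (hsmooth : A.IsSmooth) (hA : A.IsProper) {G : T}
    (i : e.functor.obj G ≅ (Q A).obj (free A)) (hG0 : ¬ IsZero G) :
    ∃ h : ℝ → EReal, IsEntropy S h ∧ ∀ t : ℝ, Tendsto (fun n : ℕ =>
      ENNReal.log (e.poincare t (S.obj^[n] G)) / (n : EReal)) atTop (𝓝 (h t)) := by
  have hG := e.isSplitGenerator i
  have htop := fun t E => hG.complexity_ne_top t E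
  have hupper : ∀ (t : ℝ) (E : T), e.poincare t E ≤ e.poincare t G * complexity t G E :=
    fun t E => e.poincare_le_mul_complexity i t (e.poincare_ne_top hA i t G) (htop t E)
  have hlim : ∀ t, ∃ l : EReal, Tendsto (fun n : ℕ =>
      ENNReal.log (e.poincare t (S.obj^[n] G)) / (n : EReal)) atTop (𝓝 l) := fun t => by
    obtain ⟨C, hC, hCE⟩ := e.exists_complexity_le_poincare hsmooth hA i t
    -- Fekete's lemma applies to the submultiplicative complexities, which are nonzero because `S^n
    -- G` is; the two-sided comparison then transfers the limit to `P_t`.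
    obtain ⟨l, hl⟩ := ENNReal.exists_tendsto_log_div
      (u := fun n => complexity t G (S.obj^[n] G))
      (fun n h0 => hG0 (isZero_of_iterate S (n := n) (e.isZero_of_poincare_eq_zero hsmooth hA i
        (t := t) (le_zero_iff.1 ((hupper t _).trans (by rw [h0, mul_zero]))))))
      (fun n => htop t _) (fun m n => complexity_iterate_add_le S hG t m n)
    exact ⟨l, ENNReal.tendsto_log_div_of_le (e.poincare_ne_top hA i t G) hC
      (fun n => hupper t _) (fun n => hCE _) hl⟩
  choose h hh using hlim
  refine ⟨h, ⟨⟨G, hG⟩, fun G' hG' t => ?_⟩, hh⟩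
  obtain ⟨C, hC, hCE⟩ := e.exists_complexity_le_poincare hsmooth hA i t
  have h₁ := hG'.complexity_ne_top t G
  have h₂ := hG.complexity_ne_top t G'
  have hit : ∀ {E E' : T} (_ : complexity t E E' ≠ ⊤) (n : ℕ),
      complexity t (S.obj^[n] E) (S.obj^[n] E') ≠ ⊤ := fun h n =>
    ne_top_of_le_ne_top h (complexity_iterate_le t _ _ S n)
  -- Changing the generator costs the complexities of `G` and `G'` relative to each other; applying
  -- `S^n` does not increase them, so the constants do not depend on `n`.
  refine ENNReal.tendsto_log_div_of_le
    (C := complexity t G' G * C * complexity t G G')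
    (c := e.poincare t G * complexity t G G' * complexity t G' G)
    (ENNReal.mul_ne_top (ENNReal.mul_ne_top h₁ hC) h₂)
    (ENNReal.mul_ne_top (ENNReal.mul_ne_top (e.poincare_ne_top hA i t G) h₂) h₁)
    (fun n => ?_) (fun n => ?_) (hh t)
  · calc complexity t G' (S.obj^[n] G')
        ≤ complexity t G' G * complexity t G (S.obj^[n] G') := complexity_trans h₁ (htop t _)
      _ ≤ complexity t G' G * (complexity t G (S.obj^[n] G) *
          complexity t (S.obj^[n] G) (S.obj^[n] G')) := by
        gcongr
        exact complexity_trans (htop t _) (hit h₂ n)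
      _ ≤ complexity t G' G * ((C * e.poincare t (S.obj^[n] G)) * complexity t G G') := by
        gcongr
        · exact hCE _
        · exact complexity_iterate_le t _ _ S n
      _ = _ := by ring
  · calc e.poincare t (S.obj^[n] G)
        ≤ e.poincare t G * complexity t G (S.obj^[n] G) := hupper t _
      _ ≤ e.poincare t G * (complexity t G G' * (complexity t G' (S.obj^[n] G') *
          complexity t (S.obj^[n] G') (S.obj^[n] G))) := by
        gcongr
        refine (complexity_trans h₂ (hG'.complexity_ne_top t _)).trans ?_
        gcongr
        exact complexity_trans (hG'.complexity_ne_top t _) (hit h₁ n)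
      _ ≤ e.poincare t G * (complexity t G G' * (complexity t G' (S.obj^[n] G') *
          complexity t G' G)) := by
        gcongr
        exact complexity_iterate_le t _ _ S n
      _ = _ := by ring

/-- The total Betti number of `S^n G` is at most a constant times the `n`-th power of the complexity
of `S G`, by submultiplicativity at `t = 0`. -/
lemma exists_poincare_zero_le (hA : A.IsProper) {G : T}
    (i : e.functor.obj G ≅ (Q A).obj (free A)) :
    ∃ c : ℝ, 0 ≤ c ∧ ∀ n : ℕ, e.poincare 0 (S.obj^[n] G) ≤
      ENNReal.ofReal (Real.exp (c * (n + 1))) := by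
  have hG := e.isSplitGenerator i
  have hN := e.poincare_ne_top hA i 0 G
  set N := e.poincare 0 G * complexity 0 G G
  set D := complexity 0 G (S.obj^[1] G)
  have hNt : N ≠ ⊤ := ENNReal.mul_ne_top hN (hG.complexity_ne_top _ _)
  have hDt : D ≠ ⊤ := hG.complexity_ne_top _ _
  have hpow : ∀ n : ℕ, complexity 0 G (S.obj^[n] G) ≤ complexity 0 G G * D ^ n := fun n => by
    induction n with
    | zero => simp
    | succ n ih =>
      refine (complexity_iterate_add_le S hG 0 n 1).trans ?_
      rw [pow_succ, ← mul_assoc]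
      exact mul_le_mul_left ih _
  have hle : ∀ x : ℝ≥0∞, x ≠ ⊤ → ∀ c, x.toReal ≤ c → x ≤ ENNReal.ofReal (Real.exp c) := by
    intro x hx c hc
    rw [ENNReal.le_ofReal_iff_toReal_le hx (Real.exp_pos c).le]
    linarith [Real.add_one_le_exp c]
  refine ⟨N.toReal + D.toReal, by positivity, fun n => ?_⟩
  refine (e.poincare_le_mul_complexity i 0 hN (hG.complexity_ne_top _ _)).trans ?_
  refine (mul_le_mul_right (hpow n) _).trans ?_
  rw [← mul_assoc, mul_add_one, add_comm, Real.exp_add, ENNReal.ofReal_mul (Real.exp_pos _).le,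
    mul_comm _ (n : ℝ), Real.exp_nat_mul, ENNReal.ofReal_pow (Real.exp_pos _).le]
  gcongr
  · exact hle N hNt _ (le_add_of_nonneg_right ENNReal.toReal_nonneg)
  · exact hle D hDt _ (le_add_of_nonneg_left ENNReal.toReal_nonneg)

/-- The upper Serre dimension is the growth rate of the lowest degree of the cohomology of the
iterates. -/
lemma exists_isUpperSerreDim [S.IsEquivalence] (hsmooth : A.IsSmooth) (hA : A.IsProper) {G : T}
    (i : e.functor.obj G ≅ (Q A).obj (free A)) (hG0 : ¬ IsZero G) :
    ∃ k : ℕ → ℤ, (∀ n, e.betti (k n) (S.obj^[n] G) ≠ 0) ∧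
      IsUpperSerreDim S (limsup (fun n : ℕ => ((-(k n : ℝ) / n : ℝ) : EReal)) atTop) := by
  have hk : ∀ n : ℕ, ∃ k : ℤ, e.betti k (S.obj^[n] G) ≠ 0 ∧
      ∀ l : ℤ, e.betti l (S.obj^[n] G) ≠ 0 → k ≤ l := fun n => by
    have hne : {k : ℤ | e.betti k (S.obj^[n] G) ≠ 0}.Nonempty := by
      by_contra hne
      rw [Set.not_nonempty_iff_eq_empty] at hne
      have hb : ∀ k, e.betti k (S.obj^[n] G) = 0 := fun k => by
        by_contra hb
        exact (Set.eq_empty_iff_forall_notMem.1 hne k) hb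
      exact hG0 (isZero_of_iterate S (n := n) (e.isZero_of_poincare_eq_zero hsmooth hA i (t := 0)
        (by simp [poincare, hb])))
    obtain ⟨k, hk, hmin⟩ := Set.exists_min_image _ id (e.finite_betti_ne_zero hA i _) hne
    exact ⟨k, hk, hmin⟩
  choose k hk hmin using hk
  obtain ⟨h, hh, hlim⟩ := e.exists_isEntropy S hsmooth hA i hG0
  obtain ⟨c, hc, hcN⟩ := e.exists_poincare_zero_le S hA i
  refine ⟨k, hk, h, hh, tendsto_growth_div hc (fun n t ht => ?_) (fun n t ht => ?_) hlim⟩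
  · refine le_trans ?_ (ENNReal.le_tsum (k n))
    have h1 : (1 : ℝ≥0∞) ≤ e.betti (k n) (S.obj^[n] G) := by
      simpa using ENat.toENNReal_le.2 (Order.one_le_iff_ne_zero.2 (hk n))
    simpa using mul_le_mul_left h1 (ENNReal.ofReal (Real.exp (-(k n : ℝ) * t)))
  -- For `t > 0` every occurring degree `l ≥ k n` has weight at most `e^{-(k n) t}`, and the
  -- remaining sum of Betti numbers is `P_0`.
  · rw [Real.exp_add, ENNReal.ofReal_mul (Real.exp_pos _).le]
    refine le_trans ?_ (mul_le_mul_right (hcN n) _)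
    rw [poincare, poincare, ← ENNReal.tsum_mul_left]
    refine ENNReal.tsum_le_tsum fun l => ?_
    by_cases hl : e.betti l (S.obj^[n] G) = 0
    · simp [hl]
    · rw [mul_zero, Real.exp_zero, ENNReal.ofReal_one, mul_one, mul_comm]
      gcongr
      exact hmin n l hl

end PerfEquivalence

end SerreDimension

end

theorem theorem4p2 {A : DGAlgebra.{w}} (hsmooth : A.IsSmooth) (hproper : A.IsProper)
    {T : Type u} [Category.{v} T] [Preadditive T] [Linear ℂ T] [HasZeroObject T] [HasShift T ℤ]
    [∀ n : ℤ, (shiftFunctor T n).Additive] [∀ n : ℤ, (shiftFunctor T n).Linear ℂ]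
    [Pretriangulated T] [IsTriangulated T] (e : PerfEquivalence T A)
    (S : T ⥤ T) [S.IsEquivalence] [S.CommShift ℤ] [S.IsTriangulated] (hS : IsSerreFunctor S) :
    ∃ s : EReal, IsUpperSerreDim S s ∧
      ∀ {Λ : Type*} [AddCommGroup Λ] [Module.Free ℤ Λ] [Module.Finite ℤ Λ]
        (v : GrothendieckGroup T →+ Λ) (_ : Function.Surjective v)
        (N : Seminorm ℝ (ℝ ⊗[ℤ] Λ)) (_ : ∀ x, N x = 0 → x = 0),
        (∀ σ : StabilityCondition v N, s ≤ σ.gldim) ∧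
          s ≤ ⨅ σ : StabilityCondition v N, σ.gldim := by
  obtain ⟨G, ⟨i⟩⟩ := e.exists_iso DerivedCat.IsPerfect.free
  suffices h : ∃ s : EReal, IsUpperSerreDim S s ∧
      ∀ {Λ : Type _} [AddCommGroup Λ] (v : GrothendieckGroup T →+ Λ)
        (N : Seminorm ℝ (ℝ ⊗[ℤ] Λ)) (σ : StabilityCondition v N), s ≤ σ.gldim by
    obtain ⟨s, hs, hle⟩ := h
    exact ⟨s, hs, fun v _ N _ => ⟨hle v N, le_iInf (hle v N)⟩⟩
  by_cases hG0 : IsZero G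
  · exact ⟨⊥, e.isUpperSerreDim_bot S hsmooth hproper i hG0, fun _ _ _ => bot_le⟩
  obtain ⟨k, hk, hs⟩ := e.exists_isUpperSerreDim S hsmooth hproper i hG0
  refine ⟨_, hs, fun v N σ => ?_⟩
  -- This excludes the value `-∞` of the supremum; the value `+∞` needs no argument.
  have hnonneg := σ.gldim_nonneg hG0
  induction hg : σ.gldim with
  | bot => simp [hg] at hnonneg
  | top => exact le_top
  | coe g =>
    obtain ⟨c, hc⟩ := σ.exists_forall_betti_ne_zero e i hS hg.le
    exact limsup_div_le fun n => hc n (k n) (hk n)
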